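/- **Meshes.** Let $\Delta$ be an abstract simplicial complex with vertex set $V=\{1,\dots,N_V\}$ that is non-empty, pure of dimension $2$ (every face lies in a $2$-face) and $2$-path connected (any two distinct $2$-faces are joined by a finite sequence of $2$-faces, consecutive members of which intersect in a $1$-face). Let $\Delta$ be consistently oriented, and let its $2$-faces be numbered $k=1,\dots,N_T$, with vertices $i_0^k,i_1^k,i_2^k$ in the order given by the orientation. For $Q=(q_1,\dots,q_{N_V})\in(\mathbb R^2)^{N_V}$ put $$A_Q(i_0,i_1,i_2)=\tfrac12\det[\,q_{i_1}-q_{i_0},\ q_{i_2}-q_{i_1}],\qquad E^\ell_Q(i_0,i_1,i_2)=\|q_{i_{\ell\oplus1}}-q_{i_{\ell\oplus2}}\|,\quad \ell=0,1,2,$$ where $\oplus$ is addition modulo $3$ and $\|\cdot\|$ is the Euclidean norm. Let $\mathcal M_+$ be the set of all $Q$ such that $q_1,\dots,q_{N_V}$ are pairwise distinct, the sets $\operatorname{conv}\{q_i : i\in\sigma\}$, $\sigma\in\Delta$, form a geometric simplicial complex in $\mathbb R^2$ in which $\operatorname{conv}\{q_i:i\in\sigma\}$ is a simplex with vertices $q_i$,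 $i\in\sigma$, and $A_Q(i_0^k,i_1^k,i_2^k)>0$ for all $k$. Fix $Q_{\rm ref}\in\mathcal M_+$. The manifold of planar triangular meshes $\mathcal M_0$ is the set of all $Q\in\mathcal M_+$ that can be joined to $Q_{\rm ref}$ by a continuous path in $\mathcal M_+$. For $Q\in\mathcal M_0$ let $\Omega_Q$ be the union of the triangles of the mesh, let $S^1(\Omega_Q)$ be the space of continuous functions on $\Omega_Q$ that are affine on each triangle, and let $S^1_0(\Omega_Q)$ be the subspace of those that vanish on $\partial\Omega_Q$. **Penalty.** Let $E_\partial$ be the set of boundary edges (the $1$-faces that lie in exactly one $2$-face), each written $[j_0,j_1]$ in the orientation induced by its triangle, and let $V_\partial$ be the set of their vertices. Let $\|\cdot\|_{1,\mu}:\mathbb R^2\to\mathbb R$ be a regularized $1$-norm, that is, a function of class $C^3$ with $0\le\|v\|_{1,\mu}\le|v_1|+|v_2|$ for all $v$ and $\|v\|_{1,\mu}=0$ only for $v=0$. For an edge $[j_0,j_1]$ and a vertex $i_0\neq j_0,j_1$ let $$d_Q(i_0;[j_0,j_1])=\min\{\|q_{i_0}-q\|_{1,\mu} : q\in\operatorname{conv}\{q_{j_0},q_{j_1}\}\},$$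 where $\|\cdot\|_{1,\mu}$ is applied to the coordinates in the orthonormal frame whose first vector is $(q_{j_1}-q_{j_0})/\|q_{j_1}-q_{j_0}\|$ and whose second vector is the first one rotated by $+90^\circ$. For $\alpha_1,\alpha_2,\alpha_3,\alpha_4>0$ let $$\varphi(Q)=\sum_{k=1}^{N_T}\frac1{N_T}\frac{\alpha_1}{\psi_Q(i_0^k,i_1^k,i_2^k)}+\frac{\alpha_2}{\sum_{k=1}^{N_T}A_Q(i_0^k,i_1^k,i_2^k)}+\sum_{[j_0,j_1]\in E_\partial}\ \sum_{\substack{i_0\in V_\partial\\ i_0\ne j_0,j_1}}\frac{\alpha_3}{\#E_\partial\,\#V_\partial}\,\chi\!\left(\frac1{d_Q(i_0;[j_0,j_1])}\right)+\frac{\alpha_4}2\sum_{i=1}^{N_V}\|q_i-q_{{\rm ref},i}\|^2,$$ where $$\frac1{\psi_Q}=\frac{(E_Q^0)^2+(E_Q^1)^2+(E_Q^2)^2}{4\sqrt3\,A_Q},$$ and where either $\chi(s)=s$ for all $s$ (no cut-off), or $\chi$ is a cut-off function: it is of class $C^3$ on $[0,\infty)$ and there are $0<\underline s<\overline s$ such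 that $\chi(s)=0$ for $0\le s\le\underline s$ and $\chi(s)=s$ for $s>\overline s$. **Claim.** Let $\underline a<\overline a$, $\underline b<\overline b$, $B=[\underline a,\overline a]\times[\underline b,\overline b]$ and $D=\{Q\in\mathcal M_0 : q_i\in B\text{ for all }i\}$. Let $I_D(Q)=0$ for $Q\in D$ and $I_D(Q)=+\infty$ otherwise. Assume that $Q_{\rm ref}\in D$, and let $r:\mathbb R^2\to\mathbb R$ be a function with $r|_B\in L^\infty(B)$. Then the problem $$\text{minimize}\quad \int_{\Omega_Q}y\,dx+I_D(Q)+\varphi(Q)\quad\text{over } Q\in\mathcal M_0,\ y\in S^1_0(\Omega_Q)$$ $$\text{subject to}\quad \int_{\Omega_Q}\nabla y\cdot\nabla v\,dx=\int_{\Omega_Q}r\,v\,dx\quad\text{for all } v\in S^1_0(\Omega_Q)$$ has at least one globally optimal solution $(Q,y)$ with $Q\in\mathcal M_0$, and the optimal value is finite. -/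

import Mathlib

open MeasureTheory
open scoped ENNReal

noncomputable section

/-- The Euclidean plane. -/
abbrev Plane : Type := EuclideanSpace ℝ (Fin 2)

/-- An oriented connectivity complex on the vertex set `{0, …, NV - 1}` with `NT` numbered
triangles. The `k`-th triangle has the vertices `tri k 0, tri k 1, tri k 2`, listed in the order
that gives its orientation. -/
structure OrientedConnectivityComplex (NV NT : ℕ) where
  /-- the underlying abstract simplicial complex -/
  complex : AbstractSimplicialComplex (Fin NV)
  nonempty : complex.faces.Nonempty
  /-- every face is contained in a `2`-face (so that all faces have dimension at most `2`) -/
  pure : ∀ τ ∈ complex.faces, ∃ σ ∈ complex.faces, σ.card = 3 ∧ τ ⊆ σ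
  /-- any two distinct `2`-faces are joined by a finite sequence of `2`-faces, consecutive members
  of which intersect in a `1`-face -/
  pathConnected : ∀ σ ∈ complex.faces, ∀ σ' ∈ complex.faces, σ.card = 3 → σ'.card = 3 → σ ≠ σ' →
    ∃ (n : ℕ) (s : ℕ → Finset (Fin NV)), s 0 = σ ∧ s n = σ' ∧
      (∀ i ≤ n, s i ∈ complex.faces ∧ (s i).card = 3) ∧
      ∀ i < n, s i ∩ s (i + 1) ∈ complex.faces ∧ (s i ∩ s (i + 1)).card = 2
  /-- the (ordered) vertices of the numbered triangles -/
  tri : Fin NT → Fin 3 → Fin NV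
  /-- the numbered triangles are exactly the `2`-faces, each listed once -/
  tri_bijOn : Set.BijOn (fun k => Finset.univ.image (tri k)) Set.univ
    {σ | σ ∈ complex.faces ∧ σ.card = 3}
  /-- two distinct triangles that share an edge induce opposite orientations on it -/
  consistent : ∀ k k' : Fin NT, k ≠ k' → ∀ l l' : Fin 3,
    ¬ (tri k l = tri k' l' ∧ tri k (l + 1) = tri k' (l' + 1))

namespace OrientedConnectivityComplex

variable {NV NT : ℕ} (Δ : OrientedConnectivityComplex NV NT)

/-- A boundary `1`-face: an edge that is contained in exactly one `2`-face. -/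
def IsBoundaryEdge (e : Finset (Fin NV)) : Prop :=
  e ∈ Δ.complex.faces ∧ e.card = 2 ∧ ∃! σ, σ ∈ Δ.complex.faces ∧ σ.card = 3 ∧ e ⊆ σ

open Classical in
/-- The boundary edges `[j₀, j₁]`. Each one occurs exactly once, as the ordered pair given by the
orientation of the only triangle that contains it. -/
def boundaryEdges : Finset (Fin NV × Fin NV) :=
  Finset.univ.filter fun j => Δ.IsBoundaryEdge {j.1, j.2} ∧
    ∃ (k : Fin NT) (l : Fin 3), Δ.tri k l = j.1 ∧ Δ.tri k (l + 1) = j.2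

open Classical in
/-- The boundary vertices: the vertices of the boundary edges. -/
def boundaryVertices : Finset (Fin NV) :=
  Finset.univ.filter fun i => ∃ e, Δ.IsBoundaryEdge e ∧ i ∈ e

end OrientedConnectivityComplex

/-- The signed area of the triangle `a, b, c`, that is `½ det [b - a, c - b]`. -/
def signedArea (a b c : Plane) : ℝ :=
  (1 / 2) * Matrix.det !![(b - a) 0, (c - b) 0; (b - a) 1, (c - b) 1]

section Mesh

variable {NV NT : ℕ} (Δ : OrientedConnectivityComplex NV NT)

/-- The signed area of the `k`-th triangle. -/
def triArea (Q : Fin NV → Plane) (k : Fin NT) : ℝ :=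
  signedArea (Q (Δ.tri k 0)) (Q (Δ.tri k 1)) (Q (Δ.tri k 2))

/-- The length of the edge of the `k`-th triangle opposite to its `l`-th vertex
(addition in `Fin 3` is modulo `3`). -/
def edgeLength (Q : Fin NV → Plane) (k : Fin NT) (l : Fin 3) : ℝ :=
  ‖Q (Δ.tri k (l + 1)) - Q (Δ.tri k (l + 2))‖

/-- The vertex positions `Q` turn the complex into a geometric simplicial complex: distinct vertices
have distinct positions, and the images of the faces are the faces of a simplicial complex in the
plane. -/
def IsGeometricComplex (Q : Fin NV → Plane) : Prop :=
  Function.Injective Q ∧ ∃ K : Geometry.SimplicialComplex ℝ Plane,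
    ∀ s : Finset Plane, s ∈ K.faces ↔ ∃ σ ∈ Δ.complex.faces, (s : Set Plane) = Q '' σ

/-- The admissible oriented meshes with the given connectivity. -/
def plusManifold : Set (Fin NV → Plane) :=
  {Q | IsGeometricComplex Δ Q ∧ ∀ k, 0 < triArea Δ Q k}

/-- The manifold of planar triangular meshes: the admissible oriented meshes that are joined to the
reference mesh by a continuous path of admissible oriented meshes. -/
def planarManifold (Qref : Fin NV → Plane) : Set (Fin NV → Plane) :=
  {Q | Q ∈ plusManifold Δ ∧ JoinedIn (plusManifold Δ) Q Qref}

/-- The `k`-th triangle of the mesh, as a closed subset of the plane. -/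
def meshTriangle (Q : Fin NV → Plane) (k : Fin NT) : Set Plane :=
  convexHull ℝ (Set.range fun l => Q (Δ.tri k l))

/-- The (closed) region covered by the mesh. -/
def meshDomain (Q : Fin NV → Plane) : Set Plane :=
  ⋃ k, meshTriangle Δ Q k

/-- The piecewise linear, globally continuous functions on the mesh. Such a function is
represented by a function on the plane, whose values outside the mesh are irrelevant. -/
def IsP1 (Q : Fin NV → Plane) (y : Plane → ℝ) : Prop :=
  ContinuousOn y (meshDomain Δ Q) ∧
    ∀ k, ∃ A : Plane →ᵃ[ℝ] ℝ, Set.EqOn y A (meshTriangle Δ Q k)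

/-- The functions in `IsP1` with zero boundary values. -/
def IsP1Zero (Q : Fin NV → Plane) (y : Plane → ℝ) : Prop :=
  IsP1 Δ Q y ∧ ∀ x ∈ frontier (meshDomain Δ Q), y x = 0

/-- `y` is the finite element solution on the mesh with right-hand side `r`. The gradients are
classical ones, which exist in the interior of each triangle, hence almost everywhere on the
mesh. -/
def IsDiscreteState (r : Plane → ℝ) (Q : Fin NV → Plane) (y : Plane → ℝ) : Prop :=
  IsP1Zero Δ Q y ∧ ∀ v, IsP1Zero Δ Q v →
    ∫ x in meshDomain Δ Q, inner ℝ (gradient y x) (gradient v x) =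
      ∫ x in meshDomain Δ Q, r x * v x

end Mesh

/-- A regularized `1`-norm on the plane, in coordinates: a function of class `C³` which
vanishes at the origin only and lies between `0` and the `1`-norm. -/
structure IsRegularizedOneNorm (N : ℝ × ℝ → ℝ) : Prop where
  contDiff : ContDiff ℝ 3 N
  nonneg : ∀ v, 0 ≤ N v
  le_oneNorm : ∀ v, N v ≤ |v.1| + |v.2|
  definite : ∀ v, N v = 0 → v = 0

/-- The coordinates of `v` in the orthonormal frame whose first vector is `t = (b - a) / ‖b - a‖`
and whose second vector is `t` rotated by `90°`. -/
def alignedCoords (a b v : Plane) : ℝ × ℝ :=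
  (inner ℝ ((1 / ‖b - a‖) • (b - a)) v,
    inner ℝ ((1 / ‖b - a‖) • (!₂[-(b - a) 1, (b - a) 0] : Plane)) v)

/-- The regularized distance of the point `p` to the edge from `a` to `b`. -/
def regDist (N : ℝ × ℝ → ℝ) (p a b : Plane) : ℝ :=
  sInf ((fun q => N (alignedCoords a b (p - q))) '' segment ℝ a b)

/-- A cut-off function: of class `C³` on `[0, ∞)`, zero on `[0, s₀]`, the identity beyond `s₁`. -/
def IsCutOff (χ : ℝ → ℝ) : Prop :=
  ContDiffOn ℝ 3 χ (Set.Ici 0) ∧ ∃ s₀ s₁ : ℝ, 0 < s₀ ∧ s₀ < s₁ ∧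
    (∀ s ∈ Set.Icc 0 s₀, χ s = 0) ∧ ∀ s, s₁ < s → χ s = s

section Penalty

variable {NV NT : ℕ} (Δ : OrientedConnectivityComplex NV NT)

/-- The reciprocal `1 / ψ_Q` of the quality of the `k`-th triangle. -/
def invQuality (Q : Fin NV → Plane) (k : Fin NT) : ℝ :=
  (edgeLength Δ Q k 0 ^ 2 + edgeLength Δ Q k 1 ^ 2 + edgeLength Δ Q k 2 ^ 2) /
    (4 * Real.sqrt 3 * triArea Δ Q k)

/-- The penalty function. -/
def penalty (N : ℝ × ℝ → ℝ) (α₁ α₂ α₃ α₄ : ℝ) (Qref Q : Fin NV → Plane) : ℝ :=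
  (∑ k, (1 / (NT : ℝ)) * (α₁ * invQuality Δ Q k))
    + α₂ / (∑ k, triArea Δ Q k)
    + (∑ j ∈ Δ.boundaryEdges, ∑ i ∈ Δ.boundaryVertices with i ≠ j.1 ∧ i ≠ j.2,
        (1 / ((Δ.boundaryEdges.card : ℝ) * (Δ.boundaryVertices.card : ℝ))) *
          (α₃ / regDist N (Q i) (Q j.1) (Q j.2)))
    + (α₄ / 2) * ∑ i, ‖Q i - Qref i‖ ^ 2

/-- The penalty function with a cut-off in its third term. -/
def penaltyCutOff (N : ℝ × ℝ → ℝ) (χ : ℝ → ℝ) (α₁ α₂ α₃ α₄ : ℝ)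
    (Qref Q : Fin NV → Plane) : ℝ :=
  (∑ k, (1 / (NT : ℝ)) * (α₁ * invQuality Δ Q k))
    + α₂ / (∑ k, triArea Δ Q k)
    + (∑ j ∈ Δ.boundaryEdges, ∑ i ∈ Δ.boundaryVertices with i ≠ j.1 ∧ i ≠ j.2,
        (α₃ / ((Δ.boundaryEdges.card : ℝ) * (Δ.boundaryVertices.card : ℝ))) *
          χ (1 / regDist N (Q i) (Q j.1) (Q j.2)))
    + (α₄ / 2) * ∑ i, ‖Q i - Qref i‖ ^ 2

/-- The box `[a₁, a₂] × [b₁, b₂]`. -/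
def box (a₁ a₂ b₁ b₂ : ℝ) : Set Plane :=
  {x | x 0 ∈ Set.Icc a₁ a₂ ∧ x 1 ∈ Set.Icc b₁ b₂}

/-- The hold-all: the meshes in the manifold with all vertices in the box. -/
def holdAll (Qref : Fin NV → Plane) (a₁ a₂ b₁ b₂ : ℝ) : Set (Fin NV → Plane) :=
  {Q | Q ∈ planarManifold Δ Qref ∧ ∀ i, Q i ∈ box a₁ a₂ b₁ b₂}

open Classical in
/-- The characteristic function of a set in the sense of optimization: `0` on it and `∞`
elsewhere. -/
def optIndicator {X : Type*} (D : Set X) (x : X) : EReal :=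
  if x ∈ D then 0 else ⊤

/-- The objective `∫ y + I_D(Q) + φ(Q)`. -/
def objective (D : Set (Fin NV → Plane)) (φ : (Fin NV → Plane) → ℝ)
    (Q : Fin NV → Plane) (y : Plane → ℝ) : EReal :=
  ((∫ x in meshDomain Δ Q, y x : ℝ) : EReal) + optIndicator D Q + ((φ Q : ℝ) : EReal)

end Penalty

end

open Filter Topology Set

/-! The proof is the direct method of the calculus of variations. The box makes the vertex positions
of a minimizing sequence relatively compact. What needs work is that a limit mesh stays in the
manifold, that the objective is bounded below, and that the discrete states converge together with
the meshes.

Admissibility is expressed through barycentric weights. Once all signed areas are positive, a mesh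
is a geometric complex exactly when every point has the same weights in all triangles that contain
it (`mem_plusManifold_iff`). The homogeneous form `ConeInjective` of this condition is open, so an
admissible limit of meshes is joined by a segment to meshes of the sequence
(`mem_planarManifold_of_tendsto`).

That the limit is admissible at all is due to the penalty (`mem_plusManifold_of_penalty_le`). The
area term keeps some triangle nondegenerate. By the quality term a triangle of vanishing area would
lose all its edges, which is impossible next to a nondegenerate triangle, and connectedness spreads
nondegeneracy to all triangles. The third term keeps boundary vertices off foreign boundary edges.
Interiors of distinct triangles remain disjoint in the limit. If the triangles around the carrier of
a point cover a neighbourhood of it, disjointness forces the weights to agree; the only other points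
lie on boundary edges, where separation decides (`eventually_mem_star_or_boundary`,
`weightsAgree_of_separated`).

Finite element functions are encoded by nodal values, and the state equation becomes a linear
system. Testing with the state itself, together with an `L¹` Poincaré inequality whose constant
depends on the box only, bounds energy and mean uniformly over the hold-all (`energy_bound`). Hence
the objective is bounded below, and the penalty is bounded along a minimizing sequence. Bounded
energy on nondegenerating meshes bounds the nodal values (`exists_bound_of_energy`); a subsequence
converges, the coefficients of the system converge by dominated convergence, and the limit is a
minimizer (`exists_optimal_mesh`). -/

theorem signedArea_eq (a b c : Plane) : signedArea a b c =
    (1 / 2) * ((b 0 - a 0) * (c 1 - b 1) - (c 0 - b 0) * (b 1 - a 1)) := by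
  simp [signedArea, Matrix.det_fin_two]

/-! ### Barycentric coordinates of a planar triangle. -/

/-- The signed area of a triangle given as a family of vertices. -/
noncomputable def vertexArea (p : Fin 3 → Plane) : ℝ := signedArea (p 0) (p 1) (p 2)

/-- The barycentric coordinates with respect to a triangle. -/
noncomputable def bary (p : Fin 3 → Plane) (l : Fin 3) (x : Plane) : ℝ :=
  signedArea x (p (l + 1)) (p (l + 2)) / vertexArea p

/-- The gradients of the barycentric coordinates. -/
noncomputable def baryGrad (p : Fin 3 → Plane) (l : Fin 3) : Plane :=
  (1 / (2 * vertexArea p)) • !₂[-(p (l + 2) 1 - p (l + 1) 1), p (l + 2) 0 - p (l + 1) 0]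

/-- The open triangle. -/
noncomputable def openTriangle (p : Fin 3 → Plane) : Set Plane := {x | ∀ l, 0 < bary p l x}

theorem plane_ext {x y : Plane} (h0 : x 0 = y 0) (h1 : x 1 = y 1) : x = y := by
  ext i; fin_cases i <;> assumption

theorem signedArea_swap (a b c : Plane) : signedArea a c b = - signedArea a b c := by
  simp only [signedArea_eq]; ring

theorem bary_sum {p : Fin 3 → Plane} (hp : vertexArea p ≠ 0) (x : Plane) :
    ∑ l, bary p l x = 1 := by
  have h : ∑ l : Fin 3, signedArea x (p (l + 1)) (p (l + 2)) = vertexArea p := by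
    simp only [Fin.sum_univ_three, vertexArea, signedArea_eq]
    simp only [Fin.reduceAdd, zero_add]
    ring
  simp only [bary, ← Finset.sum_div, h, div_self hp]

theorem bary_combination {p : Fin 3 → Plane} (hp : vertexArea p ≠ 0) (x : Plane) :
    ∑ l, bary p l x • p l = x := by
  have h : ∀ i : Fin 2, ∑ l : Fin 3, signedArea x (p (l + 1)) (p (l + 2)) * p l i
      = vertexArea p * x i := by
    intro i
    fin_cases i <;> simp only [Fin.sum_univ_three, vertexArea, signedArea_eq] <;>
      simp only [Fin.reduceAdd, zero_add, Fin.zero_eta, Fin.mk_one, Fin.isValue] <;> ring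
  ext i
  have := h i
  simp only [WithLp.ofLp_sum, WithLp.ofLp_smul, Finset.sum_apply, Pi.smul_apply, smul_eq_mul, bary]
  simp only [div_mul_eq_mul_div, ← Finset.sum_div, this]
  field_simp

theorem bary_of_combination {p : Fin 3 → Plane} (hp : vertexArea p ≠ 0) {w : Fin 3 → ℝ}
    (hw : ∑ l, w l = 1) (l : Fin 3) : bary p l (∑ m, w m • p m) = w l := by
  rw [bary, div_eq_iff hp]
  have h2 : w 2 = 1 - w 0 - w 1 := by rw [← hw, Fin.sum_univ_three]; ring
  fin_cases l <;> simp only [Fin.sum_univ_three, vertexArea, signedArea_eq] <;>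
    simp [h2] <;> ring

theorem bary_vertex {p : Fin 3 → Plane} (hp : vertexArea p ≠ 0) (l m : Fin 3) :
    bary p l (p m) = if l = m then 1 else 0 := by
  have := bary_of_combination hp (w := fun i => if i = m then 1 else 0) (by simp) l
  simpa using this

theorem bary_sub (p : Fin 3 → Plane) (l : Fin 3) (x y : Plane) :
    bary p l x - bary p l y = inner ℝ (baryGrad p l) (x - y) := by
  -- For a degenerate triangle division by zero makes both sides vanish.
  by_cases hp : vertexArea p = 0
  · simp [bary, baryGrad, hp]
  simp only [bary, baryGrad, signedArea_eq, inner_smul_left, PiLp.inner_apply, Fin.sum_univ_two]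
  simp
  field_simp
  ring

theorem bary_eq (p : Fin 3 → Plane) (l : Fin 3) (x y : Plane) :
    bary p l x = bary p l y + inner ℝ (baryGrad p l) (x - y) := by
  rw [← bary_sub]; ring

theorem continuous_bary (p : Fin 3 → Plane) (l : Fin 3) : Continuous (bary p l) := by
  have : bary p l = fun x => bary p l 0 + inner ℝ (baryGrad p l) (x - 0) := by
    ext x; exact bary_eq p l x 0
  rw [this]; fun_prop

theorem mem_convexHull_iff_bary {p : Fin 3 → Plane} (hp : vertexArea p ≠ 0) (x : Plane) :
    x ∈ convexHull ℝ (range p) ↔ ∀ l, 0 ≤ bary p l x := by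
  constructor
  · intro hx
    rw [convexHull_range_eq_exists_affineCombination] at hx
    obtain ⟨s, w, h0, h1, rfl⟩ := hx
    intro l
    rw [Finset.affineCombination_eq_linear_combination _ _ _ h1]
    have h2 : ∑ i ∈ s, w i • p i = ∑ i, (if i ∈ s then w i else 0) • p i := by
      simp [ite_smul]
    rw [h2, bary_of_combination hp (by simpa using h1)]
    split_ifs with h
    · exact h0 l h
    · exact le_rfl
  · intro h
    exact mem_convexHull_of_exists_fintype (fun l => bary p l x) p h (bary_sum hp x)
      (fun i => mem_range_self i) (bary_combination hp x)

theorem isOpen_openTriangle (p : Fin 3 → Plane) : IsOpen (openTriangle p) := by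
  simp only [openTriangle, Set.ofPred_forall]
  exact isOpen_iInter_of_finite fun l => isOpen_lt continuous_const (continuous_bary p l)

theorem openTriangle_subset {p : Fin 3 → Plane} (hp : vertexArea p ≠ 0) :
    openTriangle p ⊆ convexHull ℝ (range p) :=
  fun x hx => (mem_convexHull_iff_bary hp x).2 fun l => (hx l).le

/-- Moving a point a little towards the barycentre makes all its coordinates positive. -/
theorem subset_closure_openTriangle {p : Fin 3 → Plane} (hp : vertexArea p ≠ 0) :
    convexHull ℝ (range p) ⊆ closure (openTriangle p) := by
  intro x hx
  rw [mem_convexHull_iff_bary hp] at hx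
  have hw : ∑ l : Fin 3, (1 / 3 : ℝ) = 1 := by norm_num
  set c : Plane := ∑ l, (1 / 3 : ℝ) • p l with hc
  have hcl : ∀ l, bary p l c = 1 / 3 := bary_of_combination hp (w := fun _ => 1 / 3) hw
  have ht : Tendsto (fun t : ℝ => x + t • (c - x)) (𝓝[>] 0) (𝓝 x) := by
    have : Tendsto (fun t : ℝ => x + t • (c - x)) (𝓝 0) (𝓝 (x + (0 : ℝ) • (c - x))) :=
      Continuous.tendsto (by fun_prop) 0
    rw [zero_smul, add_zero] at this
    exact this.mono_left nhdsWithin_le_nhds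
  refine mem_closure_of_tendsto ht ?_
  filter_upwards [Ioo_mem_nhdsGT (show (0 : ℝ) < 1 by norm_num)] with t ht l
  have h1 := bary_sub p l (x + t • (c - x)) x
  have h2 := bary_sub p l c x
  rw [add_sub_cancel_left, inner_smul_right, ← h2, hcl] at h1
  have := hx l
  have h3 : bary p l (x + t • (c - x)) = (1 - t) * bary p l x + t * (1 / 3) := by linarith
  rw [h3]
  have : 0 ≤ (1 - t) * bary p l x := mul_nonneg (by linarith [ht.2]) this
  linarith [ht.1]

theorem baryGrad_ne_zero {p : Fin 3 → Plane} (hp : vertexArea p ≠ 0) (l : Fin 3) :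
    baryGrad p l ≠ 0 := by
  intro h
  have := bary_sub p l (p l) (p (l + 1))
  rw [h, bary_vertex hp, bary_vertex hp] at this
  simp at this

/-- The zero set is an affine subspace that misses the vertex `p l`, hence a null set. -/
theorem volume_bary_eq_zero {p : Fin 3 → Plane} (hp : vertexArea p ≠ 0) (l : Fin 3) :
    volume {x : Plane | bary p l x = 0} = 0 := by
  have hsub : {x : Plane | bary p l x = 0} =
      (AffineSubspace.mk' (p (l + 1)) (LinearMap.ker (innerₛₗ ℝ (baryGrad p l))) : Set Plane) := by
    ext x
    have h1 := bary_sub p l x (p (l + 1))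
    rw [bary_vertex hp] at h1
    simp at h1
    simp [AffineSubspace.mem_mk', h1]
  rw [hsub]
  refine Measure.addHaar_affineSubspace _ _ fun h => ?_
  have h1 : p l ∈ (AffineSubspace.mk' (p (l + 1))
      (LinearMap.ker (innerₛₗ ℝ (baryGrad p l))) : Set Plane) := by
    rw [h]; trivial
  rw [← hsub] at h1
  simp [bary_vertex hp] at h1

theorem volume_convexHull_diff_openTriangle {p : Fin 3 → Plane} (hp : vertexArea p ≠ 0) :
    volume (convexHull ℝ (range p) \ openTriangle p) = 0 := by
  refine measure_mono_null (t := ⋃ l, {x : Plane | bary p l x = 0}) ?_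
    (measure_iUnion_null fun l => volume_bary_eq_zero hp l)
  rintro x ⟨hx, hx'⟩
  rw [mem_convexHull_iff_bary hp] at hx
  simp only [openTriangle, mem_ofPred_eq, not_forall, not_lt] at hx'
  obtain ⟨l, hl⟩ := hx'
  exact mem_iUnion.2 ⟨l, le_antisymm hl (hx l)⟩

theorem isCompact_triangle (p : Fin 3 → Plane) : IsCompact (convexHull ℝ (range p)) :=
  (Set.finite_range p).isCompact_convexHull _

theorem tendsto_vertexArea {α : Type*} {F : Filter α} {P : α → Fin 3 → Plane} {p : Fin 3 → Plane}
    (h : Tendsto P F (𝓝 p)) : Tendsto (fun n => vertexArea (P n)) F (𝓝 (vertexArea p)) := by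
  have : Continuous vertexArea := by
    unfold vertexArea; simp only [signedArea_eq]; fun_prop
  exact (this.tendsto p).comp h

theorem tendsto_baryGrad {α : Type*} {F : Filter α} {P : α → Fin 3 → Plane} {p : Fin 3 → Plane}
    (h : Tendsto P F (𝓝 p)) (hp : vertexArea p ≠ 0) (l : Fin 3) :
    Tendsto (fun n => baryGrad (P n) l) F (𝓝 (baryGrad p l)) := by
  have hA := tendsto_vertexArea h
  have : Continuous fun p : Fin 3 → Plane =>
      (!₂[-(p (l + 2) 1 - p (l + 1) 1), p (l + 2) 0 - p (l + 1) 0] : Plane) := by fun_prop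
  exact (tendsto_const_nhds.div (tendsto_const_nhds.mul hA) (by simpa using hp)).smul
    ((this.tendsto p).comp h)

theorem tendsto_bary {α : Type*} {F : Filter α} {P : α → Fin 3 → Plane} {p : Fin 3 → Plane}
    (h : Tendsto P F (𝓝 p)) (hp : vertexArea p ≠ 0) (l : Fin 3) {X : α → Plane} {x : Plane}
    (hX : Tendsto X F (𝓝 x)) :
    Tendsto (fun n => bary (P n) l (X n)) F (𝓝 (bary p l x)) := by
  have hc : Continuous fun q : (Fin 3 → Plane) × Plane =>
      signedArea q.2 (q.1 (l + 1)) (q.1 (l + 2)) := by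
    simp only [signedArea_eq]; fun_prop
  exact ((hc.tendsto (p, x)).comp (h.prodMk_nhds hX)).div (tendsto_vertexArea h) hp

/-! ### Combinatorics of the connectivity complex. -/

namespace OrientedConnectivityComplex

variable {NV NT : ℕ} (Δ : OrientedConnectivityComplex NV NT)

/-- The vertex set of a numbered triangle. -/
def verts (k : Fin NT) : Finset (Fin NV) := Finset.univ.image (Δ.tri k)

theorem mem_verts {k : Fin NT} {i : Fin NV} : i ∈ Δ.verts k ↔ ∃ l, Δ.tri k l = i := by
  simp [verts]

theorem tri_mem_verts (k : Fin NT) (l : Fin 3) : Δ.tri k l ∈ Δ.verts k := Δ.mem_verts.2 ⟨l, rfl⟩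

theorem verts_mem_faces (k : Fin NT) : Δ.verts k ∈ Δ.complex.faces :=
  (Δ.tri_bijOn.mapsTo (mem_univ k)).1

theorem card_verts (k : Fin NT) : (Δ.verts k).card = 3 := (Δ.tri_bijOn.mapsTo (mem_univ k)).2

theorem tri_injective (k : Fin NT) : Function.Injective (Δ.tri k) := by
  have := Δ.card_verts k
  rw [← injOn_univ, ← Finset.coe_univ, ← Finset.card_image_iff]
  simpa [verts] using this

theorem verts_injective : Function.Injective Δ.verts := fun k k' h =>
  Δ.tri_bijOn.injOn (mem_univ k) (mem_univ k') h

theorem exists_verts_eq {σ : Finset (Fin NV)} (h : σ ∈ Δ.complex.faces) (h3 : σ.card = 3) :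
    ∃ k, Δ.verts k = σ := by
  obtain ⟨k, -, hk⟩ := Δ.tri_bijOn.surjOn ⟨h, h3⟩
  exact ⟨k, hk⟩

theorem exists_subset_verts {σ : Finset (Fin NV)} (h : σ ∈ Δ.complex.faces) :
    ∃ k, σ ⊆ Δ.verts k := by
  obtain ⟨τ, h1, h2, h3⟩ := Δ.pure σ h
  obtain ⟨k, rfl⟩ := Δ.exists_verts_eq h1 h2
  exact ⟨k, h3⟩

theorem exists_mem_verts (i : Fin NV) : ∃ k, i ∈ Δ.verts k := by
  obtain ⟨k, hk⟩ := Δ.exists_subset_verts (Δ.complex.singleton_mem i)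
  exact ⟨k, by simpa using hk⟩

theorem nonempty_triangles (Δ : OrientedConnectivityComplex NV NT) : Nonempty (Fin NT) := by
  obtain ⟨σ, h⟩ := Δ.nonempty
  exact ⟨(Δ.exists_subset_verts h).choose⟩

theorem mem_faces_of_subset {k : Fin NT} {σ : Finset (Fin NV)} (h : σ ⊆ Δ.verts k)
    (hne : σ.Nonempty) : σ ∈ Δ.complex.faces :=
  (Δ.complex.isRelLowerSet_faces (Δ.verts_mem_faces k)).2 h hne

/-- Two distinct vertices of a triangle are the end points of the edge opposite to a vertex. -/
theorem exists_opposite : ∀ a b : Fin 3, a ≠ b →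
    ∃ l : Fin 3, ((a = l + 1 ∧ b = l + 2) ∨ (a = l + 2 ∧ b = l + 1)) := by decide

theorem eq_succ_or_eq_succ : ∀ a b : Fin 3, a ≠ b → b = a + 1 ∨ a = b + 1 := by decide

/-- Connectedness: a property of triangles that passes to adjacent triangles holds for all
triangles if it holds for one. -/
theorem tri_induction (P : Fin NT → Prop)
    (h : ∀ k k' l, P k → Δ.tri k' (l + 1) ∈ Δ.verts k → Δ.tri k' (l + 2) ∈ Δ.verts k → P k')
    {k₀ : Fin NT} (h₀ : P k₀) (k : Fin NT) : P k := by
  by_cases hk : Δ.verts k₀ = Δ.verts k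
  · rwa [← Δ.verts_injective hk]
  obtain ⟨n, s, hs0, hsn, hs, hadj⟩ := Δ.pathConnected _ (Δ.verts_mem_faces k₀) _
    (Δ.verts_mem_faces k) (Δ.card_verts _) (Δ.card_verts _) hk
  -- Induction along the chain of triangles. The edge shared by two consecutive members is written
  -- as the edge opposite to a vertex `l` of the later one.
  have key : ∀ m ≤ n, ∀ k', Δ.verts k' = s m → P k' := by
    intro m
    induction m with
    | zero =>
      intro _ k' hk'
      rwa [Δ.verts_injective (hk'.trans hs0)]
    | succ m ih =>
      intro hm k' hk'
      obtain ⟨k₁, hk₁⟩ := Δ.exists_verts_eq (hs m (by omega)).1 (hs m (by omega)).2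
      have hP := ih (by omega) k₁ hk₁
      have hc := (hadj m (by omega)).2
      rw [← hk₁, ← hk'] at hc
      obtain ⟨a, b, hab, heq⟩ := Finset.card_eq_two.1 hc
      have ha : a ∈ Δ.verts k₁ ∩ Δ.verts k' := by rw [heq]; simp
      have hb : b ∈ Δ.verts k₁ ∩ Δ.verts k' := by rw [heq]; simp
      rw [Finset.mem_inter] at ha hb
      obtain ⟨la, rfl⟩ := Δ.mem_verts.1 ha.2
      obtain ⟨lb, rfl⟩ := Δ.mem_verts.1 hb.2
      obtain ⟨l, ⟨rfl, rfl⟩ | ⟨rfl, rfl⟩⟩ := exists_opposite la lb fun h => hab (by rw [h])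
      · exact h k₁ k' l hP ha.1 hb.1
      · exact h k₁ k' l hP hb.1 ha.1
  exact key n le_rfl k hsn.symm

theorem edge_mem_faces (k : Fin NT) {a b : Fin 3} :
    ({Δ.tri k a, Δ.tri k b} : Finset (Fin NV)) ∈ Δ.complex.faces :=
  Δ.mem_faces_of_subset (k := k) (by
    intro i hi
    simp only [Finset.mem_insert, Finset.mem_singleton] at hi
    rcases hi with rfl | rfl <;> exact Δ.tri_mem_verts _ _) (by simp)

theorem IsBoundaryEdge.unique {Δ : OrientedConnectivityComplex NV NT} {e : Finset (Fin NV)}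
    (h : Δ.IsBoundaryEdge e) {k k' : Fin NT} (hk : e ⊆ Δ.verts k) (hk' : e ⊆ Δ.verts k') :
    k = k' :=
  Δ.verts_injective (h.2.2.unique ⟨Δ.verts_mem_faces k, Δ.card_verts k, hk⟩
    ⟨Δ.verts_mem_faces k', Δ.card_verts k', hk'⟩)

/-- An edge that is not on the boundary lies in a second triangle, and consistent orientation forces
that triangle to run through the edge in the opposite direction. -/
theorem exists_neighbour {k : Fin NT} {l : Fin 3}
    (h : ¬ Δ.IsBoundaryEdge {Δ.tri k l, Δ.tri k (l + 1)}) :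
    ∃ k' l', Δ.tri k' l' = Δ.tri k (l + 1) ∧ Δ.tri k' (l' + 1) = Δ.tri k l := by
  have hne : Δ.tri k l ≠ Δ.tri k (l + 1) := fun h => by
    have := Δ.tri_injective k h; simp at this
  have hex : ∃ k', k ≠ k' ∧ ({Δ.tri k l, Δ.tri k (l + 1)} : Finset (Fin NV)) ⊆ Δ.verts k' := by
    by_contra hcon
    push Not at hcon
    refine h ⟨Δ.edge_mem_faces k, Finset.card_pair hne, Δ.verts k,
      ⟨Δ.verts_mem_faces k, Δ.card_verts k, ?_⟩, ?_⟩
    · intro i hi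
      simp only [Finset.mem_insert, Finset.mem_singleton] at hi
      rcases hi with rfl | rfl <;> exact Δ.tri_mem_verts _ _
    · rintro σ ⟨h1, h2, h3⟩
      obtain ⟨k', rfl⟩ := Δ.exists_verts_eq h1 h2
      by_contra hk
      exact hcon k' (fun h => hk (by rw [h])) h3
  obtain ⟨k', hkk', hsub⟩ := hex
  obtain ⟨a, ha⟩ := Δ.mem_verts.1 (hsub (show Δ.tri k l ∈ _ by simp))
  obtain ⟨b, hb⟩ := Δ.mem_verts.1 (hsub (show Δ.tri k (l + 1) ∈ _ by simp))
  have hab : a ≠ b := fun h => hne (by rw [← ha, ← hb, h])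
  have hcase : b = a + 1 ∨ a = b + 1 := eq_succ_or_eq_succ a b hab
  rcases hcase with rfl | rfl
  · exact (Δ.consistent k k' hkk' l a ⟨ha.symm, hb.symm⟩).elim
  · exact ⟨k', b, hb, ha⟩

theorem IsBoundaryEdge.exists_eq {Δ : OrientedConnectivityComplex NV NT} {e : Finset (Fin NV)}
    (h : Δ.IsBoundaryEdge e) : ∃ k l, e = {Δ.tri k l, Δ.tri k (l + 1)} ∧
      (Δ.tri k l, Δ.tri k (l + 1)) ∈ Δ.boundaryEdges := by
  obtain ⟨k, hk⟩ := Δ.exists_subset_verts h.1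
  obtain ⟨a, b, hab, rfl⟩ := Finset.card_eq_two.1 h.2.1
  obtain ⟨la, rfl⟩ := Δ.mem_verts.1 (hk (show a ∈ _ by simp))
  obtain ⟨lb, rfl⟩ := Δ.mem_verts.1 (hk (show b ∈ _ by simp))
  have hab : la ≠ lb := fun h => hab (by rw [h])
  have hcase : lb = la + 1 ∨ la = lb + 1 := eq_succ_or_eq_succ la lb hab
  rcases hcase with rfl | rfl
  · exact ⟨k, la, rfl, by simpa [boundaryEdges] using ⟨h, k, la, rfl, rfl⟩⟩
  · rw [Finset.pair_comm] at h ⊢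
    exact ⟨k, lb, rfl, by simpa [boundaryEdges] using ⟨h, k, lb, rfl, rfl⟩⟩

theorem mem_boundaryVertices {i : Fin NV} :
    i ∈ Δ.boundaryVertices ↔ ∃ e, Δ.IsBoundaryEdge e ∧ i ∈ e := by
  simp [boundaryVertices]

end OrientedConnectivityComplex

/-! ### Geometric complexes in terms of barycentric weights. -/

section GeometricComplex

variable {NV NT : ℕ} {Δ : OrientedConnectivityComplex NV NT}

/-- Weights are indexed by all mesh vertices, so that representations of a point in different faces
can be subtracted from each other. -/
theorem mem_convexHull_image_iff {Q : Fin NV → Plane} {σ : Finset (Fin NV)} {x : Plane} :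
    x ∈ convexHull ℝ (Q '' σ) ↔ ∃ w : Fin NV → ℝ, (∀ i, 0 ≤ w i) ∧ (∀ i ∉ σ, w i = 0) ∧
      ∑ i, w i = 1 ∧ ∑ i, w i • Q i = x := by
  constructor
  · intro hx
    have hconv : Convex ℝ {x : Plane | ∃ w : Fin NV → ℝ, (∀ i, 0 ≤ w i) ∧ (∀ i ∉ σ, w i = 0) ∧
        ∑ i, w i = 1 ∧ ∑ i, w i • Q i = x} := by
      rintro x ⟨w, h1, h2, h3, rfl⟩ y ⟨v, g1, g2, g3, rfl⟩ a b ha hb hab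
      refine ⟨fun i => a * w i + b * v i, fun i => ?_, fun i hi => ?_, ?_, ?_⟩
      · exact add_nonneg (mul_nonneg ha (h1 i)) (mul_nonneg hb (g1 i))
      · simp [h2 i hi, g2 i hi]
      · rw [Finset.sum_add_distrib, ← Finset.mul_sum, ← Finset.mul_sum, h3, g3]; linarith
      · simp only [add_smul, Finset.sum_add_distrib, Finset.smul_sum, mul_smul]
    refine convexHull_min ?_ hconv hx
    rintro _ ⟨i, hi, rfl⟩
    refine ⟨Pi.single i 1, fun j => ?_, fun j hj => ?_, by simp, by simp [Pi.single_apply]⟩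
    · by_cases h : j = i
      · subst h; simp
      · simp [h]
    · have : j ≠ i := fun h => hj (h ▸ hi)
      simp [this]
  · rintro ⟨w, h1, h2, h3, rfl⟩
    have hs : ∑ i, w i • Q i = ∑ i ∈ σ, w i • Q i :=
      (Finset.sum_subset (Finset.subset_univ σ) fun i _ hi => by simp [h2 i hi]).symm
    rw [hs]
    refine (convex_convexHull ℝ _).sum_mem (fun i _ => h1 i) ?_ fun i hi =>
      subset_convexHull ℝ _ ⟨i, hi, rfl⟩
    rw [← h3]
    exact Finset.sum_subset (Finset.subset_univ σ) fun i _ hi => h2 i hi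

/-- Injectivity of the piecewise affine realization, tested on differences of points of two
triangles, up to positive factors. -/
def ConeInjective (Δ : OrientedConnectivityComplex NV NT) (Q : Fin NV → Plane) : Prop :=
  ∀ k k' (z : Fin NV → ℝ), ∑ i, z i = 0 → (∀ i ∉ Δ.verts k, z i ≤ 0) →
    (∀ i ∉ Δ.verts k', 0 ≤ z i) → ∑ i, z i • Q i = 0 → z = 0

/-- The positive and negative parts of `z` have the same sum `m`, because `z` sums to zero. Divided
by `m` they are convex weights on the two triangles that represent the same point. -/
theorem exists_convex_weights_of_cone {Q : Fin NV → Plane} {k k' : Fin NT} {z : Fin NV → ℝ}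
    (h0 : ∑ i, z i = 0) (h1 : ∀ i ∉ Δ.verts k, z i ≤ 0) (h2 : ∀ i ∉ Δ.verts k', 0 ≤ z i)
    (h3 : ∑ i, z i • Q i = 0) (hz : z ≠ 0) :
    ∃ (m : ℝ) (w w' : Fin NV → ℝ), (∀ i, z i = m * (w i - w' i)) ∧
      (∀ i, 0 ≤ w i) ∧ (∀ i ∉ Δ.verts k, w i = 0) ∧ ∑ i, w i = 1 ∧
      (∀ i, 0 ≤ w' i) ∧ (∀ i ∉ Δ.verts k', w' i = 0) ∧ ∑ i, w' i = 1 ∧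
      ∑ i, w i • Q i = ∑ i, w' i • Q i := by
  have hpn : ∀ i, z i = max (z i) 0 - max (-z i) 0 := fun i => by
    rcases le_total (z i) 0 with h | h
    · rw [max_eq_right h, max_eq_left (by linarith)]; ring
    · rw [max_eq_left h, max_eq_right (by linarith)]; ring
  set m := ∑ i, max (z i) 0 with hm
  have hm' : ∑ i, max (-z i) 0 = m := by
    have : ∑ i, z i = m - ∑ i, max (-z i) 0 := by
      rw [hm, ← Finset.sum_sub_distrib]; exact Finset.sum_congr rfl fun i _ => hpn i
    linarith
  have hmpos : 0 < m := by
    refine lt_of_le_of_ne (Finset.sum_nonneg fun i _ => le_max_right _ _) fun h => hz ?_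
    have e1 := (Finset.sum_eq_zero_iff_of_nonneg fun i _ => le_max_right _ _).1 (hm.symm.trans h.symm)
    have e2 := (Finset.sum_eq_zero_iff_of_nonneg fun i _ => le_max_right _ _).1 (hm'.trans h.symm)
    ext i
    rw [hpn i, e1 i (Finset.mem_univ i), e2 i (Finset.mem_univ i)]; simp
  refine ⟨m, fun i => max (z i) 0 / m, fun i => max (-z i) 0 / m, fun i => ?_, fun i => ?_,
    fun i hi => ?_, ?_, fun i => ?_, fun i hi => ?_, ?_, ?_⟩
  · rw [← sub_div, mul_div_cancel₀ _ hmpos.ne']; exact hpn i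
  · exact div_nonneg (le_max_right _ _) hmpos.le
  · simp [max_eq_right (h1 i hi)]
  · rw [← Finset.sum_div, ← hm, div_self hmpos.ne']
  · exact div_nonneg (le_max_right _ _) hmpos.le
  · simp [max_eq_right (neg_nonpos.2 (h2 i hi))]
  · rw [← Finset.sum_div, hm', div_self hmpos.ne']
  · rw [← sub_eq_zero, ← Finset.sum_sub_distrib]
    have : ∀ i, (max (z i) 0 / m) • Q i - (max (-z i) 0 / m) • Q i = m⁻¹ • (z i • Q i) := by
      intro i
      rw [← sub_smul, ← sub_div, ← hpn i, smul_smul, div_eq_inv_mul]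
    simp only [this, ← Finset.smul_sum, h3, smul_zero]

theorem weights_unique_of_affineIndependent {Q : Fin NV → Plane} (hQ : Function.Injective Q)
    {σ : Finset (Fin NV)} {s : Finset Plane} (hs : (s : Set Plane) = Q '' σ)
    (hind : AffineIndependent ℝ ((↑) : s → Plane)) {z : Fin NV → ℝ} (h0 : ∑ i, z i = 0)
    (hsupp : ∀ i ∉ σ, z i = 0) (h : ∑ i, z i • Q i = 0) : z = 0 := by
  have hmem : ∀ i : σ, Q i ∈ s := fun i => by
    rw [← Finset.mem_coe, hs]; exact ⟨i, i.2, rfl⟩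
  have hi : AffineIndependent ℝ (fun i : σ => Q i) :=
    hind.comp_embedding ⟨fun i : σ => (⟨Q i, hmem i⟩ : s), fun i j hij => by
      simpa using hQ (Subtype.ext_iff.1 hij)⟩
  rw [affineIndependent_iff] at hi
  have hsum : ∀ {E : Type} [AddCommMonoid E] (f : Fin NV → E), (∀ i ∉ σ, f i = 0) →
      ∑ i : σ, f i = ∑ i, f i := by
    intro E _ f hf
    rw [Finset.sum_coe_sort]
    exact Finset.sum_subset (Finset.subset_univ σ) fun i _ hi => hf i hi
  have := hi Finset.univ (fun i => z i) ((hsum z hsupp).trans h0)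
    ((hsum (fun i => z i • Q i) fun i hi => by simp [hsupp i hi]).trans h)
  ext i
  by_cases hi : i ∈ σ
  · exact this ⟨i, hi⟩ (Finset.mem_univ _)
  · exact hsupp i hi

/-- In a complex, a point common to two triangles lies in the hull of their common vertices, and
affine independence identifies both weight vectors with the one on that common face. Conversely,
suitable choices of `z` yield all the axioms: differences of unit vectors give injectivity, vectors
supported on one face give affine independence, and differences of convex weights on two faces give
the intersection property. -/
theorem isGeometricComplex_iff {Q : Fin NV → Plane} :
    IsGeometricComplex Δ Q ↔ ConeInjective Δ Q := by
  classical
  constructor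
  · rintro ⟨hQ, K, hK⟩ k k' z h0 h1 h2 h3
    by_contra hz
    obtain ⟨m, w, w', hzw, hw0, hws, hw1, hw0', hws', hw1', heq⟩ :=
      exists_convex_weights_of_cone h0 h1 h2 h3 hz
    have hf : ∀ k, (Δ.verts k).image Q ∈ K.faces := fun k =>
      (hK _).2 ⟨_, Δ.verts_mem_faces k, by simp⟩
    have hx : ∑ i, w i • Q i ∈ convexHull ℝ (Q '' (Δ.verts k ∩ Δ.verts k' : Finset (Fin NV))) := by
      have := K.inter_subset_convexHull (hf k) (hf k')
      rw [Finset.coe_inter, image_inter hQ]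
      simp only [Finset.coe_image] at this
      exact this ⟨mem_convexHull_image_iff.2 ⟨w, hw0, hws, hw1, rfl⟩,
        mem_convexHull_image_iff.2 ⟨w', hw0', hws', hw1', heq.symm⟩⟩
    obtain ⟨v, hv0, hvs, hv1, hv⟩ := mem_convexHull_image_iff.1 hx
    have e1 := weights_unique_of_affineIndependent hQ (σ := Δ.verts k) (by simp)
      (K.indep (hf k)) (z := w - v) (by simp [hw1, hv1])
      (fun i hi => by simp [hws i hi, hvs i (by simp [hi])])
      (by simp [sub_smul, hv])
    have e2 := weights_unique_of_affineIndependent hQ (σ := Δ.verts k') (by simp)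
      (K.indep (hf k')) (z := w' - v) (by simp [hw1', hv1])
      (fun i hi => by simp [hws' i hi, hvs i (by simp [hi])])
      (by simp [sub_smul, hv, heq])
    refine hz (funext fun i => ?_)
    have e1 := congrFun e1 i
    have e2 := congrFun e2 i
    simp only [Pi.sub_apply, Pi.zero_apply] at e1 e2
    rw [hzw, show w i - w' i = 0 by linarith, mul_zero, Pi.zero_apply]
  · intro H
    -- Every face lies in a triangle, and the sign conditions become weaker when a face is enlarged,
    -- so the test on triangles covers all pairs of faces.
    have Hf : ∀ σ ∈ Δ.complex.faces, ∀ τ ∈ Δ.complex.faces, ∀ z : Fin NV → ℝ, ∑ i, z i = 0 →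
        (∀ i ∉ σ, z i ≤ 0) → (∀ i ∉ τ, 0 ≤ z i) → ∑ i, z i • Q i = 0 → z = 0 := by
      intro σ hσ τ hτ z h0 h1 h2 h3
      obtain ⟨k, hk⟩ := Δ.exists_subset_verts hσ
      obtain ⟨k', hk'⟩ := Δ.exists_subset_verts hτ
      exact H k k' z h0 (fun i hi => h1 i fun h => hi (hk h)) (fun i hi => h2 i fun h => hi (hk' h)) h3
    have hinj : Function.Injective Q := by
      intro i j hij
      by_contra hne
      have := Hf {i} (Δ.complex.singleton_mem i) {j} (Δ.complex.singleton_mem j)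
        (Pi.single i 1 - Pi.single j 1) (by simp)
        (fun m hm => by
          have : m ≠ i := by simpa using hm
          by_cases h : m = j
          · subst h; simp [this]
          · simp [this, h])
        (fun m hm => by
          have : m ≠ j := by simpa using hm
          by_cases h : m = i
          · subst h; simp [this]
          · simp [this, h])
        (by simp [sub_smul, Pi.single_apply, hij])
      have := congrFun this i
      simp [hne] at this
    refine ⟨hinj, ⟨⟨⟨{s | ∃ σ ∈ Δ.complex.faces, (s : Set Plane) = Q '' σ}, ?_⟩, ?_, ?_⟩,
      fun s => Iff.rfl⟩⟩
    · rintro s ⟨σ, hσ, hs⟩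
      refine ⟨?_, fun t hts ht => ?_⟩
      · have := (Δ.complex.isRelLowerSet_faces hσ).1
        rw [← Finset.coe_nonempty, hs]
        exact this.to_set.image Q
      · have hsub : (t : Set Plane) ⊆ Q '' σ := hs ▸ (Finset.coe_subset.2 hts)
        have ht' : (t : Set Plane) = Q '' (σ.filter fun i => Q i ∈ t : Finset (Fin NV)) := by
          ext x
          constructor
          · intro hx
            obtain ⟨i, hi, rfl⟩ := hsub hx
            exact ⟨i, by simpa using ⟨hi, hx⟩, rfl⟩
          · rintro ⟨i, hi, rfl⟩
            simp only [Finset.coe_filter, mem_ofPred_eq] at hi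
            exact hi.2
        refine ⟨_, (Δ.complex.isRelLowerSet_faces hσ).2 (Finset.filter_subset _ _) ?_, ht'⟩
        rw [← Finset.coe_nonempty, ht'] at ht
        exact Finset.coe_nonempty.1 ht.of_image
    · rintro s ⟨σ, hσ, hs⟩
      have hs' : s = σ.image Q := by
        rw [← Finset.coe_inj, hs]; simp
      have hi : AffineIndependent ℝ (fun i : σ => Q i) := by
        rw [affineIndependent_iff]
        intro t w hw hwQ i hi
        set z : Fin NV → ℝ := fun i => if h : i ∈ σ then (if (⟨i, h⟩ : σ) ∈ t then w ⟨i, h⟩ else 0) else 0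
          with hz
        have hsum : ∀ {E : Type} [AddCommMonoid E] (f : Fin NV → E), (∀ i ∉ σ, f i = 0) →
            ∑ i : σ, f i = ∑ i, f i := by
          intro E _ f hf
          rw [Finset.sum_coe_sort]
          exact Finset.sum_subset (Finset.subset_univ σ) fun i _ hi => hf i hi
        have hzσ : ∀ i : σ, z i = if i ∈ t then w i else 0 := fun i => by simp [hz]
        have hz0 : ∀ i ∉ σ, z i = 0 := fun i hi => by simp [hz, hi]
        have := Hf σ hσ σ hσ z (by
            rw [← hsum z hz0]
            simp only [hzσ]
            rw [Finset.sum_ite_mem, Finset.univ_inter, hw])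
          (fun i hi => (hz0 i hi).le) (fun i hi => (hz0 i hi).ge)
          (by
            rw [← hsum (fun i => z i • Q i) fun i hi => by simp [hz0 i hi]]
            simp only [hzσ, ite_smul, zero_smul]
            rw [Finset.sum_ite_mem, Finset.univ_inter, hwQ])
        have := congrFun this i
        rw [hzσ, if_pos hi] at this
        exact this
      have hr : range (fun i : σ => Q i) = (s : Set Plane) := by
        rw [hs]; ext x; simp
      have := hi.range
      rw [hr] at this
      exact this
    · rintro s t ⟨σ, hσ, hs⟩ ⟨τ, hτ, ht⟩ x ⟨hxs, hxt⟩
      rw [hs, mem_convexHull_image_iff] at hxs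
      rw [ht, mem_convexHull_image_iff] at hxt
      obtain ⟨w, hw0, hws, hw1, hw⟩ := hxs
      obtain ⟨v, hv0, hvs, hv1, hv⟩ := hxt
      have := Hf σ hσ τ hτ (w - v) (by simp [hw1, hv1])
        (fun i hi => by simpa [hws i hi] using hv0 i) (fun i hi => by simpa [hvs i hi] using hw0 i)
        (by simp [sub_smul, hw, hv])
      have hwv : w = v := sub_eq_zero.1 this
      rw [hs, ht, ← image_inter hinj, ← Finset.coe_inter, mem_convexHull_image_iff]
      refine ⟨w, hw0, fun i hi => ?_, hw1, hw⟩
      rw [Finset.mem_inter, not_and_or] at hi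
      rcases hi with hi | hi
      · exact hws i hi
      · rw [hwv]; exact hvs i hi

/-- The vertices of the `k`-th triangle of the mesh. -/
def corner (Δ : OrientedConnectivityComplex NV NT) (Q : Fin NV → Plane) (k : Fin NT) :
    Fin 3 → Plane := fun l => Q (Δ.tri k l)

theorem vertexArea_corner (Q : Fin NV → Plane) (k : Fin NT) :
    vertexArea (corner Δ Q k) = triArea Δ Q k := rfl

theorem bary_corner {Q : Fin NV → Plane} {k : Fin NT} (h : 0 < triArea Δ Q k) (l m : Fin 3) :
    bary (corner Δ Q k) l (Q (Δ.tri k m)) = if l = m then 1 else 0 :=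
  bary_vertex (p := corner Δ Q k) h.ne' l m

theorem mem_meshTriangle_iff {Q : Fin NV → Plane} {k : Fin NT} (h : 0 < triArea Δ Q k) {x : Plane} :
    x ∈ meshTriangle Δ Q k ↔ ∀ l, 0 ≤ bary (corner Δ Q k) l x :=
  mem_convexHull_iff_bary (p := corner Δ Q k) h.ne' x

/-- The barycentric coordinates of a point in a triangle, as weights on all mesh vertices. -/
noncomputable def nodalWeight (Δ : OrientedConnectivityComplex NV NT) (Q : Fin NV → Plane)
    (k : Fin NT) (x : Plane) (i : Fin NV) : ℝ :=
  ∑ l, if Δ.tri k l = i then bary (corner Δ Q k) l x else 0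

theorem nodalWeight_tri (Q : Fin NV → Plane) (k : Fin NT) (x : Plane) (l : Fin 3) :
    nodalWeight Δ Q k x (Δ.tri k l) = bary (corner Δ Q k) l x := by
  simp [nodalWeight, (Δ.tri_injective k).eq_iff]

theorem nodalWeight_of_notMem (Q : Fin NV → Plane) {k : Fin NT} (x : Plane) {i : Fin NV}
    (hi : i ∉ Δ.verts k) : nodalWeight Δ Q k x i = 0 := by
  exact Finset.sum_eq_zero fun l _ => if_neg fun h => hi (Δ.mem_verts.2 ⟨l, h⟩)

theorem sum_nodal {E : Type*} [AddCommMonoid E] (k : Fin NT) {f : Fin NV → E}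
    (hf : ∀ i ∉ Δ.verts k, f i = 0) : ∑ i, f i = ∑ l, f (Δ.tri k l) := by
  rw [← Finset.sum_subset (Finset.subset_univ (Δ.verts k)) fun i _ hi => hf i hi,
    OrientedConnectivityComplex.verts, Finset.sum_image fun a _ b _ h => Δ.tri_injective k h]

theorem sum_nodalWeight {Q : Fin NV → Plane} {k : Fin NT} (h : 0 < triArea Δ Q k) (x : Plane) :
    ∑ i, nodalWeight Δ Q k x i = 1 := by
  rw [sum_nodal k fun i hi => nodalWeight_of_notMem Q x hi]
  simp only [nodalWeight_tri]
  exact bary_sum (p := corner Δ Q k) h.ne' x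

theorem sum_nodalWeight_smul {Q : Fin NV → Plane} {k : Fin NT} (h : 0 < triArea Δ Q k)
    (x : Plane) : ∑ i, nodalWeight Δ Q k x i • Q i = x := by
  rw [sum_nodal k fun i hi => by rw [nodalWeight_of_notMem Q x hi, zero_smul]]
  simp only [nodalWeight_tri]
  exact bary_combination (p := corner Δ Q k) h.ne' x

theorem nodalWeight_nonneg {Q : Fin NV → Plane} {k : Fin NT} (h : 0 < triArea Δ Q k) {x : Plane}
    (hx : x ∈ meshTriangle Δ Q k) (i : Fin NV) : 0 ≤ nodalWeight Δ Q k x i := by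
  refine Finset.sum_nonneg fun l _ => ?_
  split_ifs
  · exact (mem_meshTriangle_iff h).1 hx l
  · exact le_rfl

theorem nodalWeight_of_weights {Q : Fin NV → Plane} {k : Fin NT} (h : 0 < triArea Δ Q k)
    {w : Fin NV → ℝ} (hs : ∀ i ∉ Δ.verts k, w i = 0) (h1 : ∑ i, w i = 1) (i : Fin NV) :
    nodalWeight Δ Q k (∑ i, w i • Q i) i = w i := by
  by_cases hi : i ∈ Δ.verts k
  · obtain ⟨l, rfl⟩ := Δ.mem_verts.1 hi
    rw [nodalWeight_tri, sum_nodal k fun i hi => by rw [hs i hi, zero_smul]]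
    rw [sum_nodal k hs] at h1
    exact bary_of_combination (p := corner Δ Q k) h.ne' (w := fun l => w (Δ.tri k l)) h1 l
  · rw [nodalWeight_of_notMem Q _ hi, hs i hi]

/-- A point has the same weights in all triangles that contain it. -/
def WeightsAgree (Δ : OrientedConnectivityComplex NV NT) (Q : Fin NV → Plane) : Prop :=
  ∀ k k' x, x ∈ meshTriangle Δ Q k → x ∈ meshTriangle Δ Q k' →
    nodalWeight Δ Q k x = nodalWeight Δ Q k' x

/-- Differences of two weight vectors of one point are, up to a positive factor, the vectors that
the cone condition tests. -/
theorem coneInjective_iff_weightsAgree {Q : Fin NV → Plane} (hA : ∀ k, 0 < triArea Δ Q k) :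
    ConeInjective Δ Q ↔ WeightsAgree Δ Q := by
  constructor
  · intro H k k' x hx hx'
    refine sub_eq_zero.1 (H k k' _ ?_ (fun i hi => ?_) (fun i hi => ?_) ?_)
    · simp [sum_nodalWeight (hA _)]
    · simpa [nodalWeight_of_notMem Q x hi] using nodalWeight_nonneg (hA k') hx' i
    · simpa [nodalWeight_of_notMem Q x hi] using nodalWeight_nonneg (hA k) hx i
    · simp [sub_smul, sum_nodalWeight_smul (hA _)]
  · intro H k k' z h0 h1 h2 h3
    by_contra hz
    obtain ⟨m, w, w', hzw, hw0, hws, hw1, hw0', hws', hw1', heq⟩ :=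
      exists_convex_weights_of_cone h0 h1 h2 h3 hz
    have e1 := nodalWeight_of_weights (hA k) hws hw1
    have e2 := nodalWeight_of_weights (hA k') hws' hw1'
    have hm : ∀ k (w : Fin NV → ℝ), (∀ i, 0 ≤ w i) → (∀ i ∉ Δ.verts k, w i = 0) → ∑ i, w i = 1 →
        ∑ i, w i • Q i ∈ meshTriangle Δ Q k := by
      intro k w h0 hs h1
      rw [mem_meshTriangle_iff (hA k)]
      intro l
      rw [← nodalWeight_tri, nodalWeight_of_weights (hA k) hs h1]
      exact h0 _
    have := H k k' _ (hm k w hw0 hws hw1) (heq ▸ hm k' w' hw0' hws' hw1')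
    refine hz (funext fun i => ?_)
    have hi := congrFun this i
    rw [e1, heq, e2] at hi
    rw [hzw, hi]; simp

/-- The working form of admissibility: the limit argument and the finite element theory both rely on
agreement of weights. -/
theorem mem_plusManifold_iff {Q : Fin NV → Plane} :
    Q ∈ plusManifold Δ ↔ (∀ k, 0 < triArea Δ Q k) ∧ WeightsAgree Δ Q := by
  constructor
  · rintro ⟨h1, h2⟩
    exact ⟨h2, (coneInjective_iff_weightsAgree h2).1 (isGeometricComplex_iff.1 h1)⟩
  · rintro ⟨h1, h2⟩
    exact ⟨isGeometricComplex_iff.2 ((coneInjective_iff_weightsAgree h1).2 h2), h1⟩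

end GeometricComplex

/-! ### The admissible meshes form an open set. -/

section Openness

variable {NV NT : ℕ} {Δ : OrientedConnectivityComplex NV NT}

theorem continuous_triArea (k : Fin NT) : Continuous fun Q : Fin NV → Plane => triArea Δ Q k := by
  unfold triArea; simp only [signedArea_eq]; fun_prop

/-- The condition is homogeneous in `z`, so it suffices to test unit vectors of the closed cone.
They form a compact set `K`, on which the nonvanishing of `∑ i, z i • Q i` survives small changes of
`Q`. -/
theorem eventually_coneInjective {Q : Fin NV → Plane} (h : ConeInjective Δ Q) :
    ∀ᶠ Q' in 𝓝 Q, ConeInjective Δ Q' := by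
  simp only [ConeInjective, eventually_all]
  intro k k'
  set K : Set (Fin NV → ℝ) := {z | ∑ i, z i = 0} ∩ {z | ∀ i ∉ Δ.verts k, z i ≤ 0} ∩
    {z | ∀ i ∉ Δ.verts k', 0 ≤ z i} ∩ Metric.sphere 0 1 with hKdef
  have hK : IsCompact K := by
    refine (isCompact_sphere (0 : Fin NV → ℝ) 1).inter_left ?_
    refine (IsClosed.inter ?_ ?_).inter ?_
    · exact isClosed_eq (by fun_prop) continuous_const
    · simp only [Set.ofPred_forall]
      exact isClosed_iInter fun i => isClosed_iInter fun _ =>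
        isClosed_le (continuous_apply i) continuous_const
    · simp only [Set.ofPred_forall]
      exact isClosed_iInter fun i => isClosed_iInter fun _ =>
        isClosed_le continuous_const (continuous_apply i)
  have hev : ∀ᶠ Q' in 𝓝 Q, ∀ z ∈ K, ∑ i, z i • Q' i ≠ 0 := by
    refine hK.eventually_forall_of_forall_eventually fun z hz => ?_
    have hz0 : ∑ i, z i • Q i ≠ 0 := fun h0 => by
      have := h k k' z hz.1.1.1 hz.1.1.2 hz.1.2 h0
      have hn := hz.2
      simp [this] at hn
    have hc : Continuous fun p : (Fin NV → Plane) × (Fin NV → ℝ) => ∑ i, p.2 i • p.1 i := by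
      fun_prop
    exact hc.continuousAt.eventually_ne hz0
  filter_upwards [hev] with Q' hQ' z h0 h1 h2 h3
  by_contra hz
  have hn : 0 < ‖z‖ := norm_pos_iff.2 hz
  refine hQ' (‖z‖⁻¹ • z) ⟨⟨⟨?_, fun i hi => ?_⟩, fun i hi => ?_⟩, ?_⟩ ?_
  · simp [← Finset.mul_sum, h0]
  · simpa using mul_nonpos_of_nonneg_of_nonpos (inv_nonneg.2 hn.le) (h1 i hi)
  · simpa using mul_nonneg (inv_nonneg.2 hn.le) (h2 i hi)
  · simp [norm_smul, hn.ne']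
  · simp [mul_smul, ← Finset.smul_sum, h3]

theorem isOpen_plusManifold : IsOpen (plusManifold Δ) := by
  rw [isOpen_iff_mem_nhds]
  rintro Q ⟨h1, h2⟩
  have hA : ∀ᶠ Q' in 𝓝 Q, ∀ k, 0 < triArea Δ Q' k := eventually_all.2 fun k =>
    (continuous_triArea k).continuousAt.eventually_const_lt (h2 k)
  filter_upwards [eventually_coneInjective (isGeometricComplex_iff.1 h1), hA] with Q' g1 g2
  exact ⟨isGeometricComplex_iff.2 g1, g2⟩

end Openness

/-! ### Stars of edges and vertices: local covering by triangles. -/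

section Star

variable {NV NT : ℕ} {Δ : OrientedConnectivityComplex NV NT} {Q : Fin NV → Plane}

/-- Weights with sum one on the vertices of a nondegenerate triangle are determined by the point
they represent, so weights supported on two triangles are the weights for both. -/
theorem nodalWeight_eq_of_support {k k' : Fin NT} (hk : 0 < triArea Δ Q k)
    (hk' : 0 < triArea Δ Q k') {x : Plane}
    (h : ∀ i, nodalWeight Δ Q k x i ≠ 0 → i ∈ Δ.verts k') :
    nodalWeight Δ Q k' x = nodalWeight Δ Q k x := by
  ext i
  have := nodalWeight_of_weights hk' (w := nodalWeight Δ Q k x)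
    (fun i hi => by_contra fun h0 => hi (h i h0)) (sum_nodalWeight hk x) i
  rwa [sum_nodalWeight_smul hk] at this

theorem nodalWeight_ne_zero {k : Fin NT} {x : Plane} {i : Fin NV}
    (h : nodalWeight Δ Q k x i ≠ 0) : ∃ l, Δ.tri k l = i ∧ bary (corner Δ Q k) l x ≠ 0 := by
  have hi : i ∈ Δ.verts k := by_contra fun hi => h (nodalWeight_of_notMem Q x hi)
  obtain ⟨l, rfl⟩ := Δ.mem_verts.1 hi
  exact ⟨l, rfl, by rwa [nodalWeight_tri] at h⟩

theorem Fin.three_cases : ∀ l m : Fin 3, m = l ∨ m = l + 1 ∨ m = l + 2 := by decide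

theorem Fin.three_add (l : Fin 3) : l + 1 + 1 = l + 2 ∧ l + 1 + 2 = l ∧ l + 2 + 1 = l ∧
    l + 2 + 2 = l + 1 := by revert l; decide

theorem Fin.three_ne (l : Fin 3) : l ≠ l + 1 ∧ l ≠ l + 2 ∧ l + 1 ≠ l + 2 := by revert l; decide

/-- Across an edge that is not a boundary edge there is a triangle on the other side. -/
theorem exists_triangle_across (hA : ∀ k, 0 < triArea Δ Q k) {k : Fin NT} {m : Fin 3}
    (hb : ¬ Δ.IsBoundaryEdge {Δ.tri k m, Δ.tri k (m + 1)}) {y : Plane}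
    (hy : bary (corner Δ Q k) (m + 2) y = 0) :
    ∃ k' l', Δ.tri k' l' = Δ.tri k (m + 1) ∧ Δ.tri k' (l' + 1) = Δ.tri k m ∧
      bary (corner Δ Q k') l' y = bary (corner Δ Q k) (m + 1) y ∧
      bary (corner Δ Q k') (l' + 1) y = bary (corner Δ Q k) m y ∧
      ∃ c, 0 < c ∧ ∀ z, bary (corner Δ Q k') (l' + 2) z = -(c * bary (corner Δ Q k) (m + 2) z) := by
  obtain ⟨k', l', h1, h2⟩ := Δ.exists_neighbour hb
  have hw : nodalWeight Δ Q k' y = nodalWeight Δ Q k y := by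
    refine nodalWeight_eq_of_support (hA k) (hA k') fun i hi => ?_
    obtain ⟨l, rfl, hl⟩ := nodalWeight_ne_zero hi
    rcases Fin.three_cases m l with rfl | rfl | rfl
    · exact h2 ▸ Δ.tri_mem_verts _ _
    · exact h1 ▸ Δ.tri_mem_verts _ _
    · exact (hl hy).elim
  refine ⟨k', l', h1, h2, ?_, ?_, triArea Δ Q k / triArea Δ Q k',
    div_pos (hA k) (hA k'), fun z => ?_⟩
  · rw [← nodalWeight_tri, ← nodalWeight_tri, hw, h1]
  · rw [← nodalWeight_tri, ← nodalWeight_tri, hw, h2]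
  · have e1 := (hA k).ne'
    have e2 := (hA k').ne'
    simp only [bary, vertexArea_corner, (Fin.three_add _).2.2.1, (Fin.three_add _).2.2.2, corner,
      h1, h2]
    rw [signedArea_swap]
    field_simp

/-- Near a relatively interior point of the edge, the sign of the third coordinate decides between
`k` and its neighbour, whose own third coordinate is a negative multiple of it. -/
theorem eventually_mem_star_of_edge (hA : ∀ k, 0 < triArea Δ Q k) {k : Fin NT} {m : Fin 3}
    (hb : ¬ Δ.IsBoundaryEdge {Δ.tri k m, Δ.tri k (m + 1)}) {x : Plane}
    (h0 : 0 < bary (corner Δ Q k) m x) (h1 : 0 < bary (corner Δ Q k) (m + 1) x)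
    (h2 : bary (corner Δ Q k) (m + 2) x = 0) :
    ∀ᶠ y in 𝓝 x, ∃ k', y ∈ meshTriangle Δ Q k' ∧
      ∀ i, nodalWeight Δ Q k x i ≠ 0 → i ∈ Δ.verts k' := by
  obtain ⟨k', l', g1, g2, e1, e2, c, hc, e3⟩ := exists_triangle_across hA hb h2
  have hev : ∀ k l, 0 < bary (corner Δ Q k) l x → ∀ᶠ y in 𝓝 x, 0 < bary (corner Δ Q k) l y :=
    fun k l h => (continuous_bary _ l).continuousAt.eventually_const_lt h
  filter_upwards [hev k m h0, hev k _ h1, hev k' l' (e1 ▸ h1), hev k' (l' + 1) (e2 ▸ h0)]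
    with y y1 y2 y3 y4
  rcases le_total 0 (bary (corner Δ Q k) (m + 2) y) with hy | hy
  · refine ⟨k, (mem_meshTriangle_iff (hA k)).2 fun l => ?_, fun i hi => ?_⟩
    · rcases Fin.three_cases m l with rfl | rfl | rfl
      exacts [y1.le, y2.le, hy]
    · obtain ⟨l, rfl, -⟩ := nodalWeight_ne_zero hi
      exact Δ.tri_mem_verts _ _
  · refine ⟨k', (mem_meshTriangle_iff (hA k')).2 fun l => ?_, fun i hi => ?_⟩
    · rcases Fin.three_cases l' l with rfl | rfl | rfl
      · exact y3.le
      · exact y4.le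
      · rw [e3]; exact neg_nonneg.2 (mul_nonpos_of_nonneg_of_nonpos hc.le hy)
    · obtain ⟨l, rfl, hl⟩ := nodalWeight_ne_zero hi
      rcases Fin.three_cases m l with rfl | rfl | rfl
      · exact g2 ▸ Δ.tri_mem_verts _ _
      · exact g1 ▸ Δ.tri_mem_verts _ _
      · exact (hl h2).elim

/-- The union of the cones that the triangles span at one of their common vertices. -/
def vertexCone (Δ : OrientedConnectivityComplex NV NT) (Q : Fin NV → Plane) (i : Fin NV) :
    Set Plane :=
  ⋃ k, ⋃ l, {y | Δ.tri k l = i ∧ 0 ≤ bary (corner Δ Q k) (l + 1) y ∧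
    0 ≤ bary (corner Δ Q k) (l + 2) y}

theorem mem_vertexCone {i : Fin NV} {y : Plane} : y ∈ vertexCone Δ Q i ↔
    ∃ k l, Δ.tri k l = i ∧ 0 ≤ bary (corner Δ Q k) (l + 1) y ∧
      0 ≤ bary (corner Δ Q k) (l + 2) y := by simp [vertexCone]

theorem isClosed_vertexCone (i : Fin NV) : IsClosed (vertexCone Δ Q i) := by
  refine isClosed_iUnion_of_finite fun k => isClosed_iUnion_of_finite fun l => ?_
  by_cases h : Δ.tri k l = i
  · simp only [h, true_and]
    exact (isClosed_le continuous_const (continuous_bary _ _)).inter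
      (isClosed_le continuous_const (continuous_bary _ _))
  · simp [h]

/-- If both coordinates vanish, `y` is the apex, which is excluded. If one vanishes, `y` lies on a
ray along an interior edge, and the triangle across that edge covers the other side. If none
vanishes, `y` is interior to a single cone. -/
theorem eventually_mem_vertexCone (hA : ∀ k, 0 < triArea Δ Q k) {i : Fin NV}
    (hi : i ∉ Δ.boundaryVertices) {y : Plane} (hy : y ≠ Q i) (hyC : y ∈ vertexCone Δ Q i) :
    ∀ᶠ z in 𝓝 y, z ∈ vertexCone Δ Q i := by
  have hnb : ∀ e, i ∈ e → ¬ Δ.IsBoundaryEdge e := fun e he hb =>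
    hi (Δ.mem_boundaryVertices.2 ⟨e, hb, he⟩)
  have hev : ∀ k l, 0 < bary (corner Δ Q k) l y → ∀ᶠ z in 𝓝 y, 0 < bary (corner Δ Q k) l z :=
    fun k l h => (continuous_bary _ l).continuousAt.eventually_const_lt h
  obtain ⟨k, l, hl, h1, h2⟩ := mem_vertexCone.1 hyC
  rcases h1.eq_or_lt with h1 | h1 <;> rcases h2.eq_or_lt with h2 | h2
  · refine (hy ?_).elim
    have hs := bary_sum (p := corner Δ Q k) (hA k).ne' y
    have hc := bary_combination (p := corner Δ Q k) (hA k).ne' y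
    have hz : ∀ m, m ≠ l → bary (corner Δ Q k) m y = 0 := fun m hm => by
      rcases Fin.three_cases l m with rfl | rfl | rfl
      exacts [(hm rfl).elim, h1.symm, h2.symm]
    rw [Finset.sum_eq_single l (fun m _ hm => hz m hm) (by simp)] at hs
    rw [Finset.sum_eq_single l (fun m _ hm => by rw [hz m hm, zero_smul]) (by simp), hs,
      one_smul] at hc
    rw [← hc, ← hl]; rfl
  · obtain ⟨a1, a2, a3, a4⟩ := Fin.three_add l
    obtain ⟨k', l', g1, g2, e1, e2, c, hc, e3⟩ := exists_triangle_across hA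
      (k := k) (m := l + 2) (hnb _ (by rw [a3, hl]; simp)) (y := y) (by rw [a4]; exact h1.symm)
    rw [a3] at g1 e1
    rw [a4] at e3
    filter_upwards [hev _ _ h2, hev k' (l' + 1) (e2 ▸ h2)] with z z1 z2
    rw [mem_vertexCone]
    rcases le_total 0 (bary (corner Δ Q k) (l + 1) z) with hz | hz
    · exact ⟨k, l, hl, hz, z1.le⟩
    · exact ⟨k', l', g1.trans hl, z2.le, by
        rw [e3]; exact neg_nonneg.2 (mul_nonpos_of_nonneg_of_nonpos hc.le hz)⟩
  · obtain ⟨a1, a2, a3, a4⟩ := Fin.three_add l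
    obtain ⟨k', l', g1, g2, e1, e2, c, hc, e3⟩ := exists_triangle_across hA
      (k := k) (m := l) (hnb _ (by rw [hl]; simp)) (y := y) h2.symm
    filter_upwards [hev _ _ h1, hev k' l' (e1 ▸ h1)] with z z1 z2
    rw [mem_vertexCone]
    rcases le_total 0 (bary (corner Δ Q k) (l + 2) z) with hz | hz
    · exact ⟨k, l, hl, z1.le, hz⟩
    · obtain ⟨b1, b2, b3, b4⟩ := Fin.three_add l'
      refine ⟨k', l' + 1, g2.trans hl, ?_, ?_⟩
      · rw [b1, e3]; exact neg_nonneg.2 (mul_nonpos_of_nonneg_of_nonpos hc.le hz)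
      · rw [b2]; exact z2.le
  · filter_upwards [hev _ _ h1, hev _ _ h2] with z z1 z2
    exact mem_vertexCone.2 ⟨k, l, hl, z1.le, z2.le⟩

/-- The union of cones is closed, and away from its apex it is also open. The punctured plane is
connected, so the cones at an interior vertex fill the plane. -/
theorem vertexCone_eq_univ (hA : ∀ k, 0 < triArea Δ Q k) {i : Fin NV}
    (hi : i ∉ Δ.boundaryVertices) : vertexCone Δ Q i = univ := by
  obtain ⟨k, hk⟩ := Δ.exists_mem_verts i
  obtain ⟨l, hl⟩ := Δ.mem_verts.1 hk
  have hconn : IsPreconnected ({Q i}ᶜ : Set Plane) :=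
    (isConnected_compl_singleton_of_one_lt_rank (by simp [← Module.finrank_eq_rank]) _).isPreconnected
  have hv : ∀ m, m ≠ l → Q (Δ.tri k m) ≠ Q i := by
    intro m hm h
    have e := bary_corner (hA k) l m
    have e' := bary_corner (hA k) l l
    rw [h, ← hl] at e
    rw [e] at e'
    simp [hm.symm] at e'
  have hsub : ({Q i}ᶜ : Set Plane) ⊆ interior (vertexCone Δ Q i) := by
    refine hconn.subset_left_of_subset_union isOpen_interior
      (isClosed_vertexCone (Δ := Δ) (Q := Q) i).isOpen_compl
      (disjoint_compl_right.mono_left interior_subset) (fun y hy => ?_) ⟨Q (Δ.tri k (l + 1)), ?_, ?_⟩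
    · by_cases h : y ∈ vertexCone Δ Q i
      · exact Or.inl (mem_interior_iff_mem_nhds.2 (eventually_mem_vertexCone hA hi hy h))
      · exact Or.inr h
    · exact hv _ (Fin.three_ne l).1.symm
    · refine mem_interior_iff_mem_nhds.2 (eventually_mem_vertexCone hA hi
        (hv _ (Fin.three_ne l).1.symm) (mem_vertexCone.2 ⟨k, l, hl, ?_, ?_⟩))
      · rw [bary_corner (hA k)]; simp
      · rw [bary_corner (hA k)]; simp
  refine eq_univ_of_forall fun y => ?_
  by_cases hy : y = Q i
  · subst hy
    refine mem_vertexCone.2 ⟨k, l, hl, ?_, ?_⟩ <;>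
    · rw [← hl, bary_corner (hA k)]; simp
  · exact interior_subset (hsub hy)

/-- Near `Q i` the coordinate belonging to vertex `i` stays positive, so lying in the cone of a
triangle there is the same as lying in the triangle. -/
theorem eventually_mem_star_of_vertex (hA : ∀ k, 0 < triArea Δ Q k) {i : Fin NV}
    (hi : i ∉ Δ.boundaryVertices) :
    ∀ᶠ y in 𝓝 (Q i), ∃ k', y ∈ meshTriangle Δ Q k' ∧ i ∈ Δ.verts k' := by
  have hev : ∀ k l, Δ.tri k l = i → ∀ᶠ y in 𝓝 (Q i), 0 < bary (corner Δ Q k) l y := by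
    intro k l hl
    refine (continuous_bary _ l).continuousAt.eventually_const_lt ?_
    rw [← hl]
    rw [bary_corner (hA k)]; simp
  have hev' : ∀ᶠ y in 𝓝 (Q i), ∀ k l, Δ.tri k l = i → 0 < bary (corner Δ Q k) l y := by
    simp only [eventually_all]
    exact hev
  filter_upwards [hev'] with y hy
  have : y ∈ vertexCone Δ Q i := by rw [vertexCone_eq_univ hA hi]; trivial
  obtain ⟨k, l, hl, h1, h2⟩ := mem_vertexCone.1 this
  refine ⟨k, (mem_meshTriangle_iff (hA k)).2 fun m => ?_, hl ▸ Δ.tri_mem_verts k l⟩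
  rcases Fin.three_cases l m with rfl | rfl | rfl
  exacts [(hy k _ hl).le, h1, h2]

theorem eq_corner_of_bary_eq_zero {p : Fin 3 → Plane} (hp : vertexArea p ≠ 0) {l : Fin 3}
    {x : Plane} (h1 : bary p (l + 1) x = 0) (h2 : bary p (l + 2) x = 0) : x = p l := by
  have hs := bary_sum hp x
  have hc := bary_combination hp x
  have hz : ∀ m, m ≠ l → bary p m x = 0 := fun m hm => by
    rcases Fin.three_cases l m with rfl | rfl | rfl
    exacts [(hm rfl).elim, h1, h2]
  rw [Finset.sum_eq_single l (fun m _ hm => hz m hm) (by simp)] at hs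
  rw [Finset.sum_eq_single l (fun m _ hm => by rw [hz m hm, zero_smul]) (by simp), hs,
    one_smul] at hc
  exact hc.symm

/-- The triangles that contain the carrier of a point cover a neighbourhood of it, unless the
carrier is a boundary edge or a boundary vertex. -/
theorem eventually_mem_star_or_boundary (hA : ∀ k, 0 < triArea Δ Q k) {k : Fin NT} {x : Plane}
    (hx : x ∈ meshTriangle Δ Q k) :
    (∀ᶠ y in 𝓝 x, ∃ k', y ∈ meshTriangle Δ Q k' ∧
      ∀ i, nodalWeight Δ Q k x i ≠ 0 → i ∈ Δ.verts k') ∨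
    (∃ m, Δ.IsBoundaryEdge {Δ.tri k m, Δ.tri k (m + 1)} ∧ 0 < bary (corner Δ Q k) m x ∧
      0 < bary (corner Δ Q k) (m + 1) x ∧ bary (corner Δ Q k) (m + 2) x = 0) ∨
    (∃ m, Δ.tri k m ∈ Δ.boundaryVertices ∧ x = Q (Δ.tri k m)) := by
  have hx' := (mem_meshTriangle_iff (hA k)).1 hx
  have hvert : ∀ m, x = Q (Δ.tri k m) → (∀ᶠ y in 𝓝 x, ∃ k', y ∈ meshTriangle Δ Q k' ∧
      ∀ i, nodalWeight Δ Q k x i ≠ 0 → i ∈ Δ.verts k') ∨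
      (∃ m, Δ.tri k m ∈ Δ.boundaryVertices ∧ x = Q (Δ.tri k m)) := by
    intro m hm
    by_cases hb : Δ.tri k m ∈ Δ.boundaryVertices
    · exact Or.inr ⟨m, hb, hm⟩
    · left
      rw [hm]
      filter_upwards [eventually_mem_star_of_vertex hA hb] with y hy
      obtain ⟨k', h1, h2⟩ := hy
      refine ⟨k', h1, fun i hi => ?_⟩
      obtain ⟨l, rfl, hl⟩ := nodalWeight_ne_zero hi
      have hlm : l = m := by
        by_contra hne
        refine hl ?_
        rw [bary_corner (hA k), if_neg hne]
      rw [hlm]; exact h2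
  by_cases hall : ∀ l, 0 < bary (corner Δ Q k) l x
  · left
    filter_upwards [(isOpen_openTriangle _).mem_nhds (show x ∈ openTriangle (corner Δ Q k) from hall)]
      with y hy
    refine ⟨k, openTriangle_subset (p := corner Δ Q k) (hA k).ne' hy, fun i hi => ?_⟩
    obtain ⟨l, rfl, -⟩ := nodalWeight_ne_zero hi
    exact Δ.tri_mem_verts _ _
  · push Not at hall
    obtain ⟨l, hl⟩ := hall
    have hl0 := le_antisymm hl (hx' l)
    obtain ⟨a1, a2, a3, a4⟩ := Fin.three_add l
    rcases (hx' (l + 1)).eq_or_lt with h1 | h1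
    · have := eq_corner_of_bary_eq_zero (p := corner Δ Q k) (hA k).ne' (l := l + 2) (x := x)
        (by rw [a3]; exact hl0) (by rw [a4]; exact h1.symm)
      exact (hvert _ this).imp_right Or.inr
    rcases (hx' (l + 2)).eq_or_lt with h2 | h2
    · have := eq_corner_of_bary_eq_zero (p := corner Δ Q k) (hA k).ne' (l := l + 1) (x := x)
        (by rw [a1]; exact h2.symm) (by rw [a2]; exact hl0)
      exact (hvert _ this).imp_right Or.inr
    by_cases hb : Δ.IsBoundaryEdge {Δ.tri k (l + 1), Δ.tri k (l + 1 + 1)}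
    · exact Or.inr (Or.inl ⟨l + 1, hb, h1, by rw [a1]; exact h2, by rw [a2]; exact hl0⟩)
    · left
      exact eventually_mem_star_of_edge hA hb h1 (by rw [a1]; exact h2) (by rw [a2]; exact hl0)

end Star

/-! ### Admissibility of limit meshes. -/

section Admissibility

variable {NV NT : ℕ} {Δ : OrientedConnectivityComplex NV NT} {Q : Fin NV → Plane}

/-- Distinct triangles have disjoint interiors. -/
def InteriorsDisjoint (Δ : OrientedConnectivityComplex NV NT) (Q : Fin NV → Plane) : Prop :=
  ∀ k k' x, x ∈ openTriangle (corner Δ Q k) → x ∈ openTriangle (corner Δ Q k') → k = k'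

/-- No boundary vertex lies on a boundary edge that does not contain it combinatorially. -/
def BoundarySeparated (Δ : OrientedConnectivityComplex NV NT) (Q : Fin NV → Plane) : Prop :=
  ∀ a b, Δ.IsBoundaryEdge {a, b} → ∀ i ∈ Δ.boundaryVertices, Q i ∈ segment ℝ (Q a) (Q b) →
    i = a ∨ i = b

theorem Fin.three_univ : ∀ m : Fin 3, (Finset.univ : Finset (Fin 3)) = {m, m + 1, m + 2} := by decide

/-- A triangle `k₁` containing `x` has interior points arbitrarily close to `x`. Triangles of the
star cover them, and disjointness of interiors makes `k₁` one of these. Thus `k₁` contains the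
carrier of `x`. -/
theorem nodalWeight_eq_of_star (hA : ∀ k, 0 < triArea Δ Q k) (hd : InteriorsDisjoint Δ Q)
    {k k₁ : Fin NT} {x : Plane} (hx : x ∈ meshTriangle Δ Q k₁)
    (hs : ∀ᶠ y in 𝓝 x, ∃ k', y ∈ meshTriangle Δ Q k' ∧
      ∀ i, nodalWeight Δ Q k x i ≠ 0 → i ∈ Δ.verts k') :
    nodalWeight Δ Q k₁ x = nodalWeight Δ Q k x := by
  obtain ⟨W, hW, hWo, hxW⟩ := eventually_nhds_iff.1 hs
  obtain ⟨y, hyW, hy⟩ := mem_closure_iff.1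
    (subset_closure_openTriangle (p := corner Δ Q k₁) (hA k₁).ne' hx) W hWo hxW
  obtain ⟨k', hk', hi⟩ := hW y hyW
  obtain ⟨z, hz, hz'⟩ := mem_closure_iff.1
    (subset_closure_openTriangle (p := corner Δ Q k') (hA k').ne' hk') _
    (isOpen_openTriangle (corner Δ Q k₁)) hy
  obtain rfl := hd _ _ _ hz hz'
  exact nodalWeight_eq_of_support (hA k) (hA _) hi

theorem lineMap_real_mem_segment {a b : Plane} {r s t : ℝ} (h : r ∈ segment ℝ s t) :
    AffineMap.lineMap a b r ∈
      segment ℝ (AffineMap.lineMap a b s : Plane) (AffineMap.lineMap a b t) := by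
  rw [← image_segment ℝ (AffineMap.lineMap a b : ℝ →ᵃ[ℝ] Plane) s t]
  exact mem_image_of_mem _ h

theorem eq_lineMap_of_bary_eq_zero {p : Fin 3 → Plane} (hp : vertexArea p ≠ 0) {m : Fin 3}
    {y : Plane} (hy : bary p (m + 2) y = 0) :
    y = AffineMap.lineMap (p m) (p (m + 1)) (bary p (m + 1) y) := by
  have hs := bary_sum hp y
  have hc := bary_combination hp y
  have huniv : (Finset.univ : Finset (Fin 3)) = {m, m + 1, m + 2} := Fin.three_univ _
  obtain ⟨n1, n2, n3⟩ := Fin.three_ne m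
  rw [huniv, Finset.sum_insert (by simp [n1, n2]), Finset.sum_pair n3, hy] at hs hc
  rw [AffineMap.lineMap_apply_module, show 1 - bary p (m + 1) y = bary p m y by linarith]
  rw [zero_smul, add_zero] at hc
  exact hc.symm

theorem mem_segment_of_bary {p : Fin 3 → Plane} (hp : vertexArea p ≠ 0) {m : Fin 3}
    {y : Plane} (h0 : 0 ≤ bary p m y) (h1 : 0 ≤ bary p (m + 1) y) (hy : bary p (m + 2) y = 0) :
    y ∈ segment ℝ (p m) (p (m + 1)) := by
  have hs := bary_sum hp y
  have hc := bary_combination hp y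
  have huniv : (Finset.univ : Finset (Fin 3)) = {m, m + 1, m + 2} := Fin.three_univ _
  obtain ⟨n1, n2, n3⟩ := Fin.three_ne m
  rw [huniv, Finset.sum_insert (by simp [n1, n2]), Finset.sum_pair n3, hy] at hs hc
  rw [zero_smul, add_zero] at hc
  exact ⟨_, _, h0, h1, by linarith, hc⟩

/-- Two linear functionals on an inner product space, the second one of which vanishes at `d`
while the first one does not, have a common positive value. -/
theorem exists_inner_pos {g g' d : Plane} (hg' : g' ≠ 0) (hd : inner ℝ g d ≠ 0)
    (hd' : inner ℝ g' d = 0) : ∃ v : Plane, 0 < inner ℝ g v ∧ 0 < inner ℝ g' v := by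
  have hpos : 0 < inner ℝ g' g' := real_inner_self_pos.2 hg'
  refine ⟨g' + ((1 - inner ℝ g g') / inner ℝ g d) • d, ?_, ?_⟩
  · rw [inner_add_right, inner_smul_right, div_mul_cancel₀ _ hd]; linarith
  · rw [inner_add_right, inner_smul_right, hd']; linarith

/-- If the edges cross, or the triangles lie on the same side of a common line, some direction
points into both triangles and their interiors overlap. Otherwise the edges are collinear and
overlap, separation makes their end points agree, and a boundary edge has only one triangle. -/
theorem eq_of_boundaryEdges_meet (hA : ∀ k, 0 < triArea Δ Q k) (hd : InteriorsDisjoint Δ Q)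
    (hb : BoundarySeparated Δ Q) {k k' : Fin NT} {m m' : Fin 3} {x : Plane}
    (he : Δ.IsBoundaryEdge {Δ.tri k m, Δ.tri k (m + 1)})
    (h0 : 0 < bary (corner Δ Q k) m x) (h1 : 0 < bary (corner Δ Q k) (m + 1) x)
    (h2 : bary (corner Δ Q k) (m + 2) x = 0)
    (he' : Δ.IsBoundaryEdge {Δ.tri k' m', Δ.tri k' (m' + 1)})
    (h0' : 0 < bary (corner Δ Q k') m' x) (h1' : 0 < bary (corner Δ Q k') (m' + 1) x)
    (h2' : bary (corner Δ Q k') (m' + 2) x = 0) : k = k' := by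
  have hp : vertexArea (corner Δ Q k) ≠ 0 := (hA k).ne'
  have hp' : vertexArea (corner Δ Q k') ≠ 0 := (hA k').ne'
  by_contra hkk
  set a := Q (Δ.tri k m) with ha
  set b := Q (Δ.tri k (m + 1)) with hbdef
  set a' := Q (Δ.tri k' m') with ha'
  set b' := Q (Δ.tri k' (m' + 1)) with hb'def
  obtain ⟨n1, n2, n3⟩ := Fin.three_ne m
  obtain ⟨n1', n2', n3'⟩ := Fin.three_ne m'
  have hnocommon : ∀ v : Plane, 0 < inner ℝ (baryGrad (corner Δ Q k) (m + 2)) v →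
      ¬ 0 < inner ℝ (baryGrad (corner Δ Q k') (m' + 2)) v := by
    intro v hv hv'
    have ht : Tendsto (fun t : ℝ => x + t • v) (𝓝[>] 0) (𝓝 x) := by
      have : Tendsto (fun t : ℝ => x + t • v) (𝓝 0) (𝓝 (x + (0 : ℝ) • v)) :=
        Continuous.tendsto (by fun_prop) 0
      rw [zero_smul, add_zero] at this
      exact this.mono_left nhdsWithin_le_nhds
    have hev : ∀ k l, 0 < bary (corner Δ Q k) l x →
        ∀ᶠ t in 𝓝[>] (0 : ℝ), 0 < bary (corner Δ Q k) l (x + t • v) := fun k l h =>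
      (((continuous_bary _ l).tendsto x).comp ht).eventually_const_lt h
    have hev' : ∀ k l, bary (corner Δ Q k) l x = 0 → 0 < inner ℝ (baryGrad (corner Δ Q k) l) v →
        ∀ᶠ t in 𝓝[>] (0 : ℝ), 0 < bary (corner Δ Q k) l (x + t • v) := by
      intro k l h hv
      filter_upwards [self_mem_nhdsWithin] with t ht
      rw [bary_eq _ _ _ x, h, add_sub_cancel_left, inner_smul_right, zero_add]
      exact mul_pos ht hv
    obtain ⟨t, t1, t2, t3, t4, t5, t6⟩ := ((hev k m h0).and ((hev k _ h1).and
      ((hev' k _ h2 hv).and ((hev k' m' h0').and ((hev k' _ h1').and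
        (hev' k' _ h2' hv')))))).exists
    refine hkk (hd k k' (x + t • v) (fun l => ?_) fun l => ?_)
    · rcases Fin.three_cases m l with rfl | rfl | rfl <;> assumption
    · rcases Fin.three_cases m' l with rfl | rfl | rfl <;> assumption
  have horth' : inner ℝ (baryGrad (corner Δ Q k') (m' + 2)) (b' - a') = 0 := by
    rw [← bary_sub, bary_corner (hA k'), bary_corner (hA k'), if_neg n2'.symm, if_neg n3'.symm,
      sub_zero]
  -- For nonparallel edges, `exists_inner_pos` supplies a direction that points into both triangles.
  have horth : inner ℝ (baryGrad (corner Δ Q k) (m + 2)) (b' - a') = 0 := by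
    by_contra hne
    obtain ⟨v, hv, hv'⟩ := exists_inner_pos (baryGrad_ne_zero hp' (m' + 2)) hne horth'
    exact hnocommon v hv hv'
  have hxline := eq_lineMap_of_bary_eq_zero hp' h2'
  set θ := bary (corner Δ Q k') (m' + 1) x with hθ
  have hxline : x = a' + θ • (b' - a') := by
    rw [hxline, AffineMap.lineMap_apply, vsub_eq_sub, vadd_eq_add, add_comm]; rfl
  have hθ1 : θ < 1 := by
    have hs := bary_sum hp' x
    have huniv : (Finset.univ : Finset (Fin 3)) = {m', m' + 1, m' + 2} := Fin.three_univ _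
    rw [huniv, Finset.sum_insert (by simp [n1', n2']), Finset.sum_pair n3', h2'] at hs
    linarith
  have haff : ∀ l, bary (corner Δ Q k) l x =
      (1 - θ) * bary (corner Δ Q k) l a' + θ * bary (corner Δ Q k) l b' := by
    intro l
    have e1 := bary_sub (corner Δ Q k) l x a'
    have e2 := bary_sub (corner Δ Q k) l b' a'
    rw [hxline, add_sub_cancel_left, inner_smul_right, ← e2, ← hxline] at e1
    linarith
  have hab' : bary (corner Δ Q k) (m + 2) b' = bary (corner Δ Q k) (m + 2) a' := by
    have := bary_sub (corner Δ Q k) (m + 2) b' a'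
    rw [horth] at this; linarith
  have ha0 : bary (corner Δ Q k) (m + 2) a' = 0 := by
    have := haff (m + 2)
    rw [h2, hab'] at this; linarith
  have hb0 : bary (corner Δ Q k) (m + 2) b' = 0 := hab'.trans ha0
  have hal := eq_lineMap_of_bary_eq_zero hp ha0
  have hbl := eq_lineMap_of_bary_eq_zero hp hb0
  have hξ := haff (m + 1)
  have hξ0 := h1
  have hξ1 : bary (corner Δ Q k) (m + 1) x < 1 := by
    have hs := bary_sum hp x
    have huniv : (Finset.univ : Finset (Fin 3)) = {m, m + 1, m + 2} := Fin.three_univ _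
    rw [huniv, Finset.sum_insert (by simp [n1, n2]), Finset.sum_pair n3, h2] at hs
    linarith
  -- From here on everything takes place on the line through `a` and `b`, parametrized so that `a`,
  -- `b`, `a'`, `b'`, `x` have the parameters `0`, `1`, `s`, `t`, `ξ`.
  set s := bary (corner Δ Q k) (m + 1) a' with hs
  set t := bary (corner Δ Q k) (m + 1) b' with ht
  set ξ := bary (corner Δ Q k) (m + 1) x with hξdef
  have la : bary (corner Δ Q k) (m + 1) a = 0 := by
    rw [ha, bary_corner (hA k), if_neg n1.symm]
  have lb : bary (corner Δ Q k) (m + 1) b = 1 := by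
    rw [hbdef, bary_corner (hA k), if_pos rfl]
  have la' : bary (corner Δ Q k') (m' + 1) a' = 0 := by
    rw [ha', bary_corner (hA k'), if_neg n1'.symm]
  have lb' : bary (corner Δ Q k') (m' + 1) b' = 1 := by
    rw [hb'def, bary_corner (hA k'), if_pos rfl]
  have hline0 : (a : Plane) = AffineMap.lineMap a b (0 : ℝ) := by simp
  have hline1 : (b : Plane) = AffineMap.lineMap a b (1 : ℝ) := by simp
  have hbv : ∀ {e i}, Δ.IsBoundaryEdge e → i ∈ e → i ∈ Δ.boundaryVertices := fun h hi =>
    Δ.mem_boundaryVertices.2 ⟨_, h, hi⟩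
  have Hs : s ∈ segment ℝ (0 : ℝ) 1 → Δ.tri k' m' = Δ.tri k m ∨ Δ.tri k' m' = Δ.tri k (m + 1) := by
    intro h
    refine hb _ _ he _ (hbv he' (by simp)) ?_
    have := lineMap_real_mem_segment (a := a) (b := b) h
    rw [← hline0, ← hline1] at this
    rw [show Q (Δ.tri k' m') = _ from hal]
    exact this
  have Ht : t ∈ segment ℝ (0 : ℝ) 1 →
      Δ.tri k' (m' + 1) = Δ.tri k m ∨ Δ.tri k' (m' + 1) = Δ.tri k (m + 1) := by
    intro h
    refine hb _ _ he _ (hbv he' (by simp)) ?_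
    have := lineMap_real_mem_segment (a := a) (b := b) h
    rw [← hline0, ← hline1] at this
    rw [show Q (Δ.tri k' (m' + 1)) = _ from hbl]
    exact this
  have hal' : a' = AffineMap.lineMap a b s := hal
  have hbl' : b' = AffineMap.lineMap a b t := hbl
  have Ha : (0 : ℝ) ∈ segment ℝ s t → s = 0 ∨ t = 0 := by
    intro h
    have := lineMap_real_mem_segment (a := a) (b := b) h
    rw [← hline0, ← hal', ← hbl'] at this
    rcases hb _ _ he' _ (hbv he (by simp)) this with h | h
    · left; rw [hs, ha', ← h]; exact la
    · right; rw [ht, hb'def, ← h]; exact la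
  have Hb : (1 : ℝ) ∈ segment ℝ s t → s = 1 ∨ t = 1 := by
    intro h
    have := lineMap_real_mem_segment (a := a) (b := b) h
    rw [← hline1, ← hal', ← hbl'] at this
    rcases hb _ _ he' _ (hbv he (by simp)) this with h | h
    · left; rw [hs, ha', ← h]; exact lb
    · right; rw [ht, hb'def, ← h]; exact lb
  have Hs' : s ∈ segment ℝ (0 : ℝ) 1 → s = 0 ∨ s = 1 := fun h =>
    (Hs h).imp (fun e => by rw [hs, ha', e]; exact la) fun e => by rw [hs, ha', e]; exact lb
  have Ht' : t ∈ segment ℝ (0 : ℝ) 1 → t = 0 ∨ t = 1 := fun h =>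
    (Ht h).imp (fun e => by rw [ht, hb'def, e]; exact la) fun e => by rw [ht, hb'def, e]; exact lb
  -- Both intervals contain `ξ` in their interior, and no end point of one is interior to the other.
  -- Hence they coincide, and `s`, `t` are `0`, `1` in some order.
  have hfin : s ∈ segment ℝ (0 : ℝ) 1 ∧ t ∈ segment ℝ (0 : ℝ) 1 := by
    have key : ∀ s t θ : ℝ, 0 < θ → θ < 1 → ξ = (1 - θ) * s + θ * t → s ≤ t →
        (s ∈ Icc (0 : ℝ) 1 → s = 0 ∨ s = 1) → (t ∈ Icc (0 : ℝ) 1 → t = 0 ∨ t = 1) →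
        ((0 : ℝ) ∈ Icc s t → s = 0 ∨ t = 0) → ((1 : ℝ) ∈ Icc s t → s = 1 ∨ t = 1) →
        s = 0 ∧ t = 1 := by
      intro s t θ h0 h1 hξ hst Hs Ht Ha Hb
      have es : s ≤ ξ := by nlinarith
      have et : ξ ≤ t := by nlinarith
      have hs0 : s ≤ 0 := by
        by_contra hcon
        push Not at hcon
        rcases Hs ⟨hcon.le, by linarith⟩ with h | h <;> linarith
      have ht1 : 1 ≤ t := by
        by_contra hcon
        push Not at hcon
        rcases Ht ⟨by linarith, hcon.le⟩ with h | h <;> linarith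
      refine ⟨?_, ?_⟩
      · rcases Ha ⟨hs0, by linarith⟩ with h | h
        · exact h
        · linarith
      · rcases Hb ⟨by linarith, ht1⟩ with h | h
        · linarith
        · exact h
    simp only [segment_eq_Icc (show (0 : ℝ) ≤ 1 by norm_num)] at Hs' Ht' ⊢
    rcases le_total s t with hst | hst
    · rw [segment_eq_Icc hst] at Ha Hb
      obtain ⟨h, h'⟩ := key s t θ h1' hθ1 hξ hst Hs' Ht' Ha Hb
      rw [h, h']; simp
    · rw [segment_symm, segment_eq_Icc hst] at Ha Hb
      obtain ⟨h, h'⟩ := key t s (1 - θ) (by linarith) (by linarith) (by rw [hξ]; ring) hst Ht' Hs'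
        (fun h => (Ha h).symm) (fun h => (Hb h).symm)
      rw [h, h']; simp
  refine hkk (he'.unique (fun i hi => ?_) fun i hi => ?_)
  · simp only [Finset.mem_insert, Finset.mem_singleton] at hi
    rcases hi with rfl | rfl
    · rcases Hs hfin.1 with h | h <;> rw [h] <;> exact Δ.tri_mem_verts _ _
    · rcases Ht hfin.2 with h | h <;> rw [h] <;> exact Δ.tri_mem_verts _ _
  · simp only [Finset.mem_insert, Finset.mem_singleton] at hi
    rcases hi with rfl | rfl <;> exact Δ.tri_mem_verts _ _

theorem nodalWeight_vertex {k : Fin NT} (hk : 0 < triArea Δ Q k) {i : Fin NV}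
    (hi : i ∈ Δ.verts k) : nodalWeight Δ Q k (Q i) = Pi.single i 1 := by
  ext j
  have := nodalWeight_of_weights hk (w := Pi.single i 1)
    (fun j hj => by
      have : j ≠ i := fun h => hj (h ▸ hi)
      simp [this]) (by simp) j
  simpa [Pi.single_apply, ite_smul] using this

/-- Only points whose carriers in both triangles are boundary edges or boundary vertices escape
`nodalWeight_eq_of_star`. Two such edges belong to one triangle, a vertex inside an edge is excluded
by separation, and two such vertices coincide. -/
theorem weightsAgree_of_separated (hA : ∀ k, 0 < triArea Δ Q k) (hd : InteriorsDisjoint Δ Q)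
    (hb : BoundarySeparated Δ Q) : WeightsAgree Δ Q := by
  intro k k' x hx hx'
  have hVE : ∀ k k' m m', Δ.IsBoundaryEdge {Δ.tri k m, Δ.tri k (m + 1)} →
      0 < bary (corner Δ Q k) m x → 0 < bary (corner Δ Q k) (m + 1) x →
      bary (corner Δ Q k) (m + 2) x = 0 → Δ.tri k' m' ∈ Δ.boundaryVertices →
      x ≠ Q (Δ.tri k' m') := by
    intro k k' m m' he h0 h1 h2 hv hxv
    have hseg := mem_segment_of_bary (p := corner Δ Q k) (hA k).ne' h0.le h1.le h2
    rw [hxv] at hseg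
    rcases hb _ _ he _ hv hseg with h | h <;> rw [hxv, h, bary_corner (hA k)] at h0 h1
    · rw [if_neg (Fin.three_ne m).1.symm] at h1; exact lt_irrefl _ h1
    · rw [if_neg (Fin.three_ne m).1] at h0; exact lt_irrefl _ h0
  rcases eventually_mem_star_or_boundary hA hx with h | ⟨m, he, h0, h1, h2⟩ | ⟨m, hv, hxv⟩
  · exact (nodalWeight_eq_of_star hA hd hx' h).symm
  · rcases eventually_mem_star_or_boundary hA hx' with h | ⟨m', he', h0', h1', h2'⟩ | ⟨m', hv', hxv'⟩
    · exact nodalWeight_eq_of_star hA hd hx h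
    · rw [eq_of_boundaryEdges_meet hA hd hb he h0 h1 h2 he' h0' h1' h2']
    · exact (hVE k k' m m' he h0 h1 h2 hv' hxv').elim
  · rcases eventually_mem_star_or_boundary hA hx' with h | ⟨m', he', h0', h1', h2'⟩ | ⟨m', hv', hxv'⟩
    · exact nodalWeight_eq_of_star hA hd hx h
    · exact (hVE k' k m' m he' h0' h1' h2' hv hxv).elim
    -- The second vertex is an end point of a boundary edge, and the first one lies on that edge
    -- because it has the same position. By separation it is an end point too, and the two end
    -- points have distinct positions.
    · have hii : Δ.tri k m = Δ.tri k' m' := by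
        obtain ⟨e, he, hi⟩ := Δ.mem_boundaryVertices.1 hv'
        obtain ⟨k₁, l, rfl, -⟩ := he.exists_eq
        have hseg : Q (Δ.tri k m) ∈ segment ℝ (Q (Δ.tri k₁ l)) (Q (Δ.tri k₁ (l + 1))) := by
          rw [← hxv, hxv']
          simp only [Finset.mem_insert, Finset.mem_singleton] at hi
          rcases hi with hi | hi <;> rw [hi]
          exacts [left_mem_segment _ _ _, right_mem_segment _ _ _]
        have hinj : ∀ a b, Q (Δ.tri k₁ a) = Q (Δ.tri k₁ b) → a = b := by
          intro a b hab
          by_contra hne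
          have e1 := bary_corner (hA k₁) a a
          have e2 := bary_corner (hA k₁) a b
          rw [hab, e2] at e1
          simp [hne] at e1
        have hxx := hxv.symm.trans hxv'
        simp only [Finset.mem_insert, Finset.mem_singleton] at hi
        rcases hb _ _ he _ hv hseg with h | h <;> rcases hi with hi | hi <;> rw [h, hi] at hxx ⊢ <;>
          exact congrArg _ (hinj _ _ hxx)
      rw [hxv, nodalWeight_vertex (hA k) (Δ.tri_mem_verts k m), hii,
        nodalWeight_vertex (hA k') (Δ.tri_mem_verts k' m')]

theorem WeightsAgree.eq_of_mem_openTriangle (hA : ∀ k, 0 < triArea Δ Q k) (h : WeightsAgree Δ Q)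
    {k k' : Fin NT} {x : Plane} (hx : x ∈ openTriangle (corner Δ Q k))
    (hx' : x ∈ meshTriangle Δ Q k') : k = k' := by
  have hw := h k k' x (openTriangle_subset (p := corner Δ Q k) (hA k).ne' hx) hx'
  have hsub : Δ.verts k ⊆ Δ.verts k' := by
    intro i hi
    obtain ⟨l, rfl⟩ := Δ.mem_verts.1 hi
    by_contra hni
    have := congrFun hw (Δ.tri k l)
    rw [nodalWeight_tri, nodalWeight_of_notMem Q x hni] at this
    exact (hx l).ne' this
  exact Δ.verts_injective (Finset.eq_of_subset_of_card_le hsub (by simp [Δ.card_verts]))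

theorem WeightsAgree.interiorsDisjoint (hA : ∀ k, 0 < triArea Δ Q k) (h : WeightsAgree Δ Q) :
    InteriorsDisjoint Δ Q := fun _ _ _ hx hx' =>
  h.eq_of_mem_openTriangle hA hx (openTriangle_subset (p := corner Δ Q _) (hA _).ne' hx')

theorem tendsto_corner {α : Type*} {F : Filter α} {P : α → Fin NV → Plane} (h : Tendsto P F (𝓝 Q))
    (k : Fin NT) : Tendsto (fun n => corner Δ (P n) k) F (𝓝 (corner Δ Q k)) :=
  tendsto_pi_nhds.2 fun _ => tendsto_pi_nhds.1 h _

theorem eventually_mem_openTriangle {α : Type*} {F : Filter α} {P : α → Fin NV → Plane}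
    (h : Tendsto P F (𝓝 Q)) {k : Fin NT} (hk : 0 < triArea Δ Q k) {x : Plane}
    (hx : x ∈ openTriangle (corner Δ Q k)) : ∀ᶠ n in F, x ∈ openTriangle (corner Δ (P n) k) := by
  simp only [openTriangle, mem_ofPred_eq, eventually_all]
  exact fun l => (tendsto_bary (tendsto_corner h k) hk.ne' l tendsto_const_nhds).eventually_const_lt
    (hx l)

/-- The limit of admissible meshes is admissible if no triangle degenerates and no boundary vertex
touches a boundary edge. -/
theorem mem_plusManifold_of_tendsto {P : ℕ → Fin NV → Plane} (h : Tendsto P atTop (𝓝 Q))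
    (hP : ∀ n, P n ∈ plusManifold Δ) (hA : ∀ k, 0 < triArea Δ Q k) (hb : BoundarySeparated Δ Q) :
    Q ∈ plusManifold Δ := by
  refine mem_plusManifold_iff.2 ⟨hA, weightsAgree_of_separated hA (fun k k' x hx hx' => ?_) hb⟩
  -- Open triangles are given by strict inequalities, so an overlap in the limit would already be
  -- present in some `P n`.
  obtain ⟨n, h1, h2⟩ := ((eventually_mem_openTriangle h (hA k) hx).and
    (eventually_mem_openTriangle h (hA k') hx')).exists
  obtain ⟨g1, g2⟩ := mem_plusManifold_iff.1 (hP n)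
  exact g2.interiorsDisjoint g1 k k' x h1 h2

end Admissibility

/-! ### Piecewise affine functions and nodal values. -/

section FiniteElements

variable {NV NT : ℕ} {Δ : OrientedConnectivityComplex NV NT} {Q : Fin NV → Plane}

/-- The affine function on the plane with given values at the vertices of the `k`-th triangle. -/
noncomputable def localP1 (Δ : OrientedConnectivityComplex NV NT) (Q : Fin NV → Plane)
    (u : Fin NV → ℝ) (k : Fin NT) (x : Plane) : ℝ :=
  ∑ l, u (Δ.tri k l) * bary (corner Δ Q k) l x

/-- The gradient of `localP1`. -/
noncomputable def p1Grad (Δ : OrientedConnectivityComplex NV NT) (Q : Fin NV → Plane)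
    (u : Fin NV → ℝ) (k : Fin NT) : Plane :=
  ∑ l, u (Δ.tri k l) • baryGrad (corner Δ Q k) l

open Classical in
/-- The piecewise affine interpolation of nodal values, extended by zero to the plane. -/
noncomputable def interp (Δ : OrientedConnectivityComplex NV NT) (Q : Fin NV → Plane)
    (u : Fin NV → ℝ) (x : Plane) : ℝ :=
  if h : ∃ k, x ∈ meshTriangle Δ Q k then localP1 Δ Q u h.choose x else 0

theorem localP1_eq (u : Fin NV → ℝ) (k : Fin NT) (x y : Plane) :
    localP1 Δ Q u k x = localP1 Δ Q u k y + inner ℝ (p1Grad Δ Q u k) (x - y) := by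
  simp only [localP1, p1Grad, sum_inner, inner_smul_left, ← Finset.sum_add_distrib]
  refine Finset.sum_congr rfl fun l _ => ?_
  rw [bary_eq _ _ x y]; simp; ring

theorem localP1_eq_sum_nodalWeight (u : Fin NV → ℝ) (k : Fin NT) (x : Plane) :
    localP1 Δ Q u k x = ∑ i, u i * nodalWeight Δ Q k x i := by
  rw [sum_nodal k fun i hi => by rw [nodalWeight_of_notMem Q x hi, mul_zero]]
  simp only [nodalWeight_tri, localP1]

theorem continuous_localP1 (u : Fin NV → ℝ) (k : Fin NT) : Continuous (localP1 Δ Q u k) :=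
  continuous_finsetSum _ fun l _ => continuous_const.mul (continuous_bary _ l)

theorem hasGradientAt_localP1 (u : Fin NV → ℝ) (k : Fin NT) (x : Plane) :
    HasGradientAt (localP1 Δ Q u k) (p1Grad Δ Q u k) x := by
  have : localP1 Δ Q u k = fun x => localP1 Δ Q u k 0 + inner ℝ (p1Grad Δ Q u k) x := by
    ext x; simpa using localP1_eq u k x 0
  rw [this, hasGradientAt_iff_hasFDerivAt]
  exact ((InnerProductSpace.toDual ℝ Plane (p1Grad Δ Q u k)).hasFDerivAt).const_add _

theorem exists_affineMap_localP1 (u : Fin NV → ℝ) (k : Fin NT) :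
    ∃ A : Plane →ᵃ[ℝ] ℝ, ⇑A = localP1 Δ Q u k := by
  refine ⟨(innerₛₗ ℝ (p1Grad Δ Q u k)).toAffineMap + AffineMap.const ℝ Plane (localP1 Δ Q u k 0), ?_⟩
  ext x
  have := localP1_eq (Δ := Δ) (Q := Q) u k x 0
  simp only [sub_zero] at this
  simp [this, add_comm]

/-- The triangle chosen in `interp` is immaterial because the weights agree. -/
theorem interp_eq (hW : WeightsAgree Δ Q) (u : Fin NV → ℝ) {k : Fin NT} {x : Plane}
    (hx : x ∈ meshTriangle Δ Q k) : interp Δ Q u x = localP1 Δ Q u k x := by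
  have h : ∃ k, x ∈ meshTriangle Δ Q k := ⟨k, hx⟩
  rw [interp, dif_pos h, localP1_eq_sum_nodalWeight, localP1_eq_sum_nodalWeight,
    hW _ _ x h.choose_spec hx]

theorem mem_meshDomain {x : Plane} : x ∈ meshDomain Δ Q ↔ ∃ k, x ∈ meshTriangle Δ Q k := by
  simp [meshDomain]

theorem interp_of_notMem (u : Fin NV → ℝ) {x : Plane} (hx : x ∉ meshDomain Δ Q) :
    interp Δ Q u x = 0 := by
  rw [interp, dif_neg fun h => hx (mem_meshDomain.2 h)]

theorem isClosed_meshTriangle (k : Fin NT) : IsClosed (meshTriangle Δ Q k) :=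
  (isCompact_triangle (corner Δ Q k)).isClosed

theorem isCompact_meshDomain : IsCompact (meshDomain Δ Q) :=
  isCompact_iUnion fun k => isCompact_triangle (corner Δ Q k)

theorem isP1_interp (hW : WeightsAgree Δ Q) (u : Fin NV → ℝ) : IsP1 Δ Q (interp Δ Q u) := by
  refine ⟨?_, fun k => ?_⟩
  · refine (locallyFinite_of_finite _).continuousOn_iUnion (fun k => isClosed_meshTriangle k)
      fun {k} => ?_
    exact (continuous_localP1 u k).continuousOn.congr fun x hx => interp_eq hW u hx
  · obtain ⟨A, hA⟩ := exists_affineMap_localP1 (Δ := Δ) (Q := Q) u k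
    exact ⟨A, fun x hx => by rw [interp_eq hW u hx, hA]⟩

theorem vertex_mem_meshTriangle (k : Fin NT) (l : Fin 3) : Q (Δ.tri k l) ∈ meshTriangle Δ Q k :=
  subset_convexHull ℝ _ ⟨l, rfl⟩

theorem vertex_mem_meshDomain (i : Fin NV) : Q i ∈ meshDomain Δ Q := by
  obtain ⟨k, hk⟩ := Δ.exists_mem_verts i
  obtain ⟨l, rfl⟩ := Δ.mem_verts.1 hk
  exact mem_meshDomain.2 ⟨k, vertex_mem_meshTriangle k l⟩

theorem interp_vertex (hA : ∀ k, 0 < triArea Δ Q k) (hW : WeightsAgree Δ Q) (u : Fin NV → ℝ)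
    (i : Fin NV) : interp Δ Q u (Q i) = u i := by
  obtain ⟨k, hk⟩ := Δ.exists_mem_verts i
  obtain ⟨l, rfl⟩ := Δ.mem_verts.1 hk
  rw [interp_eq hW u (vertex_mem_meshTriangle k l), localP1]
  simp [bary_corner (hA k)]

theorem IsP1.eq_localP1 (hA : ∀ k, 0 < triArea Δ Q k) {y : Plane → ℝ}
    (hy : IsP1 Δ Q y) {k : Fin NT} {x : Plane} (hx : x ∈ meshTriangle Δ Q k) :
    y x = localP1 Δ Q (y ∘ Q) k x := by
  obtain ⟨A, h⟩ := hy.2 k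
  have hc := bary_combination (p := corner Δ Q k) (hA k).ne' x
  have hs := bary_sum (p := corner Δ Q k) (hA k).ne' x
  have hlin : ∀ z, A z = A.linear z + A 0 := fun z => congrFun A.decomp z
  have h1 : ∀ l, (y ∘ Q) (Δ.tri k l) = A (corner Δ Q k l) := fun l =>
    h (vertex_mem_meshTriangle k l)
  rw [h hx, localP1]
  simp only [h1]
  rw [hlin x]
  conv_lhs => rw [← hc]
  simp only [hlin (corner Δ Q k _), map_sum, map_smul, smul_eq_mul, add_mul,
    Finset.sum_add_distrib, ← Finset.mul_sum, hs, mul_one]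
  congr 1
  exact Finset.sum_congr rfl fun l _ => mul_comm _ _

theorem frontier_meshDomain_subset : frontier (meshDomain Δ Q) ⊆ meshDomain Δ Q :=
  (isCompact_meshDomain (Δ := Δ) (Q := Q)).isClosed.frontier_subset

theorem boundary_of_mem_frontier (hA : ∀ k, 0 < triArea Δ Q k) {k : Fin NT} {x : Plane}
    (hx : x ∈ meshTriangle Δ Q k) (hf : x ∈ frontier (meshDomain Δ Q)) :
    (∃ m, Δ.IsBoundaryEdge {Δ.tri k m, Δ.tri k (m + 1)} ∧ bary (corner Δ Q k) (m + 2) x = 0) ∨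
    (∃ m, Δ.tri k m ∈ Δ.boundaryVertices ∧ x = Q (Δ.tri k m)) := by
  rcases eventually_mem_star_or_boundary hA hx with h | ⟨m, he, -, -, h2⟩ | h
  · refine (hf.2 (mem_interior_iff_mem_nhds.2 ?_)).elim
    filter_upwards [h] with y hy
    obtain ⟨k', hk', -⟩ := hy
    exact mem_meshDomain.2 ⟨k', hk'⟩
  · exact Or.inl ⟨m, he, h2⟩
  · exact Or.inr h

/-- The region is compact and nonempty, hence not the whole plane. So it has a frontier point, and
such a point lies on a boundary edge or is a boundary vertex. -/
theorem boundaryVertices_nonempty (hA : ∀ k, 0 < triArea Δ Q k) : Δ.boundaryVertices.Nonempty := by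
  obtain ⟨k⟩ := Δ.nonempty_triangles
  have hne : (meshDomain Δ Q).Nonempty := ⟨_, mem_meshDomain.2 ⟨k, vertex_mem_meshTriangle k 0⟩⟩
  have hun : meshDomain Δ Q ≠ univ := fun h => by
    have := isCompact_meshDomain (Δ := Δ) (Q := Q)
    rw [h] at this
    exact noncompact_univ Plane this
  obtain ⟨x, hx⟩ := nonempty_frontier_iff.2 ⟨hne, hun⟩
  obtain ⟨k, hk⟩ := mem_meshDomain.1 (frontier_meshDomain_subset hx)
  rcases boundary_of_mem_frontier hA hk hx with ⟨m, he, -⟩ | ⟨m, h, -⟩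
  · exact ⟨Δ.tri k m, Δ.mem_boundaryVertices.2 ⟨_, he, by simp⟩⟩
  · exact ⟨_, h⟩

theorem localP1_eq_zero_of_mem_frontier (hA : ∀ k, 0 < triArea Δ Q k) {u : Fin NV → ℝ}
    (hu : ∀ i ∈ Δ.boundaryVertices, u i = 0) {k : Fin NT} {x : Plane}
    (hx : x ∈ meshTriangle Δ Q k) (hf : x ∈ frontier (meshDomain Δ Q)) :
    localP1 Δ Q u k x = 0 := by
  rcases boundary_of_mem_frontier hA hx hf with ⟨m, he, h2⟩ | ⟨m, h, rfl⟩
  · refine Finset.sum_eq_zero fun l _ => ?_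
    rcases Fin.three_cases m l with rfl | rfl | rfl
    · rw [hu _ (Δ.mem_boundaryVertices.2 ⟨_, he, by simp⟩), zero_mul]
    · rw [hu _ (Δ.mem_boundaryVertices.2 ⟨_, he, by simp⟩), zero_mul]
    · rw [h2, mul_zero]
  · simp [localP1, bary_corner (hA k), hu _ h]

theorem isP1Zero_interp (hA : ∀ k, 0 < triArea Δ Q k) (hW : WeightsAgree Δ Q) {u : Fin NV → ℝ}
    (hu : ∀ i ∈ Δ.boundaryVertices, u i = 0) : IsP1Zero Δ Q (interp Δ Q u) := by
  refine ⟨isP1_interp hW u, fun x hx => ?_⟩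
  obtain ⟨k, hk⟩ := mem_meshDomain.1 (frontier_meshDomain_subset hx)
  rw [interp_eq hW u hk, localP1_eq_zero_of_mem_frontier hA hu hk hx]

/-- A second triangle through `x` would contain both end points of the edge, since their weights are
positive. So near `x` the region is just triangle `k`, and stepping against the gradient of the
third coordinate leaves it. -/
theorem notMem_interior_of_boundaryEdge (hA : ∀ k, 0 < triArea Δ Q k) (hW : WeightsAgree Δ Q)
    {k : Fin NT} {m : Fin 3} (he : Δ.IsBoundaryEdge {Δ.tri k m, Δ.tri k (m + 1)}) {x : Plane}
    (h0 : 0 < bary (corner Δ Q k) m x) (h1 : 0 < bary (corner Δ Q k) (m + 1) x)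
    (h2 : bary (corner Δ Q k) (m + 2) x = 0) : x ∉ interior (meshDomain Δ Q) := by
  intro hint
  have hp : vertexArea (corner Δ Q k) ≠ 0 := (hA k).ne'
  have hxk : x ∈ meshTriangle Δ Q k := (mem_meshTriangle_iff (hA k)).2 fun l => by
    rcases Fin.three_cases m l with rfl | rfl | rfl
    exacts [h0.le, h1.le, h2.ge]
  have hother : ∀ k', k' ≠ k → x ∉ meshTriangle Δ Q k' := by
    intro k' hne hx'
    refine hne (he.unique (fun i hi => ?_) fun i hi => ?_)
    · have hw := hW k k' x hxk hx'
      by_contra hni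
      have := congrFun hw i
      rw [nodalWeight_of_notMem Q x hni] at this
      simp only [Finset.mem_insert, Finset.mem_singleton] at hi
      rcases hi with rfl | rfl <;> rw [nodalWeight_tri] at this <;> linarith
    · simp only [Finset.mem_insert, Finset.mem_singleton] at hi
      rcases hi with rfl | rfl <;> exact Δ.tri_mem_verts _ _
  have hev : ∀ᶠ y in 𝓝 x, ∀ k', k' ≠ k → y ∉ meshTriangle Δ Q k' := by
    simp only [eventually_all]
    exact fun k' hne => (isClosed_meshTriangle k').isOpen_compl.mem_nhds (hother k' hne)
  have hev2 : ∀ᶠ y in 𝓝 x, 0 ≤ bary (corner Δ Q k) (m + 2) y := by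
    filter_upwards [hev, mem_interior_iff_mem_nhds.1 hint] with y hy hy'
    obtain ⟨k', hk'⟩ := mem_meshDomain.1 hy'
    by_cases hkk : k' = k
    · subst hkk
      exact (mem_meshTriangle_iff (hA _)).1 hk' _
    · exact (hy k' hkk hk').elim
  set g := baryGrad (corner Δ Q k) (m + 2)
  have ht : Tendsto (fun t : ℝ => x - t • g) (𝓝[>] 0) (𝓝 x) := by
    have : Tendsto (fun t : ℝ => x - t • g) (𝓝 0) (𝓝 (x - (0 : ℝ) • g)) :=
      Continuous.tendsto (by fun_prop) 0
    rw [zero_smul, sub_zero] at this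
    exact this.mono_left nhdsWithin_le_nhds
  obtain ⟨t, ht1, ht0⟩ := ((ht.eventually hev2).and self_mem_nhdsWithin).exists
  rw [bary_eq _ _ _ x, h2, sub_sub_cancel_left, inner_neg_right, inner_smul_right] at ht1
  have : 0 < t * inner ℝ g g :=
    mul_pos ht0 (real_inner_self_pos.2 (baryGrad_ne_zero hp _))
  linarith

/-- A boundary vertex is a limit of relatively interior points of a boundary edge. This links the
topological boundary condition to the combinatorial one on nodal values. -/
theorem boundaryVertex_mem_frontier (hA : ∀ k, 0 < triArea Δ Q k) (hW : WeightsAgree Δ Q)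
    {i : Fin NV} (hi : i ∈ Δ.boundaryVertices) : Q i ∈ frontier (meshDomain Δ Q) := by
  refine ⟨subset_closure (vertex_mem_meshDomain i), fun hint => ?_⟩
  obtain ⟨e, he, hie⟩ := Δ.mem_boundaryVertices.1 hi
  obtain ⟨k, m, rfl, -⟩ := he.exists_eq
  have hp : vertexArea (corner Δ Q k) ≠ 0 := (hA k).ne'
  obtain ⟨n1, n2, n3⟩ := Fin.three_ne m
  set a := Q (Δ.tri k m) with ha
  set b := Q (Δ.tri k (m + 1)) with hb
  have hrel : ∀ t ∈ Ioo (0 : ℝ) 1, a + t • (b - a) ∉ interior (meshDomain Δ Q) := by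
    intro t ht
    have hbt : ∀ l, bary (corner Δ Q k) l (a + t • (b - a)) =
        (1 - t) * bary (corner Δ Q k) l a + t * bary (corner Δ Q k) l b := by
      intro l
      rw [bary_eq _ l _ a, add_sub_cancel_left, inner_smul_right, ← bary_sub]; ring
    refine notMem_interior_of_boundaryEdge hA hW he ?_ ?_ ?_ <;>
      rw [hbt, ha, hb, bary_corner (hA k), bary_corner (hA k)]
    · simp [n1, ht.2]
    · simp [n1.symm, ht.1]
    · simp [n2.symm, n3.symm]
  have hcont : Continuous fun t : ℝ => a + t • (b - a) := by fun_prop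
  simp only [Finset.mem_insert, Finset.mem_singleton] at hie
  rcases hie with rfl | rfl
  · have ht : Tendsto (fun t : ℝ => a + t • (b - a)) (𝓝[>] 0) (𝓝 a) := by
      simpa using (hcont.tendsto 0).mono_left (nhdsWithin_le_nhds (s := Ioi 0))
    obtain ⟨t, h1, h2⟩ := ((ht.eventually (isOpen_interior.mem_nhds hint)).and
      (Ioo_mem_nhdsGT (show (0 : ℝ) < 1 by norm_num))).exists
    exact hrel t h2 h1
  · have ht : Tendsto (fun t : ℝ => a + t • (b - a)) (𝓝[<] 1) (𝓝 b) := by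
      simpa using (hcont.tendsto 1).mono_left (nhdsWithin_le_nhds (s := Iio 1))
    obtain ⟨t, h1, h2⟩ := ((ht.eventually (isOpen_interior.mem_nhds hint)).and
      (Ioo_mem_nhdsLT (show (0 : ℝ) < 1 by norm_num))).exists
    exact hrel t h2 h1

theorem IsP1Zero.nodal_eq_zero (hA : ∀ k, 0 < triArea Δ Q k) (hW : WeightsAgree Δ Q)
    {y : Plane → ℝ} (hy : IsP1Zero Δ Q y) : ∀ i ∈ Δ.boundaryVertices, (y ∘ Q) i = 0 :=
  fun _ hi => hy.2 _ (boundaryVertex_mem_frontier hA hW hi)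

theorem IsP1.gradient_eq (hA : ∀ k, 0 < triArea Δ Q k) {y : Plane → ℝ} (hy : IsP1 Δ Q y)
    {k : Fin NT} {x : Plane} (hx : x ∈ openTriangle (corner Δ Q k)) :
    gradient y x = p1Grad Δ Q (y ∘ Q) k := by
  refine HasGradientAt.gradient ((hasGradientAt_localP1 (y ∘ Q) k x).congr_of_eventuallyEq ?_)
  filter_upwards [(isOpen_openTriangle _).mem_nhds hx] with z hz
  exact hy.eq_localP1 hA (openTriangle_subset (p := corner Δ Q k) (hA k).ne' hz)

theorem meshDomain_ae_eq (hA : ∀ k, 0 < triArea Δ Q k) :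
    meshDomain Δ Q =ᵐ[volume] ⋃ k, openTriangle (corner Δ Q k) := by
  refine eventuallyLE_antisymm_iff.2 ⟨?_, ?_⟩
  · rw [ae_le_set]
    refine measure_mono_null (t := ⋃ k, meshTriangle Δ Q k \ openTriangle (corner Δ Q k)) ?_
      (measure_iUnion_null fun k => volume_convexHull_diff_openTriangle (p := corner Δ Q k)
        (hA k).ne')
    rintro x ⟨hx, hx'⟩
    obtain ⟨k, hk⟩ := mem_meshDomain.1 hx
    exact mem_iUnion.2 ⟨k, hk, fun h => hx' (mem_iUnion.2 ⟨k, h⟩)⟩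
  · exact Eventually.of_forall (iUnion_mono fun k =>
      openTriangle_subset (p := corner Δ Q k) (hA k).ne')

theorem integral_meshDomain (hA : ∀ k, 0 < triArea Δ Q k) (hW : WeightsAgree Δ Q)
    {f : Plane → ℝ} (hf : ∀ k, IntegrableOn f (openTriangle (corner Δ Q k))) :
    ∫ x in meshDomain Δ Q, f x = ∑ k, ∫ x in openTriangle (corner Δ Q k), f x := by
  rw [setIntegral_congr_set (meshDomain_ae_eq hA)]
  refine integral_iUnion_fintype (fun k => (isOpen_openTriangle _).measurableSet)
    (fun k k' hkk => ?_) hf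
  rw [Function.onFun, disjoint_left]
  exact fun x hx hx' => hkk (hW.interiorsDisjoint hA k k' x hx hx')

/-- The stiffness form in terms of nodal values. -/
noncomputable def stiffness (Δ : OrientedConnectivityComplex NV NT) (Q : Fin NV → Plane)
    (u v : Fin NV → ℝ) : ℝ :=
  ∑ k, volume.real (openTriangle (corner Δ Q k)) * inner ℝ (p1Grad Δ Q u k) (p1Grad Δ Q v k)

/-- The load functional in terms of nodal values. -/
noncomputable def load (Δ : OrientedConnectivityComplex NV NT) (r : Plane → ℝ)
    (Q : Fin NV → Plane) (v : Fin NV → ℝ) : ℝ :=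
  ∑ k, ∫ x in openTriangle (corner Δ Q k), r x * localP1 Δ Q v k x

theorem volume_openTriangle_lt_top {p : Fin 3 → Plane} (hp : vertexArea p ≠ 0) :
    volume (openTriangle p) < ⊤ :=
  (measure_mono (openTriangle_subset hp)).trans_lt (isCompact_triangle p).measure_lt_top

theorem integral_gradient_eq_stiffness (hA : ∀ k, 0 < triArea Δ Q k) (hW : WeightsAgree Δ Q)
    {y v : Plane → ℝ} (hy : IsP1 Δ Q y) (hv : IsP1 Δ Q v) :
    ∫ x in meshDomain Δ Q, inner ℝ (gradient y x) (gradient v x) =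
      stiffness Δ Q (y ∘ Q) (v ∘ Q) := by
  have hc : ∀ k, EqOn (fun x => inner ℝ (gradient y x) (gradient v x))
      (fun _ => inner ℝ (p1Grad Δ Q (y ∘ Q) k) (p1Grad Δ Q (v ∘ Q) k))
      (openTriangle (corner Δ Q k)) := fun k x hx => by
    simp only [hy.gradient_eq hA hx, hv.gradient_eq hA hx]
  have hm : ∀ k, MeasurableSet (openTriangle (corner Δ Q k)) :=
    fun k => (isOpen_openTriangle _).measurableSet
  rw [integral_meshDomain hA hW fun k => (integrableOn_const
    (volume_openTriangle_lt_top (p := corner Δ Q k) (hA k).ne').ne).congr_fun (hc k).symm (hm k)]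
  refine Finset.sum_congr rfl fun k _ => ?_
  rw [setIntegral_congr_fun (hm k) (hc k), setIntegral_const, smul_eq_mul]

theorem integral_mul_eq_load (hA : ∀ k, 0 < triArea Δ Q k) (hW : WeightsAgree Δ Q)
    {r v : Plane → ℝ} (hr : IntegrableOn r (meshDomain Δ Q)) (hv : IsP1 Δ Q v) :
    ∫ x in meshDomain Δ Q, r x * v x = load Δ r Q (v ∘ Q) := by
  have hsub : ∀ k, openTriangle (corner Δ Q k) ⊆ meshDomain Δ Q := fun k x hx =>
    mem_meshDomain.2 ⟨k, openTriangle_subset (p := corner Δ Q k) (hA k).ne' hx⟩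
  rw [integral_meshDomain hA hW fun k =>
    (hr.mul_continuousOn hv.1 isCompact_meshDomain).mono_set (hsub k)]
  refine Finset.sum_congr rfl fun k _ =>
    setIntegral_congr_fun (isOpen_openTriangle _).measurableSet fun x hx => ?_
  simp only [hv.eq_localP1 hA (openTriangle_subset (p := corner Δ Q k) (hA k).ne' hx)]

theorem integral_eq_load_one (hA : ∀ k, 0 < triArea Δ Q k) (hW : WeightsAgree Δ Q)
    {v : Plane → ℝ} (hv : IsP1 Δ Q v) :
    ∫ x in meshDomain Δ Q, v x = load Δ (fun _ => 1) Q (v ∘ Q) := by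
  rw [← integral_mul_eq_load hA hW (integrableOn_const isCompact_meshDomain.measure_lt_top.ne) hv]
  simp

/-- Every nodal vector vanishing at the boundary vertices is the trace of an admissible test
function, its interpolant. -/
theorem IsDiscreteState.nodal (hA : ∀ k, 0 < triArea Δ Q k) (hW : WeightsAgree Δ Q)
    {r y : Plane → ℝ} (hr : IntegrableOn r (meshDomain Δ Q)) (hy : IsDiscreteState Δ r Q y)
    {v : Fin NV → ℝ} (hv : ∀ i ∈ Δ.boundaryVertices, v i = 0) :
    stiffness Δ Q (y ∘ Q) v = load Δ r Q v := by
  have hvi := isP1Zero_interp hA hW hv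
  have hvQ : interp Δ Q v ∘ Q = v := funext fun i => interp_vertex hA hW v i
  have := hy.2 _ hvi
  rwa [integral_gradient_eq_stiffness hA hW hy.1.1 hvi.1, integral_mul_eq_load hA hW hr hvi.1,
    hvQ] at this

theorem isDiscreteState_interp (hA : ∀ k, 0 < triArea Δ Q k) (hW : WeightsAgree Δ Q)
    {r : Plane → ℝ} (hr : IntegrableOn r (meshDomain Δ Q)) {u : Fin NV → ℝ}
    (hu : ∀ i ∈ Δ.boundaryVertices, u i = 0)
    (h : ∀ v : Fin NV → ℝ, (∀ i ∈ Δ.boundaryVertices, v i = 0) →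
      stiffness Δ Q u v = load Δ r Q v) : IsDiscreteState Δ r Q (interp Δ Q u) := by
  have hui := isP1Zero_interp hA hW hu
  have huQ : interp Δ Q u ∘ Q = u := funext fun i => interp_vertex hA hW u i
  refine ⟨hui, fun v hv => ?_⟩
  rw [integral_gradient_eq_stiffness hA hW hui.1 hv.1, integral_mul_eq_load hA hW hr hv.1, huQ]
  exact h _ (hv.nodal_eq_zero hA hW)

end FiniteElements

/-! ### Lipschitz bounds on finite closed covers. -/

section Lipschitz

/-- Immediately to the right of any `x`, one of the finitely many pieces is met again and again.
Being closed it contains `x`, so slopes at most `L` occur arbitrarily close to `x`, which is enough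
for the mean value inequality. -/
theorem le_add_mul_of_finite_closed_cover {ι : Type*} [Finite ι] {C : ι → Set ℝ}
    (hcl : ∀ i, IsClosed (C i)) (hcov : ⋃ i, C i = univ) {f : ℝ → ℝ} {L : ℝ}
    (hf : Continuous f) (h : ∀ i, ∀ x ∈ C i, ∀ z ∈ C i, |f x - f z| ≤ L * |x - z|) :
    f 1 ≤ f 0 + L := by
  have hB : ∀ x : ℝ, HasDerivAt (fun t => f 0 + L * t) L x := fun x => by
    simpa using ((hasDerivAt_id x).const_mul L).const_add (f 0)
  have := image_le_of_liminf_slope_right_le_deriv_boundary (f := f) (a := 0) (b := 1)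
    (B := fun t => f 0 + L * t) (B' := fun _ => L) hf.continuousOn (by simp) (by fun_prop)
    (fun x _ => (hB x).hasDerivWithinAt) (fun x _ r hr => ?_) (right_mem_Icc.2 zero_le_one)
  · simpa using this
  have hfreq : ∃ᶠ z in 𝓝[>] x, ∃ i, z ∈ C i := Eventually.frequently (Eventually.of_forall fun z =>
    by simpa using hcov.ge (mem_univ z))
  rw [frequently_exists] at hfreq
  obtain ⟨i, hi⟩ := hfreq
  have hx : x ∈ C i := by
    rw [← (hcl i).closure_eq]
    exact mem_closure_iff_frequently.2 (hi.filter_mono nhdsWithin_le_nhds)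
  refine (hi.and_eventually self_mem_nhdsWithin).mono fun z hz => ?_
  obtain ⟨hzC, hzx⟩ := hz
  have hpos : 0 < z - x := sub_pos.2 hzx
  have := (le_abs_self _).trans (h i z hzC x hx)
  rw [abs_of_pos hpos] at this
  rw [slope_def_field]
  exact ((div_le_iff₀ hpos).2 this).trans_lt hr

theorem lipschitzWith_of_finite_closed_cover {ι E : Type*} [Finite ι] [NormedAddCommGroup E]
    [NormedSpace ℝ E] {C : ι → Set E} (hcl : ∀ i, IsClosed (C i)) (hcov : ⋃ i, C i = univ)
    {f : E → ℝ} {L : NNReal} (h : ∀ i, LipschitzOnWith L f (C i)) : LipschitzWith L f := by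
  have hf : Continuous f := (locallyFinite_of_finite C).continuous hcov hcl
    fun i => (h i).continuousOn
  have key : ∀ (g : E → ℝ), (∀ i, LipschitzOnWith L g (C i)) → Continuous g → ∀ x y : E,
      g y ≤ g x + L * ‖y - x‖ := by
    intro g h hg x y
    have hl : Continuous fun t : ℝ => x + t • (y - x) := by fun_prop
    have := le_add_mul_of_finite_closed_cover (C := fun i => (fun t : ℝ => x + t • (y - x)) ⁻¹' C i)
      (fun i => (hcl i).preimage hl) (by rw [← preimage_iUnion, hcov, preimage_univ])
      (f := fun t => g (x + t • (y - x))) (L := L * ‖y - x‖) (hg.comp hl) (fun i s hs t ht => by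
        have := (h i).dist_le_mul _ hs _ ht
        rw [Real.dist_eq, dist_eq_norm, add_sub_add_left_eq_sub, ← sub_smul, norm_smul,
          Real.norm_eq_abs] at this
        linarith)
    simpa using this
  refine LipschitzWith.of_le_add_mul L fun x y => ?_
  have := key f h hf y x
  rwa [dist_eq_norm]

end Lipschitz

/-! ### Poincaré inequality and energy bound. -/

section Poincare

variable {NV NT : ℕ} {Δ : OrientedConnectivityComplex NV NT} {Q : Fin NV → Plane}

theorem lipschitzOnWith_localP1 (u : Fin NV → ℝ) (k : Fin NT) (s : Set Plane) :
    LipschitzOnWith ‖p1Grad Δ Q u k‖₊ (localP1 Δ Q u k) s := by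
  refine LipschitzOnWith.of_dist_le_mul fun x _ y _ => ?_
  rw [Real.dist_eq, localP1_eq u k x y, add_sub_cancel_left, dist_eq_norm, coe_nnnorm]
  exact abs_real_inner_le_norm _ _

theorem exists_lipschitzWith_interp (hA : ∀ k, 0 < triArea Δ Q k) (hW : WeightsAgree Δ Q)
    {u : Fin NV → ℝ} (hu : ∀ i ∈ Δ.boundaryVertices, u i = 0) :
    ∃ L, LipschitzWith L (interp Δ Q u) := by
  -- The piece `none` is the closure of the exterior, where the extension by zero vanishes thanks to
  -- the boundary values.
  let C : Option (Fin NT) → Set Plane := fun o =>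
    o.elim (closure (meshDomain Δ Q)ᶜ) fun k => meshTriangle Δ Q k
  refine ⟨∑ k, ‖p1Grad Δ Q u k‖₊, lipschitzWith_of_finite_closed_cover (C := C) ?_ ?_ ?_⟩
  · rintro (_ | k)
    exacts [isClosed_closure, isClosed_meshTriangle k]
  · refine eq_univ_of_forall fun x => mem_iUnion.2 ?_
    by_cases hx : x ∈ meshDomain Δ Q
    · obtain ⟨k, hk⟩ := mem_meshDomain.1 hx
      exact ⟨some k, hk⟩
    · exact ⟨none, subset_closure hx⟩
  · rintro (_ | k)
    · have hz : ∀ x ∈ closure (meshDomain Δ Q)ᶜ, interp Δ Q u x = 0 := by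
        intro x hx
        by_cases hxm : x ∈ meshDomain Δ Q
        · exact (isP1Zero_interp hA hW hu).2 x
            (frontier_eq_closure_inter_closure (s := meshDomain Δ Q) ▸ ⟨subset_closure hxm, hx⟩)
        · exact interp_of_notMem u hxm
      refine LipschitzOnWith.of_dist_le_mul fun x hx y hy => ?_
      rw [hz x hx, hz y hy, dist_self]
      positivity
    · refine LipschitzOnWith.weaken (K := ‖p1Grad Δ Q u k‖₊) (fun x hx y hy => ?_)
        (Finset.single_le_sum (f := fun k => ‖p1Grad Δ Q u k‖₊) (fun _ _ => zero_le)
          (Finset.mem_univ k))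
      rw [interp_eq hW u hx, interp_eq hW u hy]
      exact lipschitzOnWith_localP1 u k _ hx hy

/-- A Poincaré inequality in `L¹`. -/
theorem integral_abs_interp_le (hA : ∀ k, 0 < triArea Δ Q k) (hW : WeightsAgree Δ Q)
    {u : Fin NV → ℝ} (hu : ∀ i ∈ Δ.boundaryVertices, u i = 0) {R : ℝ}
    (hR : ∀ x ∈ meshDomain Δ Q, |x 0| ≤ R) :
    ∫ x, |interp Δ Q u x| ≤
      ∑ k, volume.real (openTriangle (corner Δ Q k)) * (R * ‖p1Grad Δ Q u k‖) := by
  obtain ⟨L, hL⟩ := exists_lipschitzWith_interp hA hW hu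
  set e : Plane := EuclideanSpace.single 0 1 with he
  have hf : LipschitzWith 1 (fun x : Plane => x 0) := by
    refine LipschitzWith.of_dist_le_mul fun x y => ?_
    rw [NNReal.coe_one, one_mul, dist_eq_norm, dist_eq_norm]
    exact PiLp.norm_apply_le (x - y) 0
  have hg : LipschitzWith (1 * L) (fun x => |interp Δ Q u x|) := by
    have := lipschitzWith_one_norm (E := ℝ) |>.comp hL
    exact this
  have hgc : HasCompactSupport fun x => |interp Δ Q u x| :=
    HasCompactSupport.intro (isCompact_meshDomain (Δ := Δ) (Q := Q)) fun x hx => by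
      rw [interp_of_notMem u hx, abs_zero]
  have hld : ∀ x : Plane, lineDeriv ℝ (fun x : Plane => x 0) x e = 1 := by
    intro x
    refine HasLineDerivAt.lineDeriv ?_
    have : (fun t : ℝ => (x + t • e) 0) = fun t : ℝ => x 0 + t := by
      ext t; simp [he]
    rw [HasLineDerivAt, this]
    exact (hasDerivAt_id 0).const_add _
  have hm : ∀ k, MeasurableSet (openTriangle (corner Δ Q k)) :=
    fun k => (isOpen_openTriangle _).measurableSet
  have hsubm : ∀ k, openTriangle (corner Δ Q k) ⊆ meshDomain Δ Q := fun k x hx =>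
    mem_meshDomain.2 ⟨k, openTriangle_subset (p := corner Δ Q k) (hA k).ne' hx⟩
  have hint : ∀ k, Integrable ((openTriangle (corner Δ Q k)).indicator
      fun _ => R * ‖p1Grad Δ Q u k‖) := fun k =>
    (integrable_indicator_iff (hm k)).2 (integrableOn_const
      (volume_openTriangle_lt_top (p := corner Δ Q k) (hA k).ne').ne)
  -- Integration by parts: the first coordinate has derivative `1` along `e`. Moving the derivative
  -- onto `|interp Δ Q u|` leaves the first coordinate as a factor, which is bounded by `R` on the
  -- mesh.
  have key := hf.integral_lineDeriv_mul_eq (μ := volume) hg hgc e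
  simp only [hld, one_mul] at key
  rw [key]
  have hdiff : ∀ᵐ x, x ∉ meshDomain Δ Q ∨ ∃ k, x ∈ openTriangle (corner Δ Q k) := by
    filter_upwards [(meshDomain_ae_eq (Q := Q) hA).mem_iff] with x hx
    rw [or_iff_not_imp_left, not_not, hx, mem_iUnion]
    exact id
  have hbound : ‖∫ x, lineDeriv ℝ (fun x => |interp Δ Q u x|) x (-e) * x 0‖ ≤
      ∫ x, ∑ k, (openTriangle (corner Δ Q k)).indicator (fun _ => R * ‖p1Grad Δ Q u k‖) x := by
    refine norm_integral_le_of_norm_le (integrable_finsetSum _ fun k _ => hint k) ?_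
    filter_upwards [hdiff] with x hx
    rcases hx with hx | ⟨k, hk⟩
    · have hloc : (fun x => |interp Δ Q u x|) =ᶠ[𝓝 x] fun _ => 0 := by
        filter_upwards [(isCompact_meshDomain (Δ := Δ) (Q := Q)).isClosed.isOpen_compl.mem_nhds hx]
          with y hy
        rw [interp_of_notMem u hy, abs_zero]
      have hnot : ∀ k, x ∉ openTriangle (corner Δ Q k) := fun k hk => hx (hsubm k hk)
      rw [hloc.lineDeriv_eq]
      simp [lineDeriv, hnot]
    · have hR0 : 0 ≤ R := (abs_nonneg _).trans (hR x (hsubm k hk))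
      have hterm : (openTriangle (corner Δ Q k)).indicator (fun _ => R * ‖p1Grad Δ Q u k‖) x ≤
          ∑ k, (openTriangle (corner Δ Q k)).indicator (fun _ => R * ‖p1Grad Δ Q u k‖) x :=
        Finset.single_le_sum (f := fun k => (openTriangle (corner Δ Q k)).indicator
          (fun _ => R * ‖p1Grad Δ Q u k‖) x)
          (fun k _ => indicator_nonneg (fun _ _ => by positivity) _) (Finset.mem_univ k)
      refine le_trans ?_ hterm
      rw [indicator_of_mem hk, norm_mul, mul_comm]
      refine mul_le_mul (hR x (hsubm k hk)) ?_ (norm_nonneg _) hR0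
      have hlip : LipschitzOnWith ‖p1Grad Δ Q u k‖₊ (fun x => |interp Δ Q u x|)
          (openTriangle (corner Δ Q k)) := by
        refine LipschitzOnWith.of_dist_le_mul fun y hy z hz => ?_
        rw [interp_eq hW u (openTriangle_subset (p := corner Δ Q k) (hA k).ne' hy),
          interp_eq hW u (openTriangle_subset (p := corner Δ Q k) (hA k).ne' hz), Real.dist_eq]
        refine (abs_abs_sub_abs_le _ _).trans ?_
        have := (lipschitzOnWith_localP1 (Δ := Δ) (Q := Q) u k univ).dist_le_mul y trivial z trivial
        rwa [Real.dist_eq] at this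
      have := norm_lineDeriv_le_of_lipschitzOn ℝ (v := -e)
        ((isOpen_openTriangle _).mem_nhds hk) hlip
      simpa [he] using this
  refine (Real.le_norm_self _).trans (hbound.trans ?_)
  rw [integral_finsetSum _ fun k _ => hint k]
  refine Finset.sum_le_sum fun k _ => ?_
  rw [integral_indicator (hm k), setIntegral_const, smul_eq_mul]

theorem sum_volume_openTriangle (hA : ∀ k, 0 < triArea Δ Q k) (hW : WeightsAgree Δ Q) :
    ∑ k, volume.real (openTriangle (corner Δ Q k)) = volume.real (meshDomain Δ Q) := by
  have := integral_meshDomain hA hW (f := fun _ => 1) fun k => integrableOn_const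
    (volume_openTriangle_lt_top (p := corner Δ Q k) (hA k).ne').ne
  simpa using this.symm

/-- Energy and mean of a discrete state are bounded in terms of the right-hand side and the
hold-all. -/
theorem energy_bound (hA : ∀ k, 0 < triArea Δ Q k) (hW : WeightsAgree Δ Q) {B : Set Plane}
    (hB : volume B ≠ ⊤) (hQB : meshDomain Δ Q ⊆ B) {R M : ℝ} (hR0 : 0 ≤ R) (hM0 : 0 ≤ M)
    (hR : ∀ x ∈ B, |x 0| ≤ R) {r : Plane → ℝ} (hr : IntegrableOn r B)
    (hM : ∀ᵐ x ∂volume.restrict B, |r x| ≤ M) {u : Fin NV → ℝ}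
    (hu : ∀ i ∈ Δ.boundaryVertices, u i = 0) (hS : stiffness Δ Q u u = load Δ r Q u) :
    stiffness Δ Q u u ≤ M ^ 2 * R ^ 2 * volume.real B ∧
      |load Δ (fun _ => 1) Q u| ≤ M * R ^ 2 * volume.real B := by
  set V := volume.real B with hV
  set G := ∑ k, volume.real (openTriangle (corner Δ Q k)) * ‖p1Grad Δ Q u k‖ with hG
  have hY := isP1Zero_interp hA hW hu
  have huQ : interp Δ Q u ∘ Q = u := funext fun i => interp_vertex hA hW u i
  have hV0 : 0 ≤ V := measureReal_nonneg
  have hG0 : 0 ≤ G := Finset.sum_nonneg fun k _ => mul_nonneg measureReal_nonneg (norm_nonneg _)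
  have hYint : IntegrableOn (interp Δ Q u) (meshDomain Δ Q) :=
    hY.1.1.integrableOn_compact isCompact_meshDomain
  have hI : ∫ x in meshDomain Δ Q, |interp Δ Q u x| ≤ R * G := by
    have h1 := integral_abs_interp_le hA hW hu fun x hx => hR x (hQB hx)
    rw [setIntegral_eq_integral_of_forall_compl_eq_zero fun x hx => by
      rw [interp_of_notMem u hx, abs_zero]]
    refine h1.trans (le_of_eq ?_)
    rw [hG, Finset.mul_sum]
    exact Finset.sum_congr rfl fun k _ => by ring
  -- `G` is the `L¹` norm of the gradient; this is Cauchy–Schwarz with the triangle areas as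
  -- weights.
  have hCS : G ^ 2 ≤ V * stiffness Δ Q u u := by
    have h1 := Finset.sum_mul_sq_le_sq_mul_sq Finset.univ
      (fun k => √(volume.real (openTriangle (corner Δ Q k))))
      (fun k => √(volume.real (openTriangle (corner Δ Q k))) * ‖p1Grad Δ Q u k‖)
    have e1 : ∀ k, √(volume.real (openTriangle (corner Δ Q k))) *
        (√(volume.real (openTriangle (corner Δ Q k))) * ‖p1Grad Δ Q u k‖) =
        volume.real (openTriangle (corner Δ Q k)) * ‖p1Grad Δ Q u k‖ := fun k => by
      rw [← mul_assoc, Real.mul_self_sqrt measureReal_nonneg]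
    have e2 : ∀ k, (√(volume.real (openTriangle (corner Δ Q k))) * ‖p1Grad Δ Q u k‖) ^ 2 =
        volume.real (openTriangle (corner Δ Q k)) *
          inner ℝ (p1Grad Δ Q u k) (p1Grad Δ Q u k) := fun k => by
      rw [mul_pow, Real.sq_sqrt measureReal_nonneg, real_inner_self_eq_norm_sq]
    simp only [e1, e2, Real.sq_sqrt measureReal_nonneg, sum_volume_openTriangle hA hW] at h1
    refine h1.trans (mul_le_mul_of_nonneg_right (measureReal_mono hQB hB) ?_)
    exact Finset.sum_nonneg fun k _ => mul_nonneg measureReal_nonneg real_inner_self_nonneg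
  have hSle : stiffness Δ Q u u ≤ M * (R * G) := by
    have h1 := integral_mul_eq_load hA hW (hr.mono_set hQB) hY.1
    rw [huQ, ← hS] at h1
    rw [← h1]
    refine le_trans ?_ (mul_le_mul_of_nonneg_left hI hM0)
    rw [← integral_const_mul]
    refine integral_mono_ae ((hr.mono_set hQB).mul_continuousOn hY.1.1 isCompact_meshDomain)
      (hYint.abs.const_mul M) ?_
    filter_upwards [ae_restrict_of_ae_restrict_of_subset hQB hM] with x hx
    refine (le_abs_self _).trans ?_
    rw [abs_mul]
    exact mul_le_mul_of_nonneg_right hx (abs_nonneg _)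
  -- The two previous bounds combine to a quadratic inequality for `G`, in which one factor `G`
  -- cancels.
  have hGle : G ≤ V * (M * R) := by
    rcases hG0.eq_or_lt with h | h
    · rw [← h]; positivity
    · have : G * G ≤ V * (M * R) * G := by
        calc G * G = G ^ 2 := by ring
          _ ≤ V * stiffness Δ Q u u := hCS
          _ ≤ V * (M * (R * G)) := mul_le_mul_of_nonneg_left hSle hV0
          _ = V * (M * R) * G := by ring
      exact le_of_mul_le_mul_right this h
  constructor
  · calc stiffness Δ Q u u ≤ M * (R * G) := hSle
      _ ≤ M * (R * (V * (M * R))) := by gcongr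
      _ = M ^ 2 * R ^ 2 * V := by ring
  · have h1 := integral_eq_load_one hA hW hY.1
    rw [huQ] at h1
    rw [← h1]
    calc |∫ x in meshDomain Δ Q, interp Δ Q u x| ≤ ∫ x in meshDomain Δ Q, |interp Δ Q u x| :=
          abs_integral_le_integral_abs
      _ ≤ R * G := hI
      _ ≤ R * (V * (M * R)) := by gcongr
      _ = M * R ^ 2 * V := by ring

end Poincare

/-! ### Convergence of the discrete problems and their solvability. -/

section Limits

variable {NV NT : ℕ} {Δ : OrientedConnectivityComplex NV NT} {Q : Fin NV → Plane}

theorem abs_localP1_le {k : Fin NT} (hk : 0 < triArea Δ Q k) (u : Fin NV → ℝ) {x : Plane}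
    (hx : x ∈ meshTriangle Δ Q k) : |localP1 Δ Q u k x| ≤ ∑ i, |u i| := by
  have hx' := (mem_meshTriangle_iff hk).1 hx
  rw [localP1_eq_sum_nodalWeight]
  refine (Finset.abs_sum_le_sum_abs _ _).trans (Finset.sum_le_sum fun i _ => ?_)
  rw [abs_mul, abs_of_nonneg (nodalWeight_nonneg hk hx i)]
  refine mul_le_of_le_one_right (abs_nonneg _) ?_
  rw [← sum_nodalWeight hk x]
  exact Finset.single_le_sum (fun m _ => nodalWeight_nonneg hk hx m) (Finset.mem_univ i)

theorem meshTriangle_subset {B : Set Plane} (hB : Convex ℝ B) (hQ : ∀ i, Q i ∈ B) (k : Fin NT) :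
    meshTriangle Δ Q k ⊆ B :=
  convexHull_min (range_subset_iff.2 fun _ => hQ _) hB

theorem meshDomain_subset {B : Set Plane} (hB : Convex ℝ B) (hQ : ∀ i, Q i ∈ B) :
    meshDomain Δ Q ⊆ B := iUnion_subset fun k => meshTriangle_subset hB hQ k

variable {P : ℕ → Fin NV → Plane} {U V : ℕ → Fin NV → ℝ} {u v : Fin NV → ℝ}

theorem tendsto_localP1 (h : Tendsto P atTop (𝓝 Q)) (hU : Tendsto U atTop (𝓝 u)) {k : Fin NT}
    (hk : 0 < triArea Δ Q k) (x : Plane) :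
    Tendsto (fun n => localP1 Δ (P n) (U n) k x) atTop (𝓝 (localP1 Δ Q u k x)) :=
  tendsto_finsetSum _ fun l _ => (tendsto_pi_nhds.1 hU _).mul
    (tendsto_bary (tendsto_corner h k) hk.ne' l tendsto_const_nhds)

theorem tendsto_p1Grad (h : Tendsto P atTop (𝓝 Q)) (hU : Tendsto U atTop (𝓝 u)) {k : Fin NT}
    (hk : 0 < triArea Δ Q k) :
    Tendsto (fun n => p1Grad Δ (P n) (U n) k) atTop (𝓝 (p1Grad Δ Q u k)) :=
  tendsto_finsetSum _ fun l _ => (tendsto_pi_nhds.1 hU _).smul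
    (tendsto_baryGrad (tendsto_corner h k) hk.ne' l)

/-- Dominated convergence for integrands extended by zero: off the three lines bounding the limit
triangle, membership in the moving triangle is eventually constant, and barycentric weights in `[0,
1]` bound the integrand by a multiple of `|r|` on `B`. -/
theorem tendsto_integral_mul_localP1 (h : Tendsto P atTop (𝓝 Q)) (hU : Tendsto U atTop (𝓝 u))
    (hA : ∀ n k, 0 < triArea Δ (P n) k) {k : Fin NT} (hk : 0 < triArea Δ Q k) {B : Set Plane}
    (hB : Convex ℝ B) (hBm : MeasurableSet B) (hPB : ∀ n i, P n i ∈ B) {r : Plane → ℝ}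
    (hr : IntegrableOn r B) :
    Tendsto (fun n => ∫ x in openTriangle (corner Δ (P n) k), r x * localP1 Δ (P n) (U n) k x) atTop
      (𝓝 (∫ x in openTriangle (corner Δ Q k), r x * localP1 Δ Q u k x)) := by
  have hm : ∀ Q : Fin NV → Plane, MeasurableSet (openTriangle (corner Δ Q k)) :=
    fun Q => (isOpen_openTriangle _).measurableSet
  have hsub : ∀ n, openTriangle (corner Δ (P n) k) ⊆ meshTriangle Δ (P n) k := fun n =>
    openTriangle_subset (p := corner Δ (P n) k) (hA n k).ne'
  simp only [← integral_indicator (hm _)]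
  set C := ∑ i, |u i| + 1 with hC
  have hUC : ∀ᶠ n in atTop, ∑ i, |U n i| ≤ C := by
    have : Tendsto (fun n => ∑ i, |U n i|) atTop (𝓝 (∑ i, |u i|)) :=
      tendsto_finsetSum _ fun i _ => (tendsto_pi_nhds.1 hU i).abs
    exact (this.eventually_lt_const (lt_add_one _)).mono fun n hn => hn.le
  refine tendsto_integral_filter_of_dominated_convergence (B.indicator fun x => C * |r x|) ?_ ?_ ?_ ?_
  · refine Eventually.of_forall fun n => ?_
    rw [aestronglyMeasurable_indicator_iff (hm _)]
    exact (hr.mono_set ((hsub n).trans (meshTriangle_subset hB (hPB n) k))).aestronglyMeasurable.mul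
      (continuous_localP1 _ _).aestronglyMeasurable
  · filter_upwards [hUC] with n hn
    refine Eventually.of_forall fun x => ?_
    by_cases hx : x ∈ openTriangle (corner Δ (P n) k)
    · rw [indicator_of_mem hx, indicator_of_mem (meshTriangle_subset hB (hPB n) k (hsub n hx)),
        norm_mul, Real.norm_eq_abs, Real.norm_eq_abs, mul_comm]
      exact mul_le_mul_of_nonneg_right ((abs_localP1_le (hA n k) _ (hsub n hx)).trans hn)
        (abs_nonneg _)
    · rw [indicator_of_notMem hx, norm_zero]
      exact indicator_nonneg (fun x _ => mul_nonneg (by positivity) (abs_nonneg _)) x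
  · exact (integrable_indicator_iff hBm).2 (hr.abs.const_mul C)
  · have hae : ∀ᵐ x : Plane, ∀ l, bary (corner Δ Q k) l x ≠ 0 := by
      rw [ae_all_iff]
      intro l
      simpa [ae_iff] using volume_bary_eq_zero (p := corner Δ Q k) hk.ne' l
    filter_upwards [hae] with x hx
    by_cases hin : x ∈ openTriangle (corner Δ Q k)
    · rw [indicator_of_mem hin]
      refine (tendsto_const_nhds.mul (tendsto_localP1 h hU hk x)).congr' ?_
      filter_upwards [eventually_mem_openTriangle h hk hin] with n hn
      rw [indicator_of_mem hn]
    · rw [indicator_of_notMem hin]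
      refine tendsto_const_nhds.congr' ?_
      simp only [openTriangle, mem_ofPred_eq, not_forall, not_lt] at hin
      obtain ⟨l, hl⟩ := hin
      have := (tendsto_bary (tendsto_corner h k) (p := corner Δ Q k) hk.ne' l
        (tendsto_const_nhds (x := x))).eventually_lt_const (lt_of_le_of_ne hl (hx l))
      filter_upwards [this] with n hn
      rw [indicator_of_notMem fun hmem => (hmem l).not_gt hn]

theorem tendsto_load (h : Tendsto P atTop (𝓝 Q)) (hU : Tendsto U atTop (𝓝 u))
    (hA : ∀ n k, 0 < triArea Δ (P n) k) (hk : ∀ k, 0 < triArea Δ Q k) {B : Set Plane}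
    (hB : Convex ℝ B) (hBm : MeasurableSet B) (hPB : ∀ n i, P n i ∈ B) {r : Plane → ℝ}
    (hr : IntegrableOn r B) :
    Tendsto (fun n => load Δ r (P n) (U n)) atTop (𝓝 (load Δ r Q u)) :=
  tendsto_finsetSum _ fun k _ => tendsto_integral_mul_localP1 h hU hA (hk k) hB hBm hPB hr

theorem localP1_one {k : Fin NT} (hk : 0 < triArea Δ Q k) (x : Plane) :
    localP1 Δ Q (fun _ => 1) k x = 1 := by
  simpa [localP1] using bary_sum (p := corner Δ Q k) hk.ne' x

/-- The preceding convergence with `r = 1` and all nodal values equal to `1`. -/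
theorem tendsto_volume_openTriangle (h : Tendsto P atTop (𝓝 Q))
    (hA : ∀ n k, 0 < triArea Δ (P n) k) (hk : ∀ k, 0 < triArea Δ Q k) {B : Set Plane}
    (hB : Convex ℝ B) (hBm : MeasurableSet B) (hBf : volume B ≠ ⊤) (hPB : ∀ n i, P n i ∈ B)
    (k : Fin NT) : Tendsto (fun n => volume.real (openTriangle (corner Δ (P n) k))) atTop
      (𝓝 (volume.real (openTriangle (corner Δ Q k)))) := by
  have := tendsto_integral_mul_localP1 h (tendsto_const_nhds (x := fun _ : Fin NV => (1 : ℝ))) hA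
    (hk k) hB hBm hPB (r := fun _ => 1) (integrableOn_const hBf)
  simpa [localP1_one (hA _ k), localP1_one (hk k)] using this

theorem tendsto_stiffness (h : Tendsto P atTop (𝓝 Q)) (hU : Tendsto U atTop (𝓝 u))
    (hV : Tendsto V atTop (𝓝 v))
    (hA : ∀ n k, 0 < triArea Δ (P n) k) (hk : ∀ k, 0 < triArea Δ Q k) {B : Set Plane}
    (hB : Convex ℝ B) (hBm : MeasurableSet B) (hBf : volume B ≠ ⊤) (hPB : ∀ n i, P n i ∈ B) :
    Tendsto (fun n => stiffness Δ (P n) (U n) (V n)) atTop (𝓝 (stiffness Δ Q u v)) :=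
  tendsto_finsetSum _ fun k _ => (tendsto_volume_openTriangle h hA hk hB hBm hBf hPB k).mul
    ((tendsto_p1Grad h hU (hk k)).inner (tendsto_p1Grad h hV (hk k)))

theorem volume_openTriangle_pos {k : Fin NT} (hk : 0 < triArea Δ Q k) :
    0 < volume.real (openTriangle (corner Δ Q k)) := by
  have hne : (openTriangle (corner Δ Q k)).Nonempty := by
    rw [← closure_nonempty_iff]
    exact ⟨_, subset_closure_openTriangle (p := corner Δ Q k) hk.ne' (vertex_mem_meshTriangle k 0)⟩
  exact ENNReal.toReal_pos ((isOpen_openTriangle _).measure_pos volume hne).ne'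
    (volume_openTriangle_lt_top (p := corner Δ Q k) hk.ne').ne

theorem nodal_sub_nodal {k : Fin NT} (hk : 0 < triArea Δ Q k) (u : Fin NV → ℝ) (l m : Fin 3) :
    u (Δ.tri k l) - u (Δ.tri k m) =
      inner ℝ (p1Grad Δ Q u k) (Q (Δ.tri k l) - Q (Δ.tri k m)) := by
  have := localP1_eq (Δ := Δ) (Q := Q) u k (Q (Δ.tri k l)) (Q (Δ.tri k m))
  simp only [localP1, bary_corner hk] at this
  simp at this
  rw [this]; simp

theorem stiffness_self_term_le (u : Fin NV → ℝ) (k : Fin NT) :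
    volume.real (openTriangle (corner Δ Q k)) * ‖p1Grad Δ Q u k‖ ^ 2 ≤ stiffness Δ Q u u := by
  rw [← real_inner_self_eq_norm_sq]
  exact Finset.single_le_sum
    (f := fun k => volume.real (openTriangle (corner Δ Q k)) *
      inner ℝ (p1Grad Δ Q u k) (p1Grad Δ Q u k))
    (fun k _ => mul_nonneg measureReal_nonneg real_inner_self_nonneg) (Finset.mem_univ k)

/-- Bounded energy implies bounded nodal values along a convergent sequence of meshes. -/
theorem exists_bound_of_energy (h : Tendsto P atTop (𝓝 Q)) (hA : ∀ n k, 0 < triArea Δ (P n) k)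
    (hk : ∀ k, 0 < triArea Δ Q k) {B : Set Plane} (hB : Convex ℝ B) (hBm : MeasurableSet B)
    (hBf : volume B ≠ ⊤) (hPB : ∀ n i, P n i ∈ B)
    (hU : ∀ n, ∀ i ∈ Δ.boundaryVertices, U n i = 0) {S : ℝ}
    (hS : ∀ n, stiffness Δ (P n) (U n) (U n) ≤ S) : ∃ C, ∀ᶠ n in atTop, ∀ i, |U n i| ≤ C := by
  -- Eventually the area of triangle `k` is at least half its limit, so the energy bounds the
  -- gradient there, and hence nodal differences within the triangle.
  have hdiff : ∀ k, ∃ D, ∀ᶠ n in atTop, ∀ l m, |U n (Δ.tri k l) - U n (Δ.tri k m)| ≤ D := by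
    intro k
    set a := volume.real (openTriangle (corner Δ Q k)) / 2 with ha
    have hapos : 0 < a := half_pos (volume_openTriangle_pos (hk k))
    have hev := (tendsto_volume_openTriangle h hA hk hB hBm hBf hPB k).eventually_const_le
      (half_lt_self (volume_openTriangle_pos (hk k)))
    have hnorm : ∀ᶠ n in atTop, ‖P n‖ ≤ ‖Q‖ + 1 :=
      (h.norm.eventually_lt_const (lt_add_one _)).mono fun n hn => hn.le
    refine ⟨√(S / a) * (2 * (‖Q‖ + 1)), ?_⟩
    filter_upwards [hev, hnorm] with n hn hn' l m
    rw [nodal_sub_nodal (hA n k)]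
    refine (abs_real_inner_le_norm _ _).trans ?_
    gcongr
    · refine Real.le_sqrt_of_sq_le ?_
      rw [le_div_iff₀ hapos, mul_comm]
      exact (mul_le_mul_of_nonneg_right hn (sq_nonneg _)).trans
        ((stiffness_self_term_le (U n) k).trans (hS n))
    · refine (norm_sub_le _ _).trans ?_
      have h1 := (norm_le_pi_norm (P n) (Δ.tri k l)).trans hn'
      have h2 := (norm_le_pi_norm (P n) (Δ.tri k m)).trans hn'
      linarith
  obtain ⟨i₀, hi₀⟩ := boundaryVertices_nonempty hk
  obtain ⟨k₀, hk₀⟩ := Δ.exists_mem_verts i₀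
  have hstep : ∀ k m, (∃ C, ∀ᶠ n in atTop, |U n (Δ.tri k m)| ≤ C) →
      ∃ C, ∀ᶠ n in atTop, ∀ l, |U n (Δ.tri k l)| ≤ C := by
    rintro k m ⟨C, hC⟩
    obtain ⟨D, hD⟩ := hdiff k
    refine ⟨D + C, ?_⟩
    filter_upwards [hC, hD] with n h1 h2 l
    have := abs_add_le (U n (Δ.tri k l) - U n (Δ.tri k m)) (U n (Δ.tri k m))
    rw [sub_add_cancel] at this
    linarith [h2 l m]
  -- The bound starts at a boundary vertex, where the nodal value is zero, and spreads through
  -- shared vertices of adjacent triangles.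
  have hall : ∀ k, ∃ C, ∀ᶠ n in atTop, ∀ l, |U n (Δ.tri k l)| ≤ C := by
    refine Δ.tri_induction (fun k => ∃ C, ∀ᶠ n in atTop, ∀ l, |U n (Δ.tri k l)| ≤ C)
      (fun k k' l hP h1 _ => ?_) (k₀ := k₀) ?_
    · obtain ⟨C, hC⟩ := hP
      obtain ⟨m, hm⟩ := Δ.mem_verts.1 h1
      refine hstep k' (l + 1) ⟨C, hC.mono fun n hn => ?_⟩
      rw [← hm]; exact hn m
    · obtain ⟨m, hm⟩ := Δ.mem_verts.1 hk₀
      exact hstep k₀ m ⟨0, Eventually.of_forall fun n => by rw [hm, hU n i₀ hi₀, abs_zero]⟩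
  choose C hC using hall
  refine ⟨∑ k, |C k|, ?_⟩
  filter_upwards [eventually_all.2 hC] with n hn i
  obtain ⟨k, hik⟩ := Δ.exists_mem_verts i
  obtain ⟨l, rfl⟩ := Δ.mem_verts.1 hik
  exact (hn k l).trans ((le_abs_self _).trans
    (Finset.single_le_sum (f := fun k => |C k|) (fun _ _ => abs_nonneg _) (Finset.mem_univ k)))

theorem p1Grad_add (u v : Fin NV → ℝ) (k : Fin NT) :
    p1Grad Δ Q (u + v) k = p1Grad Δ Q u k + p1Grad Δ Q v k := by
  simp [p1Grad, add_smul, Finset.sum_add_distrib]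

theorem p1Grad_smul (c : ℝ) (u : Fin NV → ℝ) (k : Fin NT) :
    p1Grad Δ Q (c • u) k = c • p1Grad Δ Q u k := by
  simp [p1Grad, Finset.smul_sum, mul_smul]

/-- The stiffness form as a bilinear map. -/
noncomputable def stiffnessForm (Δ : OrientedConnectivityComplex NV NT) (Q : Fin NV → Plane) :
    (Fin NV → ℝ) →ₗ[ℝ] (Fin NV → ℝ) →ₗ[ℝ] ℝ :=
  LinearMap.mk₂ ℝ (stiffness Δ Q)
    (fun u u' v => by
      simp only [stiffness, p1Grad_add, inner_add_left, mul_add, Finset.sum_add_distrib])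
    (fun c u v => by
      simp only [stiffness, p1Grad_smul, inner_smul_left, smul_eq_mul, Finset.mul_sum]
      exact Finset.sum_congr rfl fun k _ => by simp; ring)
    (fun u v v' => by
      simp only [stiffness, p1Grad_add, inner_add_right, mul_add, Finset.sum_add_distrib])
    (fun c u v => by
      simp only [stiffness, p1Grad_smul, inner_smul_right, smul_eq_mul, Finset.mul_sum]
      exact Finset.sum_congr rfl fun k _ => by ring)

/-- All multiples `n • u` have zero energy. Applied to the constant sequence of meshes,
`exists_bound_of_energy` bounds them, which forces `u = 0`. -/
theorem eq_zero_of_stiffness_eq_zero (hA : ∀ k, 0 < triArea Δ Q k)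
    (hu : ∀ i ∈ Δ.boundaryVertices, u i = 0) (h : stiffness Δ Q u u = 0) : u = 0 := by
  have hc := (finite_range Q).isCompact_convexHull ℝ
  obtain ⟨C, hC⟩ := exists_bound_of_energy (Δ := Δ) (P := fun _ => Q) (U := fun n => (n : ℝ) • u)
    tendsto_const_nhds (fun _ => hA) hA (convex_convexHull ℝ (range Q)) hc.measurableSet
    hc.measure_lt_top.ne (fun _ i => subset_convexHull ℝ _ ⟨i, rfl⟩)
    (fun n i hi => by simp [hu i hi]) (S := 0) (fun n => by
      have : stiffness Δ Q ((n : ℝ) • u) ((n : ℝ) • u) = n * (n * stiffness Δ Q u u) := by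
        change stiffnessForm Δ Q ((n : ℝ) • u) ((n : ℝ) • u) = n * (n * stiffnessForm Δ Q u u)
        simp
      rw [this, h]; simp)
  ext i
  by_contra hne
  have hpos : 0 < |u i| := abs_pos.2 hne
  obtain ⟨n, hn, hn'⟩ := (hC.and ((tendsto_natCast_atTop_atTop (R := ℝ)).eventually_gt_atTop
    (C / |u i|))).exists
  have := hn i
  rw [div_lt_iff₀ hpos] at hn'
  simp [abs_mul] at this
  linarith

theorem integrableOn_mul_localP1 (hA : ∀ k, 0 < triArea Δ Q k) {r : Plane → ℝ}
    (hr : IntegrableOn r (meshDomain Δ Q)) (u : Fin NV → ℝ) (k : Fin NT) :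
    IntegrableOn (fun x => r x * localP1 Δ Q u k x) (openTriangle (corner Δ Q k)) :=
  (hr.mul_continuousOn (continuous_localP1 u k).continuousOn isCompact_meshDomain).mono_set
    fun _ hx => mem_meshDomain.2 ⟨k, openTriangle_subset (p := corner Δ Q k) (hA k).ne' hx⟩

/-- The discrete problem is solvable. -/
theorem exists_nodal_solution (hA : ∀ k, 0 < triArea Δ Q k) {r : Plane → ℝ}
    (hr : IntegrableOn r (meshDomain Δ Q)) :
    ∃ u : Fin NV → ℝ, (∀ i ∈ Δ.boundaryVertices, u i = 0) ∧
      ∀ v : Fin NV → ℝ, (∀ i ∈ Δ.boundaryVertices, v i = 0) →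
        stiffness Δ Q u v = load Δ r Q v := by
  let W : Submodule ℝ (Fin NV → ℝ) :=
    { carrier := {u | ∀ i ∈ Δ.boundaryVertices, u i = 0}
      add_mem' := fun {a b} ha hb i hi => by simp [ha i hi, hb i hi]
      zero_mem' := fun i _ => rfl
      smul_mem' := fun c a ha i hi => by simp [ha i hi] }
  let T : W →ₗ[ℝ] Module.Dual ℝ W := (stiffnessForm Δ Q).domRestrict₁₂ W W
  let F : Module.Dual ℝ W :=
    { toFun := fun v => load Δ r Q v
      map_add' := fun v v' => by
        simp only [load, ← Finset.sum_add_distrib]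
        refine Finset.sum_congr rfl fun k _ => ?_
        rw [← integral_add (integrableOn_mul_localP1 hA hr _ k)
          (integrableOn_mul_localP1 hA hr _ k)]
        refine integral_congr_ae (Eventually.of_forall fun x => ?_)
        simp [localP1, add_mul, Finset.sum_add_distrib, mul_add]
      map_smul' := fun c v => by
        simp only [load, RingHom.id_apply, smul_eq_mul, Finset.mul_sum]
        refine Finset.sum_congr rfl fun k _ => ?_
        rw [← integral_const_mul]
        refine integral_congr_ae (Eventually.of_forall fun x => ?_)
        simp only [localP1, Finset.mul_sum]
        exact Finset.sum_congr rfl fun l _ => by simp; ring }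
  -- Definiteness gives injectivity; surjectivity onto the dual follows by equality of dimensions.
  have hinj : Function.Injective T := by
    rw [← LinearMap.ker_eq_bot, LinearMap.ker_eq_bot']
    intro u hu
    exact Subtype.ext (eq_zero_of_stiffness_eq_zero hA u.2 (LinearMap.congr_fun hu u))
  obtain ⟨u, hu⟩ := (LinearMap.injective_iff_surjective_of_finrank_eq_finrank
    (Subspace.dual_finrank_eq (K := ℝ) (V := W)).symm).1 hinj F
  exact ⟨u, u.2, fun v hv => LinearMap.congr_fun hu ⟨v, hv⟩⟩

end Limits

/-! ### The regularized distance. -/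

section RegularizedDistance

variable {N : ℝ × ℝ → ℝ}

theorem regDist_nonneg (hN : IsRegularizedOneNorm N) (p a b : Plane) : 0 ≤ regDist N p a b := by
  refine Real.sInf_nonneg ?_
  rintro _ ⟨q, -, rfl⟩
  exact hN.nonneg _

theorem norm_unit_le (w : Plane) : ‖(1 / ‖w‖) • w‖ ≤ 1 := by
  rw [norm_smul, norm_div, norm_one, norm_norm, one_div]
  exact inv_mul_le_one

theorem norm_rotate (w : Plane) : ‖(!₂[-w 1, w 0] : Plane)‖ = ‖w‖ := by
  simp [EuclideanSpace.norm_eq, Fin.sum_univ_two, add_comm]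

/-- Each of the two coordinates is at most `‖p - q‖`, since the frame vectors have norm at most one.
This includes `a = b`, where they are zero. -/
theorem regDist_le (hN : IsRegularizedOneNorm N) {p a b q : Plane} (hq : q ∈ segment ℝ a b) :
    regDist N p a b ≤ 2 * ‖p - q‖ := by
  refine (csInf_le ⟨0, ?_⟩ (mem_image_of_mem _ hq)).trans ((hN.le_oneNorm _).trans ?_)
  · rintro _ ⟨q, -, rfl⟩
    exact hN.nonneg _
  · have h1 := (abs_real_inner_le_norm ((1 / ‖b - a‖) • (b - a)) (p - q)).trans
      (mul_le_mul_of_nonneg_right (norm_unit_le (b - a)) (norm_nonneg _))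
    have h2 := abs_real_inner_le_norm ((1 / ‖b - a‖) • (!₂[-(b - a) 1, (b - a) 0] : Plane)) (p - q)
    have h3 := norm_unit_le (!₂[-(b - a) 1, (b - a) 0] : Plane)
    rw [norm_rotate] at h3
    have h4 := h2.trans (mul_le_mul_of_nonneg_right h3 (norm_nonneg _))
    simp only [alignedCoords]
    linarith

theorem eq_zero_of_alignedCoords {a b v : Plane} (hab : a ≠ b) (h : alignedCoords a b v = 0) :
    v = 0 := by
  have hn : ‖b - a‖ ≠ 0 := norm_ne_zero_iff.2 (sub_ne_zero.2 hab.symm)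
  have h1 := congrArg Prod.fst h
  have h2 := congrArg Prod.snd h
  simp only [alignedCoords, inner_smul_left, PiLp.inner_apply, Fin.sum_univ_two] at h1 h2
  simp [hn] at h1 h2
  set c := b 0 - a 0 with hc
  set d := b 1 - a 1 with hd
  have hcd : c ^ 2 + d ^ 2 ≠ 0 := by
    intro h0
    have hc0 : c = 0 := by nlinarith
    have hd0 : d = 0 := by nlinarith
    exact hab (plane_ext (by linarith) (by linarith))
  have e0 : (c ^ 2 + d ^ 2) * v 0 = 0 := by linear_combination c * h1 - d * h2
  have e1 : (c ^ 2 + d ^ 2) * v 1 = 0 := by linear_combination d * h1 + c * h2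
  refine plane_ext ?_ ?_
  · simpa [hcd] using e0
  · simpa [hcd] using e1

theorem continuousOn_alignedCoords :
    ContinuousOn (fun t : Plane × Plane × Plane => alignedCoords t.1 t.2.1 t.2.2)
      {t | t.1 ≠ t.2.1} := by
  have hc : ContinuousOn (fun t : Plane × Plane × Plane => 1 / ‖t.2.1 - t.1‖) {t | t.1 ≠ t.2.1} :=
    continuousOn_const.div (by fun_prop) fun t ht => norm_ne_zero_iff.2 (sub_ne_zero.2 (Ne.symm ht))
  refine ContinuousOn.prodMk ?_ ?_
  · exact (hc.smul (Continuous.continuousOn (by fun_prop))).inner (Continuous.continuousOn (by fun_prop))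
  · exact (hc.smul (Continuous.continuousOn (by fun_prop))).inner
      (Continuous.continuousOn (by fun_prop))

/-- With the segment parametrized by `[0, 1]`, this is the infimum of a jointly continuous function
over a fixed compact set. -/
theorem continuousOn_regDist (hN : IsRegularizedOneNorm N) :
    ContinuousOn (fun t : Plane × Plane × Plane => regDist N t.1 t.2.1 t.2.2)
      {t | t.2.1 ≠ t.2.2} := by
  rw [continuousOn_iff_continuous_domRestrict]
  set s : Set (Plane × Plane × Plane) := {t | t.2.1 ≠ t.2.2}
  let g : s → ℝ → ℝ := fun t θ => N (alignedCoords t.1.2.1 t.1.2.2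
    (t.1.1 - AffineMap.lineMap t.1.2.1 t.1.2.2 θ))
  have hg : Continuous (Function.uncurry g) := by
    refine hN.contDiff.continuous.comp ?_
    refine continuousOn_alignedCoords.comp_continuous (f := fun q : s × ℝ =>
      (q.1.1.2.1, q.1.1.2.2, q.1.1.1 - AffineMap.lineMap q.1.1.2.1 q.1.1.2.2 q.2)) ?_ fun q => q.1.2
    simp only [AffineMap.lineMap_apply_module]
    fun_prop
  have := (isCompact_Icc (a := (0 : ℝ)) (b := 1)).continuous_sInf (f := g) hg
  convert this using 2 with t
  simp only [domRestrict_apply, regDist, segment_eq_image_lineMap, image_image, g]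

theorem tendsto_regDist (hN : IsRegularizedOneNorm N) {p a b : Plane} (hab : a ≠ b)
    {P A B : ℕ → Plane} (hp : Tendsto P atTop (𝓝 p)) (ha : Tendsto A atTop (𝓝 a))
    (hb : Tendsto B atTop (𝓝 b)) :
    Tendsto (fun n => regDist N (P n) (A n) (B n)) atTop (𝓝 (regDist N p a b)) := by
  have hmem : {t : Plane × Plane × Plane | t.2.1 ≠ t.2.2} ∈ 𝓝 (p, a, b) :=
    (isOpen_ne_fun (f := fun t : Plane × Plane × Plane => t.2.1)
      (g := fun t : Plane × Plane × Plane => t.2.2) continuous_snd.fst continuous_snd.snd).mem_nhds hab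
  have hc := ((continuousOn_regDist hN).continuousAt hmem).tendsto.comp
    (hp.prodMk_nhds (ha.prodMk_nhds hb))
  simpa only [Function.comp_def] using hc

theorem regDist_pos (hN : IsRegularizedOneNorm N) {p a b : Plane} (hab : a ≠ b)
    (hp : p ∉ segment ℝ a b) : 0 < regDist N p a b := by
  have hc : ContinuousOn (fun q => N (alignedCoords a b (p - q))) (segment ℝ a b) := by
    refine (hN.contDiff.continuous.comp_continuousOn
      (continuousOn_alignedCoords.comp (f := fun q : Plane => (a, b, p - q)) ?_ fun q _ => hab))
    fun_prop
  have hcomp : IsCompact (segment ℝ a b) := by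
    rw [segment_eq_image_lineMap]
    exact isCompact_Icc.image (AffineMap.lineMap_continuous)
  obtain ⟨q, hq, hmin⟩ := hcomp.exists_sInf_image_eq ⟨a, left_mem_segment ℝ a b⟩ hc
  refine lt_of_le_of_ne (regDist_nonneg hN p a b) fun h => hp ?_
  have h0 : N (alignedCoords a b (p - q)) = 0 := hmin.symm.trans h.symm
  rwa [sub_eq_zero.1 (eq_zero_of_alignedCoords hab (hN.definite _ h0))]

end RegularizedDistance

/-! ### Continuity and coercivity of the penalty. -/

section Penalty

variable {NV NT : ℕ} {Δ : OrientedConnectivityComplex NV NT} {Q : Fin NV → Plane}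
  {N : ℝ × ℝ → ℝ} {χ : ℝ → ℝ} {α₁ α₂ α₃ α₄ : ℝ} {Qref : Fin NV → Plane}

/-- Allows both forms of the penalty to be treated at once, with `χ = id` for no cut-off. -/
theorem penalty_eq_penaltyCutOff : penalty Δ N α₁ α₂ α₃ α₄ Qref =
    penaltyCutOff Δ N id α₁ α₂ α₃ α₄ Qref := by
  ext Q
  simp only [penalty, penaltyCutOff, id]
  congr 2
  refine Finset.sum_congr rfl fun j _ => Finset.sum_congr rfl fun i _ => ?_
  ring

theorem mem_boundaryEdges_isBoundaryEdge {j : Fin NV × Fin NV} (hj : j ∈ Δ.boundaryEdges) :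
    Δ.IsBoundaryEdge {j.1, j.2} := by
  simp only [OrientedConnectivityComplex.boundaryEdges, Finset.mem_filter] at hj
  exact hj.2.1

/-- A point of the segment has weights only at `a` and `b`, whereas `Q i` has its full weight at
`i`; the weights agree. -/
theorem boundarySeparated_of_mem_plusManifold (hQ : Q ∈ plusManifold Δ) :
    BoundarySeparated Δ Q := by
  obtain ⟨hA, hW⟩ := mem_plusManifold_iff.1 hQ
  intro a b he i _ hi
  obtain ⟨k, hk⟩ := Δ.exists_subset_verts he.1
  obtain ⟨k', hk'⟩ := Δ.exists_mem_verts i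
  have ha : a ∈ Δ.verts k := hk (by simp)
  have hb : b ∈ Δ.verts k := hk (by simp)
  have hmem : ∀ {k i}, i ∈ Δ.verts k → Q i ∈ meshTriangle Δ Q k := fun h => by
    obtain ⟨l, rfl⟩ := Δ.mem_verts.1 h
    exact vertex_mem_meshTriangle _ l
  have hik : Q i ∈ meshTriangle Δ Q k :=
    (convex_convexHull ℝ _).segment_subset (hmem ha) (hmem hb) hi
  have hw := hW k k' (Q i) hik (hmem hk')
  rw [nodalWeight_vertex (hA k') hk'] at hw
  obtain ⟨s, t, hs, ht, hst, heq⟩ := hi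
  by_contra hne
  push Not at hne
  have hcomb : ∑ j, (s • Pi.single a (1 : ℝ) + t • Pi.single b (1 : ℝ) : Fin NV → ℝ) j • Q j
      = Q i := by
    simp [add_smul, Finset.sum_add_distrib, Pi.single_apply, ite_smul, ← heq]
  have h2 := nodalWeight_of_weights (hA k)
    (w := s • Pi.single a (1 : ℝ) + t • Pi.single b (1 : ℝ))
    (fun j hj => by
      have h1 : j ≠ a := fun h => hj (h ▸ ha)
      have h2 : j ≠ b := fun h => hj (h ▸ hb)
      simp [h1, h2])
    (by simp [Finset.sum_add_distrib, ← Finset.mul_sum, hst]) i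
  rw [hcomb, hw] at h2
  simp [hne.1, hne.2] at h2

theorem regDist_pos_of_mem_plusManifold (hN : IsRegularizedOneNorm N) (hQ : Q ∈ plusManifold Δ)
    {j : Fin NV × Fin NV} (hj : j ∈ Δ.boundaryEdges) {i : Fin NV} (hi : i ∈ Δ.boundaryVertices)
    (hij : i ≠ j.1 ∧ i ≠ j.2) : 0 < regDist N (Q i) (Q j.1) (Q j.2) := by
  have he := mem_boundaryEdges_isBoundaryEdge hj
  refine regDist_pos hN (fun h => ?_) fun h => ?_
  · have := hQ.1.1 h
    have hc := he.2.1
    rw [this] at hc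
    simp at hc
  · rcases boundarySeparated_of_mem_plusManifold hQ _ _ he i hi h with h | h
    exacts [hij.1 h, hij.2 h]

theorem tendsto_triArea {P : ℕ → Fin NV → Plane} (h : Tendsto P atTop (𝓝 Q)) (k : Fin NT) :
    Tendsto (fun n => triArea Δ (P n) k) atTop (𝓝 (triArea Δ Q k)) :=
  ((continuous_triArea k).tendsto Q).comp h

theorem tendsto_edgeLength {P : ℕ → Fin NV → Plane} (h : Tendsto P atTop (𝓝 Q)) (k : Fin NT)
    (l : Fin 3) : Tendsto (fun n => edgeLength Δ (P n) k l) atTop (𝓝 (edgeLength Δ Q k l)) :=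
  ((tendsto_pi_nhds.1 h _).sub (tendsto_pi_nhds.1 h _)).norm

theorem tendsto_penaltyCutOff (hN : IsRegularizedOneNorm N) (hχ : ContinuousOn χ (Ici 0))
    {P : ℕ → Fin NV → Plane} (h : Tendsto P atTop (𝓝 Q)) (hQ : Q ∈ plusManifold Δ) :
    Tendsto (fun n => penaltyCutOff Δ N χ α₁ α₂ α₃ α₄ Qref (P n)) atTop
      (𝓝 (penaltyCutOff Δ N χ α₁ α₂ α₃ α₄ Qref Q)) := by
  have hA := hQ.2
  obtain ⟨k₀⟩ := Δ.nonempty_triangles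
  have hsum : 0 < ∑ k, triArea Δ Q k :=
    Finset.sum_pos (fun k _ => hA k) ⟨k₀, Finset.mem_univ k₀⟩
  have hp : ∀ i, Tendsto (fun n => P n i) atTop (𝓝 (Q i)) := tendsto_pi_nhds.1 h
  refine ((Tendsto.add ?_ ?_).add ?_).add ?_
  · refine tendsto_finsetSum _ fun k _ => tendsto_const_nhds.mul (tendsto_const_nhds.mul ?_)
    refine Tendsto.div ?_ (tendsto_const_nhds.mul (tendsto_triArea h k)) ?_
    · exact (((tendsto_edgeLength h k 0).pow 2).add ((tendsto_edgeLength h k 1).pow 2)).add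
        ((tendsto_edgeLength h k 2).pow 2)
    · have := hA k
      positivity
  · exact tendsto_const_nhds.div (tendsto_finsetSum _ fun k _ => tendsto_triArea h k) hsum.ne'
  · refine tendsto_finsetSum _ fun j hj => tendsto_finsetSum _ fun i hi => tendsto_const_nhds.mul ?_
    rw [Finset.mem_filter] at hi
    have hpos := regDist_pos_of_mem_plusManifold hN hQ hj hi.1 hi.2
    have hne : Q j.1 ≠ Q j.2 := fun h => by
      have hc := (mem_boundaryEdges_isBoundaryEdge hj).2.1
      rw [hQ.1.1 h] at hc
      simp at hc
    have hd : Tendsto (fun n => regDist N (P n i) (P n j.1) (P n j.2)) atTop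
        (𝓝 (regDist N (Q i) (Q j.1) (Q j.2))) := tendsto_regDist hN hne (hp i) (hp j.1) (hp j.2)
    have hx : (0 : ℝ) ≤ 1 / regDist N (Q i) (Q j.1) (Q j.2) := by positivity
    -- Continuity of `χ` is available on `[0, ∞)` only, so the limit is taken within that set.
    have hχx : Tendsto χ (𝓝[Ici 0] (1 / regDist N (Q i) (Q j.1) (Q j.2)))
        (𝓝 (χ (1 / regDist N (Q i) (Q j.1) (Q j.2)))) := hχ _ hx
    have hin : Tendsto (fun n => 1 / regDist N (P n i) (P n j.1) (P n j.2)) atTop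
        (𝓝[Ici 0] (1 / regDist N (Q i) (Q j.1) (Q j.2))) := tendsto_nhdsWithin_iff.2
      ⟨tendsto_const_nhds.div hd hpos.ne', Eventually.of_forall fun n =>
        div_nonneg zero_le_one (regDist_nonneg hN _ _ _)⟩
    exact hχx.comp hin
  · exact tendsto_const_nhds.mul (tendsto_finsetSum _ fun i _ =>
      ((hp i).sub tendsto_const_nhds).norm.pow 2)

theorem exists_lower_bound_cutOff (hχ : ContinuousOn χ (Ici 0)) {s₁ : ℝ}
    (hs : ∀ s, s₁ < s → χ s = s) : ∃ c, 0 ≤ c ∧ ∀ s, 0 ≤ s → -c ≤ χ s := by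
  have hK : IsCompact (Icc 0 (max s₁ 0)) := isCompact_Icc
  obtain ⟨m, hm⟩ := (hK.image_of_continuousOn (hχ.mono fun x hx => hx.1)).bddBelow
  refine ⟨max (-m) 0, le_max_right _ _, fun s h0 => ?_⟩
  by_cases h : s ≤ max s₁ 0
  · have := hm ⟨s, ⟨h0, h⟩, rfl⟩
    linarith [le_max_left (-m) 0]
  · push Not at h
    rw [hs s ((le_max_left _ _).trans_lt h)]
    linarith [le_max_right (-m) 0]

theorem invQuality_nonneg (hA : ∀ k, 0 < triArea Δ Q k) (k : Fin NT) : 0 ≤ invQuality Δ Q k := by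
  have := hA k
  unfold invQuality
  positivity

/-- The penalty is bounded below, and each of its first three terms is bounded above where
it is bounded above. -/
theorem penaltyCutOff_bounds (hN : IsRegularizedOneNorm N) (hχ : ContinuousOn χ (Ici 0)) {s₁ : ℝ}
    (hs : ∀ s, s₁ < s → χ s = s) (hα₁ : 0 < α₁) (hα₂ : 0 < α₂) (hα₃ : 0 < α₃) (hα₄ : 0 < α₄)
    (Δ : OrientedConnectivityComplex NV NT) (Qref : Fin NV → Plane) :
    ∃ K, ∀ Q ∈ plusManifold Δ, -K ≤ penaltyCutOff Δ N χ α₁ α₂ α₃ α₄ Qref Q ∧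
      ∀ C, penaltyCutOff Δ N χ α₁ α₂ α₃ α₄ Qref Q ≤ C →
        (∀ k, invQuality Δ Q k ≤ NT * (C + K) / α₁) ∧
        α₂ ≤ (C + K) * ∑ k, triArea Δ Q k ∧
        ∀ j ∈ Δ.boundaryEdges, ∀ i ∈ Δ.boundaryVertices, i ≠ j.1 ∧ i ≠ j.2 →
          χ (1 / regDist N (Q i) (Q j.1) (Q j.2)) ≤
            (C + K) * ((Δ.boundaryEdges.card : ℝ) * (Δ.boundaryVertices.card : ℝ)) / α₃ := by
  obtain ⟨c, hc0, hc⟩ := exists_lower_bound_cutOff hχ hs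
  set β := α₃ / ((Δ.boundaryEdges.card : ℝ) * (Δ.boundaryVertices.card : ℝ)) with hβ
  have hβ0 : 0 ≤ β := by positivity
  -- A cut-off may be negative, but not below `-c`. Adding `K` to the third term makes each of its
  -- summands nonnegative, so that any single summand is controlled by the whole sum.
  set K := ∑ j ∈ Δ.boundaryEdges, ∑ i ∈ Δ.boundaryVertices with i ≠ j.1 ∧ i ≠ j.2, β * c with hK
  refine ⟨K, fun Q hQ => ?_⟩
  have hA := hQ.2
  obtain ⟨k₀⟩ := Δ.nonempty_triangles
  have hNT : (0 : ℝ) < NT := by exact_mod_cast k₀.pos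
  have hsum : 0 < ∑ k, triArea Δ Q k :=
    Finset.sum_pos (fun k _ => hA k) ⟨k₀, Finset.mem_univ k₀⟩
  have hq := invQuality_nonneg hA
  set T₁ := ∑ k, (1 / (NT : ℝ)) * (α₁ * invQuality Δ Q k) with hT₁
  set T₂ := α₂ / (∑ k, triArea Δ Q k) with hT₂
  set T₃ := ∑ j ∈ Δ.boundaryEdges, ∑ i ∈ Δ.boundaryVertices with i ≠ j.1 ∧ i ≠ j.2,
    β * χ (1 / regDist N (Q i) (Q j.1) (Q j.2)) with hT₃
  set T₄ := (α₄ / 2) * ∑ i, ‖Q i - Qref i‖ ^ 2 with hT₄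
  have hφ : penaltyCutOff Δ N χ α₁ α₂ α₃ α₄ Qref Q = T₁ + T₂ + T₃ + T₄ := rfl
  have h1term : ∀ k, 0 ≤ (1 / (NT : ℝ)) * (α₁ * invQuality Δ Q k) := fun k => by
    have := hq k; positivity
  have h1 : 0 ≤ T₁ := Finset.sum_nonneg fun k _ => h1term k
  have h2 : 0 ≤ T₂ := by positivity
  have h4 : 0 ≤ T₄ := by positivity
  have h3term : ∀ (j : Fin NV × Fin NV) (i : Fin NV),
      0 ≤ β * χ (1 / regDist N (Q i) (Q j.1) (Q j.2)) + β * c := fun j i => by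
    rw [← mul_add]
    refine mul_nonneg hβ0 ?_
    linarith [hc (1 / regDist N (Q i) (Q j.1) (Q j.2))
      (div_nonneg zero_le_one (regDist_nonneg hN _ _ _))]
  have h3sum : T₃ + K = ∑ j ∈ Δ.boundaryEdges,
      ∑ i ∈ Δ.boundaryVertices with i ≠ j.1 ∧ i ≠ j.2,
        (β * χ (1 / regDist N (Q i) (Q j.1) (Q j.2)) + β * c) := by
    simp only [hT₃, hK, Finset.sum_add_distrib]
  have h3 : 0 ≤ T₃ + K := by
    rw [h3sum]
    exact Finset.sum_nonneg fun j _ => Finset.sum_nonneg fun i _ => h3term j i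
  refine ⟨by rw [hφ]; linarith, fun C hC => ?_⟩
  rw [hφ] at hC
  refine ⟨fun k => ?_, ?_, fun j hj i hi hij => ?_⟩
  · have : (1 / (NT : ℝ)) * (α₁ * invQuality Δ Q k) ≤ T₁ :=
      Finset.single_le_sum (f := fun k => (1 / (NT : ℝ)) * (α₁ * invQuality Δ Q k))
        (fun k _ => h1term k) (Finset.mem_univ k)
    have h5 : (1 / (NT : ℝ)) * (α₁ * invQuality Δ Q k) ≤ C + K := by linarith
    rw [le_div_iff₀ hα₁]
    rw [one_div, inv_mul_le_iff₀ hNT] at h5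
    linarith
  · have h5 : T₂ ≤ C + K := by linarith
    rwa [hT₂, div_le_iff₀ hsum] at h5
  · have hcard : 0 < (Δ.boundaryEdges.card : ℝ) * (Δ.boundaryVertices.card : ℝ) :=
      mul_pos (Nat.cast_pos.2 (Finset.card_pos.2 ⟨j, hj⟩)) (Nat.cast_pos.2 (Finset.card_pos.2 ⟨i, hi⟩))
    have e1 : β * χ (1 / regDist N (Q i) (Q j.1) (Q j.2)) + β * c ≤ T₃ + K := by
      rw [h3sum]
      refine le_trans ?_ (Finset.single_le_sum
        (f := fun j : Fin NV × Fin NV => ∑ i ∈ Δ.boundaryVertices with i ≠ j.1 ∧ i ≠ j.2,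
          (β * χ (1 / regDist N (Q i) (Q j.1) (Q j.2)) + β * c))
        (fun j _ => Finset.sum_nonneg fun i _ => h3term j i) hj)
      exact Finset.single_le_sum
        (f := fun i => (β * χ (1 / regDist N (Q i) (Q j.1) (Q j.2)) + β * c))
        (fun i _ => h3term j i) (Finset.mem_filter.2 ⟨hi, hij⟩)
    have e2 : β * χ (1 / regDist N (Q i) (Q j.1) (Q j.2)) ≤ C + K := by
      have : 0 ≤ β * c := mul_nonneg hβ0 hc0
      linarith
    rw [hβ, div_mul_eq_mul_div, div_le_iff₀ hcard] at e2
    rw [le_div_iff₀ hα₃]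
    linarith

/-- A limit of admissible meshes with bounded penalty is admissible. -/
theorem mem_plusManifold_of_penalty_le (hN : IsRegularizedOneNorm N) (hχ : ContinuousOn χ (Ici 0))
    {s₁ : ℝ} (hs : ∀ s, s₁ < s → χ s = s) (hα₁ : 0 < α₁) (hα₂ : 0 < α₂) (hα₃ : 0 < α₃)
    (hα₄ : 0 < α₄) {P : ℕ → Fin NV → Plane} (h : Tendsto P atTop (𝓝 Q))
    (hP : ∀ n, P n ∈ plusManifold Δ) {C : ℝ}
    (hC : ∀ n, penaltyCutOff Δ N χ α₁ α₂ α₃ α₄ Qref (P n) ≤ C) : Q ∈ plusManifold Δ := by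
  obtain ⟨K, hK⟩ := penaltyCutOff_bounds hN hχ hs hα₁ hα₂ hα₃ hα₄ Δ Qref
  have hb := fun n => (hK (P n) (hP n)).2 C (hC n)
  have hA0 : ∀ k, 0 ≤ triArea Δ Q k := fun k =>
    ge_of_tendsto (tendsto_triArea h k) (Eventually.of_forall fun n => ((hP n).2 k).le)
  -- With the denominator multiplied out, the quality bound passes to the limit even where the area
  -- might tend to zero.
  have hE : ∀ k, edgeLength Δ Q k 0 ^ 2 + edgeLength Δ Q k 1 ^ 2 + edgeLength Δ Q k 2 ^ 2 ≤
      NT * (C + K) / α₁ * (4 * √3 * triArea Δ Q k) := by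
    intro k
    refine le_of_tendsto_of_tendsto ((((tendsto_edgeLength h k 0).pow 2).add
      ((tendsto_edgeLength h k 1).pow 2)).add ((tendsto_edgeLength h k 2).pow 2))
      (tendsto_const_nhds.mul (tendsto_const_nhds.mul (tendsto_triArea h k)))
      (Eventually.of_forall fun n => ?_)
    have hpos : 0 < 4 * √3 * triArea Δ (P n) k := by
      have := (hP n).2 k
      positivity
    exact (div_le_iff₀ hpos).1 ((hb n).1 k)
  have hsum : α₂ ≤ (C + K) * ∑ k, triArea Δ Q k :=
    ge_of_tendsto (tendsto_const_nhds.mul (tendsto_finsetSum _ fun k _ => tendsto_triArea h k))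
      (Eventually.of_forall fun n => (hb n).2.1)
  obtain ⟨k₀, hk₀⟩ : ∃ k, 0 < triArea Δ Q k := by
    by_contra hcon
    push Not at hcon
    rw [Finset.sum_eq_zero fun k _ => le_antisymm (hcon k) (hA0 k), mul_zero] at hsum
    linarith
  -- If a neighbour of a nondegenerate triangle had zero area, `hE` would make all its edges zero,
  -- including the shared one.
  have hA : ∀ k, 0 < triArea Δ Q k := by
    refine Δ.tri_induction (fun k => 0 < triArea Δ Q k) (fun k k' l hk h1 h2 => ?_) hk₀
    refine lt_of_le_of_ne (hA0 k') fun hz => ?_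
    have hEk := hE k'
    rw [← hz, mul_zero, mul_zero] at hEk
    have hzero : ∀ l, edgeLength Δ Q k' l = 0 := by
      have n0 := sq_nonneg (edgeLength Δ Q k' 0)
      have n1 := sq_nonneg (edgeLength Δ Q k' 1)
      have n2 := sq_nonneg (edgeLength Δ Q k' 2)
      intro l
      refine pow_eq_zero_iff (two_ne_zero) |>.1 (le_antisymm ?_ (sq_nonneg _))
      fin_cases l <;> simp only [Fin.zero_eta, Fin.mk_one, Fin.reduceFinMk] <;> linarith
    have heq : Q (Δ.tri k' (l + 1)) = Q (Δ.tri k' (l + 2)) :=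
      sub_eq_zero.1 (norm_eq_zero.1 (hzero l))
    obtain ⟨m₁, e1⟩ := Δ.mem_verts.1 h1
    obtain ⟨m₂, e2⟩ := Δ.mem_verts.1 h2
    rw [← e1, ← e2] at heq
    have hm : m₁ = m₂ := by
      by_contra hne
      have f1 := bary_corner hk m₁ m₁
      rw [heq, bary_corner hk, if_neg hne] at f1
      simp at f1
    rw [← hm, e1] at e2
    exact (Fin.three_ne l).2.2 (Δ.tri_injective k' e2)
  refine mem_plusManifold_of_tendsto h hP hA fun a b he i hi hseg => ?_
  by_contra hne
  push Not at hne
  obtain ⟨k, l, heq, hj⟩ := he.exists_eq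
  set j : Fin NV × Fin NV := (Δ.tri k l, Δ.tri k (l + 1)) with hjdef
  have hij : i ≠ j.1 ∧ i ≠ j.2 := by
    have hni : i ∉ ({a, b} : Finset (Fin NV)) := by simp [hne.1, hne.2]
    rw [heq] at hni
    simpa using hni
  have hseg' : Q i ∈ segment ℝ (Q j.1) (Q j.2) := by
    have himg : Q '' (({a, b} : Finset (Fin NV)) : Set (Fin NV)) = Q '' ({j.1, j.2} : Finset _) := by
      rw [heq]
    simp only [Finset.coe_insert, Finset.coe_singleton, image_pair] at himg
    rwa [← convexHull_pair, ← himg, convexHull_pair]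
  rw [segment_eq_image_lineMap] at hseg'
  obtain ⟨θ, hθ, hθQ⟩ := hseg'
  set D := (C + K) * ((Δ.boundaryEdges.card : ℝ) * (Δ.boundaryVertices.card : ℝ)) / α₃ with hD
  -- Beyond `s₁` the cut-off is the identity, so `1 / regDist` is at most `s₁` or at most `D`; the
  -- entry `1` keeps the maximum positive. Passing to Euclidean distances makes the bound survive in
  -- the limit without continuity of `regDist` at a possibly degenerate edge.
  have hlow : ∀ n, 1 / (max s₁ (max D 1)) ≤ 2 * ‖P n i - AffineMap.lineMap (P n j.1) (P n j.2) θ‖ := by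
    intro n
    have hpos := regDist_pos_of_mem_plusManifold hN (hP n) hj hi hij
    have hle : regDist N (P n i) (P n j.1) (P n j.2) ≤ _ := regDist_le hN
      (q := AffineMap.lineMap (P n j.1) (P n j.2) θ)
      (by rw [segment_eq_image_lineMap]; exact ⟨θ, hθ, rfl⟩)
    refine le_trans ?_ hle
    have hbd := (hb n).2.2 j hj i hi hij
    have hinv : 1 / regDist N (P n i) (P n j.1) (P n j.2) ≤ max s₁ (max D 1) := by
      by_cases hcase : 1 / regDist N (P n i) (P n j.1) (P n j.2) ≤ s₁
      · exact hcase.trans (le_max_left _ _)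
      · push Not at hcase
        rw [hs _ hcase] at hbd
        exact hbd.trans ((le_max_left _ _).trans (le_max_right _ _))
    rw [one_div_le (lt_of_lt_of_le one_pos ((le_max_right _ _).trans (le_max_right _ _))) hpos]
    exact hinv
  have hlim : Tendsto (fun n => 2 * ‖P n i - AffineMap.lineMap (P n j.1) (P n j.2) θ‖) atTop
      (𝓝 (2 * ‖Q i - AffineMap.lineMap (Q j.1) (Q j.2) θ‖)) := by
    have hp : ∀ i, Tendsto (fun n => P n i) atTop (𝓝 (Q i)) := tendsto_pi_nhds.1 h
    simp only [AffineMap.lineMap_apply_module]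
    exact tendsto_const_nhds.mul ((hp i).sub
      ((tendsto_const_nhds.smul (hp _)).add (tendsto_const_nhds.smul (hp _)))).norm
  have := ge_of_tendsto hlim (Eventually.of_forall hlow)
  rw [hθQ, sub_self, norm_zero, mul_zero] at this
  have hpos : 0 < 1 / (max s₁ (max D 1)) := one_div_pos.2
    (lt_of_lt_of_le one_pos ((le_max_right _ _).trans (le_max_right _ _)))
  linarith

end Penalty

/-! ### Existence of an optimal mesh. -/

section Existence

variable {NV NT : ℕ} {Δ : OrientedConnectivityComplex NV NT}

theorem convex_box (a₁ a₂ b₁ b₂ : ℝ) : Convex ℝ (box a₁ a₂ b₁ b₂) := by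
  have h0 := (convex_Icc a₁ a₂).linear_preimage (EuclideanSpace.projₗ (𝕜 := ℝ) (0 : Fin 2))
  have h1 := (convex_Icc b₁ b₂).linear_preimage (EuclideanSpace.projₗ (𝕜 := ℝ) (1 : Fin 2))
  exact h0.inter h1

theorem isCompact_box (a₁ a₂ b₁ b₂ : ℝ) : IsCompact (box a₁ a₂ b₁ b₂) := by
  have hc : Continuous fun p : ℝ × ℝ => (!₂[p.1, p.2] : Plane) := by fun_prop
  have : box a₁ a₂ b₁ b₂ = (fun p : ℝ × ℝ => (!₂[p.1, p.2] : Plane)) '' (Icc a₁ a₂ ×ˢ Icc b₁ b₂) := by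
    ext x
    constructor
    · rintro ⟨h0, h1⟩
      exact ⟨(x 0, x 1), ⟨h0, h1⟩, plane_ext rfl rfl⟩
    · rintro ⟨p, ⟨h0, h1⟩, rfl⟩
      exact ⟨h0, h1⟩
  rw [this]
  exact (isCompact_Icc.prod isCompact_Icc).image hc

/-- An admissible limit of meshes of the manifold belongs to the manifold. -/
theorem mem_planarManifold_of_tendsto {Qref Q : Fin NV → Plane} {P : ℕ → Fin NV → Plane}
    (h : Tendsto P atTop (𝓝 Q)) (hP : ∀ n, P n ∈ planarManifold Δ Qref) (hQ : Q ∈ plusManifold Δ) :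
    Q ∈ planarManifold Δ Qref := by
  -- A ball of admissible meshes around `Q` contains some `P n`, and the segment between them
  -- extends the path.
  obtain ⟨ε, hε, hball⟩ := Metric.isOpen_iff.1 (isOpen_plusManifold (Δ := Δ)) Q hQ
  obtain ⟨n, hn⟩ := (h.eventually (Metric.ball_mem_nhds Q hε)).exists
  refine ⟨hQ, JoinedIn.trans (JoinedIn.of_segment_subset ?_) (hP n).2⟩
  exact ((convex_ball Q ε).segment_subset (Metric.mem_ball_self hε) hn).trans hball

theorem objective_of_mem {D : Set (Fin NV → Plane)} {φ : (Fin NV → Plane) → ℝ}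
    {Q : Fin NV → Plane} (hQ : Q ∈ D) (y : Plane → ℝ) :
    objective Δ D φ Q y = ((∫ x in meshDomain Δ Q, y x) + φ Q : ℝ) := by
  rw [objective, optIndicator, if_pos hQ, add_zero, EReal.coe_add]

theorem objective_of_notMem {D : Set (Fin NV → Plane)} {φ : (Fin NV → Plane) → ℝ}
    {Q : Fin NV → Plane} (hQ : Q ∉ D) (y : Plane → ℝ) : objective Δ D φ Q y = ⊤ := by
  rw [objective, optIndicator, if_neg hQ, EReal.coe_add_top, EReal.top_add_coe]

theorem exists_optimal_mesh (Δ : OrientedConnectivityComplex NV NT) (Qref : Fin NV → Plane)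
    {N : ℝ × ℝ → ℝ} (hN : IsRegularizedOneNorm N) {χ : ℝ → ℝ} (hχ : ContinuousOn χ (Ici 0)) {s₁ : ℝ}
    (hs : ∀ s, s₁ < s → χ s = s) {α₁ α₂ α₃ α₄ : ℝ} (hα₁ : 0 < α₁) (hα₂ : 0 < α₂) (hα₃ : 0 < α₃)
    (hα₄ : 0 < α₄) {a₁ a₂ b₁ b₂ : ℝ} (hD : Qref ∈ holdAll Δ Qref a₁ a₂ b₁ b₂)
    {r : Plane → ℝ} (hr : MemLp r ∞ (volume.restrict (box a₁ a₂ b₁ b₂))) :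
    ∃ Q ∈ holdAll Δ Qref a₁ a₂ b₁ b₂, ∃ y : Plane → ℝ, IsDiscreteState Δ r Q y ∧
      ∀ Q' ∈ holdAll Δ Qref a₁ a₂ b₁ b₂, ∀ y' : Plane → ℝ, IsDiscreteState Δ r Q' y' →
        (∫ x in meshDomain Δ Q, y x) + penaltyCutOff Δ N χ α₁ α₂ α₃ α₄ Qref Q ≤
          (∫ x in meshDomain Δ Q', y' x) + penaltyCutOff Δ N χ α₁ α₂ α₃ α₄ Qref Q' := by
  set B := box a₁ a₂ b₁ b₂ with hB
  set φ := penaltyCutOff Δ N χ α₁ α₂ α₃ α₄ Qref with hφ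
  have hBc := isCompact_box a₁ a₂ b₁ b₂
  have hBconv := convex_box a₁ a₂ b₁ b₂
  have hBm : MeasurableSet B := hBc.measurableSet
  have hBf : volume B ≠ ⊤ := hBc.measure_lt_top.ne
  have : IsFiniteMeasure (volume.restrict B) := ⟨by simpa using hBc.measure_lt_top⟩
  have hrB : IntegrableOn r B := hr.integrable le_top
  obtain ⟨M, hM0, hM⟩ : ∃ M : ℝ, 0 ≤ M ∧ ∀ᵐ x ∂volume.restrict B, |r x| ≤ M := by
    refine ⟨(eLpNorm r ∞ (volume.restrict B)).toReal, ENNReal.toReal_nonneg, ?_⟩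
    have h1 := hr.eLpNorm_lt_top
    filter_upwards [enorm_ae_le_eLpNormEssSup r (volume.restrict B)] with x hx
    rw [← eLpNorm_exponent_top] at hx
    have := ENNReal.toReal_mono h1.ne hx
    simpa using this
  set R := |a₁| + |a₂| with hR
  have hR0 : 0 ≤ R := by positivity
  have hRB : ∀ x ∈ B, |x 0| ≤ R := by
    rintro x ⟨⟨h0, h1⟩, -⟩
    refine abs_le.2 ⟨?_, ?_⟩
    · linarith [neg_abs_le a₁, abs_nonneg a₂]
    · linarith [le_abs_self a₂, abs_nonneg a₁]
  set S := {p : (Fin NV → Plane) × (Plane → ℝ) | p.1 ∈ holdAll Δ Qref a₁ a₂ b₁ b₂ ∧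
    IsDiscreteState Δ r p.1 p.2} with hS
  set f : (Fin NV → Plane) × (Plane → ℝ) → ℝ := fun p => (∫ x in meshDomain Δ p.1, p.2 x) + φ p.1
    with hf
  have hplus : ∀ p ∈ S, (∀ k, 0 < triArea Δ p.1 k) ∧ WeightsAgree Δ p.1 := fun p hp =>
    mem_plusManifold_iff.1 hp.1.1.1
  have hsub : ∀ p ∈ S, meshDomain Δ p.1 ⊆ B := fun p hp => meshDomain_subset hBconv hp.1.2
  have hmean : ∀ p ∈ S, ∫ x in meshDomain Δ p.1, p.2 x = load Δ (fun _ => 1) p.1 (p.2 ∘ p.1) :=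
    fun p hp => integral_eq_load_one (hplus p hp).1 (hplus p hp).2 hp.2.1.1
  have hzero : ∀ p ∈ S, ∀ i ∈ Δ.boundaryVertices, (p.2 ∘ p.1) i = 0 := fun p hp =>
    hp.2.1.nodal_eq_zero (hplus p hp).1 (hplus p hp).2
  have hnodal : ∀ p ∈ S, ∀ v : Fin NV → ℝ, (∀ i ∈ Δ.boundaryVertices, v i = 0) →
      stiffness Δ p.1 (p.2 ∘ p.1) v = load Δ r p.1 v := fun p hp v hv =>
    hp.2.nodal (hplus p hp).1 (hplus p hp).2 (hrB.mono_set (hsub p hp)) hv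
  have hener := fun p hp => energy_bound (hplus p hp).1 (hplus p hp).2 hBf (hsub p hp) hR0 hM0 hRB
    hrB hM (hzero p hp) (hnodal p hp _ (hzero p hp))
  set E := M * R ^ 2 * volume.real B with hE
  obtain ⟨K, hK⟩ := penaltyCutOff_bounds hN hχ hs hα₁ hα₂ hα₃ hα₄ Δ Qref
  have hbelow : BddBelow (f '' S) := by
    refine ⟨-E - K, ?_⟩
    rintro _ ⟨p, hp, rfl⟩
    have h1 := (abs_le.1 (hener p hp).2).1
    have h2 := (hK p.1 hp.1.1.1).1
    simp only [hf, hmean p hp]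
    linarith
  have hne : (f '' S).Nonempty := by
    obtain ⟨hA, hW⟩ := mem_plusManifold_iff.1 hD.1.1
    have hrQ : IntegrableOn r (meshDomain Δ Qref) :=
      hrB.mono_set (meshDomain_subset hBconv hD.2)
    obtain ⟨u, hu, huv⟩ := exists_nodal_solution hA hrQ
    exact ⟨_, (Qref, interp Δ Qref u), ⟨hD, isDiscreteState_interp hA hW hrQ hu huv⟩, rfl⟩
  obtain ⟨t, ht_anti, ht, htS⟩ := exists_seq_tendsto_sInf hne hbelow
  choose p hpS hpt using htS
  -- Compactness of the vertex positions comes from the box alone.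
  have hcomp : IsCompact {Q : Fin NV → Plane | ∀ i, Q i ∈ B} := by
    have := isCompact_univ_pi (fun _ : Fin NV => hBc)
    simpa [Set.pi] using this
  obtain ⟨Q, hQB, σ, hσ, hσQ⟩ := hcomp.tendsto_subseq (x := fun n => (p n).1) fun n => (hpS n).1.2
  have hP : ∀ n, (p (σ n)).1 ∈ planarManifold Δ Qref := fun n => (hpS (σ n)).1.1
  -- The mean of a state is at least `-E`, so bounded objective values along the minimizing sequence
  -- bound the penalty.
  have hφC : ∀ n, φ (p (σ n)).1 ≤ t 0 + E := by
    intro n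
    have h1 : f (p (σ n)) ≤ t 0 := by rw [hpt]; exact ht_anti (Nat.zero_le _)
    have h2 := (abs_le.1 (hener _ (hpS (σ n))).2).1
    simp only [hf, hmean _ (hpS (σ n))] at h1
    linarith
  have hQplus : Q ∈ plusManifold Δ := mem_plusManifold_of_penalty_le hN hχ hs hα₁ hα₂ hα₃ hα₄ hσQ
    (fun n => (hP n).1) hφC
  have hQman : Q ∈ planarManifold Δ Qref := mem_planarManifold_of_tendsto hσQ hP hQplus
  obtain ⟨hA, hW⟩ := mem_plusManifold_iff.1 hQplus
  obtain ⟨C, hC⟩ := exists_bound_of_energy (U := fun n => (p (σ n)).2 ∘ (p (σ n)).1) hσQ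
    (fun n => (hplus _ (hpS (σ n))).1) hA hBconv hBm hBf (fun n => (hpS (σ n)).1.2)
    (fun n => hzero _ (hpS (σ n))) (fun n => (hener _ (hpS (σ n))).1)
  have hUball : ∃ᶠ n in atTop, (p (σ n)).2 ∘ (p (σ n)).1 ∈ Icc (fun _ : Fin NV => -C) fun _ => C :=
    (hC.mono fun n hn => ⟨fun i => (abs_le.1 (hn i)).1, fun i => (abs_le.1 (hn i)).2⟩).frequently
  obtain ⟨u, -, τ, hτ, hτu⟩ := isCompact_Icc.tendsto_subseq' hUball
  have hPτ : Tendsto (fun n => (p (σ (τ n))).1) atTop (𝓝 Q) := hσQ.comp hτ.tendsto_atTop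
  have hUτ : Tendsto (fun n => (p (σ (τ n))).2 ∘ (p (σ (τ n))).1) atTop (𝓝 u) := hτu
  have hAτ : ∀ n k, 0 < triArea Δ (p (σ (τ n))).1 k := fun n => (hplus _ (hpS _)).1
  have hBτ : ∀ n i, (p (σ (τ n))).1 i ∈ B := fun n => (hpS _).1.2
  have hu0 : ∀ i ∈ Δ.boundaryVertices, u i = 0 := fun i hi =>
    tendsto_nhds_unique (tendsto_pi_nhds.1 hUτ i)
      (tendsto_const_nhds.congr fun n => (hzero _ (hpS (σ (τ n))) i hi).symm)
  -- For a fixed nodal test vector both sides of the discrete equation converge, so the limit nodal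
  -- values solve the system on the limit mesh.
  have huv : ∀ v : Fin NV → ℝ, (∀ i ∈ Δ.boundaryVertices, v i = 0) →
      stiffness Δ Q u v = load Δ r Q v := fun v hv =>
    tendsto_nhds_unique (tendsto_stiffness hPτ hUτ tendsto_const_nhds hAτ hA hBconv hBm hBf hBτ)
      ((tendsto_load hPτ tendsto_const_nhds hAτ hA hBconv hBm hBτ hrB).congr fun n =>
        (hnodal _ (hpS (σ (τ n))) v hv).symm)
  have hstate : IsDiscreteState Δ r Q (interp Δ Q u) :=
    isDiscreteState_interp hA hW (hrB.mono_set (meshDomain_subset hBconv hQB)) hu0 huv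
  have hSQ : (Q, interp Δ Q u) ∈ S := ⟨⟨hQman, hQB⟩, hstate⟩
  have hval : f (Q, interp Δ Q u) = sInf (f '' S) := by
    have h1 : Tendsto (fun n => f (p (σ (τ n)))) atTop (𝓝 (sInf (f '' S))) := by
      simp only [hpt]
      exact ht.comp (hσ.tendsto_atTop.comp hτ.tendsto_atTop)
    have h2 : Tendsto (fun n => f (p (σ (τ n)))) atTop (𝓝 (f (Q, interp Δ Q u))) := by
      simp only [hf, hmean _ hSQ, hmean _ (hpS _)]
      have huQ : interp Δ Q u ∘ Q = u := funext fun i => interp_vertex hA hW u i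
      rw [huQ]
      exact (tendsto_load hPτ hUτ hAτ hA hBconv hBm hBτ (integrableOn_const hBf)).add
        (tendsto_penaltyCutOff hN hχ hPτ hQplus)
    exact tendsto_nhds_unique h2 h1
  refine ⟨Q, ⟨hQman, hQB⟩, interp Δ Q u, hstate, fun Q' hQ' y' hy' => ?_⟩
  have : f (Q, interp Δ Q u) ≤ f (Q', y') := by
    rw [hval]
    exact csInf_le hbelow ⟨(Q', y'), ⟨hQ', hy'⟩, rfl⟩
  exact this

end Existence

theorem proposition3p5 {NV NT : ℕ} (Δ : OrientedConnectivityComplex NV NT)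
    (Qref : Fin NV → Plane) (hQref : Qref ∈ plusManifold Δ)
    (N : ℝ × ℝ → ℝ) (hN : IsRegularizedOneNorm N)
    (α₁ α₂ α₃ α₄ : ℝ) (hα₁ : 0 < α₁) (hα₂ : 0 < α₂) (hα₃ : 0 < α₃) (hα₄ : 0 < α₄)
    (φ : (Fin NV → Plane) → ℝ)
    (hφ : φ = penalty Δ N α₁ α₂ α₃ α₄ Qref ∨
      ∃ χ : ℝ → ℝ, IsCutOff χ ∧ φ = penaltyCutOff Δ N χ α₁ α₂ α₃ α₄ Qref)
    (a₁ a₂ b₁ b₂ : ℝ) (ha : a₁ < a₂) (hb : b₁ < b₂)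
    (hD : Qref ∈ holdAll Δ Qref a₁ a₂ b₁ b₂)
    (r : Plane → ℝ) (hr : MemLp r ∞ (volume.restrict (box a₁ a₂ b₁ b₂))) :
    ∃ Q ∈ planarManifold Δ Qref, ∃ y : Plane → ℝ, IsDiscreteState Δ r Q y ∧
      objective Δ (holdAll Δ Qref a₁ a₂ b₁ b₂) φ Q y < ⊤ ∧
      ∀ Q' ∈ planarManifold Δ Qref, ∀ y' : Plane → ℝ, IsDiscreteState Δ r Q' y' →
        objective Δ (holdAll Δ Qref a₁ a₂ b₁ b₂) φ Q y ≤
          objective Δ (holdAll Δ Qref a₁ a₂ b₁ b₂) φ Q' y' := by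
  -- Only continuity of `χ` on `[0, ∞)` and `χ s = s` for large `s` matter; without cut-off, `χ =
  -- id` and `s₁ = 0` serve.
  obtain ⟨χ, s₁, hχ, hs, rfl⟩ : ∃ (χ : ℝ → ℝ) (s₁ : ℝ), ContinuousOn χ (Ici 0) ∧
      (∀ s, s₁ < s → χ s = s) ∧ φ = penaltyCutOff Δ N χ α₁ α₂ α₃ α₄ Qref := by
    rcases hφ with h | ⟨χ, hχ, h⟩
    · exact ⟨id, 0, continuousOn_id, fun _ _ => rfl, h.trans penalty_eq_penaltyCutOff⟩
    · obtain ⟨-, s₀, s₁, -, -, -, hs⟩ := id hχ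
      exact ⟨χ, s₁, hχ.1.continuousOn, hs, h⟩
  obtain ⟨Q, hQ, y, hy, hmin⟩ :=
    exists_optimal_mesh Δ Qref hN hχ hs hα₁ hα₂ hα₃ hα₄ hD hr
  refine ⟨Q, hQ.1, y, hy, ?_, fun Q' hQ' y' hy' => ?_⟩
  · rw [objective_of_mem hQ]
    exact EReal.coe_lt_top _
  · by_cases hQD : Q' ∈ holdAll Δ Qref a₁ a₂ b₁ b₂
    · rw [objective_of_mem hQ, objective_of_mem hQD]
      exact EReal.coe_le_coe_iff.2 (hmin Q' hQD y' hy')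
    · rw [objective_of_notMem hQD]
      exact le_top
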